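/- Let $n\ge 0$, $D=2n$, $\theta\in\mathbb R\setminus\{0\}$, and let $\Theta=\theta\,\mathrm{diag}(J,\dots,J)$ with $n$ blocks $J=\begin{pmatrix}0&-1\\1&0\end{pmatrix}$. For Schwartz functions $a,b\in\mathcal S=\mathcal S(\mathbb R^D)$ put $$(a\star b)(x)=\frac1{(\pi\theta)^D}\int\!\!\int a(x+y)\,b(x+z)\,e^{-2i\,y\Theta^{-1}z}\,dy\,dz .$$ For a tempered distribution $T$ put $\langle T\star a,b\rangle=\langle T,a\star b\rangle$, $\langle a\star T,b\rangle=\langle T,b\star a\rangle$. Let $\mathcal M$ be the Moyal algebra, i.e. the space of tempered distributions $T$ with $a\star T\in\mathcal S$ and $T\star a\in\mathcal S$ for all $a\in\mathcal S$, with the product $\langle T\star S,a\rangle=\langle T,S\star a\rangle$. Write $[a,b]_\star=a\star b-b\star a$ and $\mathrm{Ad}_P(a)=[P,a]_\star$. Let $\mathcal G_2$ be the set of derivations $\mathrm{Ad}_P$ of $\mathcal M$ with $P$ a complex polynomial function of degree $\le 2$, and let $\eta(\mathrm{Ad}_P)=P-P(0)$. Put $\xi_\mu=-\sum_\nu\Theta^{-1}_{\mu\nu}x_\nu$,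 $\eta_\mu=i\xi_\mu$, $\eta_{(\mu\nu)}=i\,\xi_\mu\xi_\nu$ (commutative product), $\partial_\mu=\mathrm{Ad}_{\eta_\mu}$, $X_{(\mu\nu)}=\mathrm{Ad}_{\eta_{(\mu\nu)}}$. A connection (on the right module $\mathcal M$, for the calculus based on $\mathcal G_2$) assigns to each $X\in\mathcal G_2$, $\mathbb C$-linearly in $X$, a $\mathbb C$-linear map $\nabla_X:\mathcal M\to\mathcal M$ with $\nabla_X(m\star a)=m\star X(a)+\nabla_X(m)\star a$. Its curvature is $F(X,Y)=[\nabla_X,\nabla_Y]-\nabla_{[X,Y]}$. The canonical connection is $\nabla^{\rm inv}_X(a)=X(a)-\eta(X)\star a$, and the covariant coordinates of $\nabla$ are $\mathcal A(X)=\nabla_X(1)+\eta(X)$, with $\mathcal A_\mu=\mathcal A(\partial_\mu)$, $\mathcal A_{(\mu\nu)}=\mathcal A(X_{(\mu\nu)})$. An element of $\mathcal M$ in the place of an operator on $\mathcal M$ stands for left $\star$-multiplication by it. Then the following hold. 1. The product of two Schwartz functions is a Schwartz function, and $(\mathcal M,\star)$ is a well-defined associative algebra with unit $1$ that contains the polynomial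 functions of degree $\le2$. 2. $\mathcal G_2$ is the complex linear span of the $\partial_\mu$ and $X_{(\mu\nu)}$ and is closed under the bracket $[X,Y]=XY-YX$. The map $\eta$ is well defined, and $X=\mathrm{Ad}_{\eta(X)}$ for all $X\in\mathcal G_2$. 3. $\eta(\mathcal G_2)$ is the complex linear span of the $\eta_\mu,\eta_{(\mu\nu)}$. The real linear span of the $\eta_\mu,\eta_{(\mu\nu)}$, with the bracket $(P,Q)\mapsto\eta([\mathrm{Ad}_P,\mathrm{Ad}_Q])$ transported from $\mathcal G_2$ by $\eta$, is a Lie algebra isomorphic to $isp(2n,\mathbb R)=sp(2n,\mathbb R)\ltimes\mathbb R^{2n}$. 4. For every connection $\nabla$ one has $\nabla_X(a)=\nabla^{\rm inv}_X(a)+\mathcal A(X)\star a$, and for all indices $$F(\partial_\mu,\partial_\nu)=[\mathcal A_\mu,\mathcal A_\nu]_\star-i\Theta^{-1}_{\mu\nu},$$ $$F(\partial_\mu,X_{(\rho\sigma)})=[\mathcal A_\mu,\mathcal A_{(\rho\sigma)}]_\star-\Theta^{-1}_{\mu\rho}\mathcal A_\sigma-\Theta^{-1}_{\mu\sigma}\mathcal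 A_\rho,$$ $$F(X_{(\mu\nu)},X_{(\rho\sigma)})=[\mathcal A_{(\mu\nu)},\mathcal A_{(\rho\sigma)}]_\star+\Theta^{-1}_{\rho\nu}\mathcal A_{(\mu\sigma)}+\Theta^{-1}_{\sigma\nu}\mathcal A_{(\mu\rho)}+\Theta^{-1}_{\rho\mu}\mathcal A_{(\nu\sigma)}+\Theta^{-1}_{\sigma\mu}\mathcal A_{(\nu\rho)}.$$ 5. $\nabla^{\rm inv}$ is a connection, and its curvature satisfies $F^{\rm inv}(\partial_\mu,\partial_\nu)=-i\Theta^{-1}_{\mu\nu}$, $F^{\rm inv}(\partial_\mu,X_{(\rho\sigma)})=0$ and $F^{\rm inv}(X_{(\mu\nu)},X_{(\rho\sigma)})=0$. -/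

import Mathlib

open scoped SchwartzMap

namespace Moyal

/-- The index set of the coordinates of `ℝ^D`, with `D = 2 n` elements. The pair `(j, k)` is the
`j`-th coordinate of the `k`-th symplectic plane. -/
abbrev Idx (n : ℕ) : Type := Fin 2 × Fin n

/-- The space `ℝ^D`, `D = 2 n`. -/
abbrev Space (n : ℕ) : Type := EuclideanSpace ℝ (Idx n)

/-- The skew-symmetric matrix `Θ = θ diag(J, …, J)` with `n` blocks `J = (0, -1; 1, 0)`. -/
noncomputable def Theta (n : ℕ) (θ : ℝ) : Matrix (Idx n) (Idx n) ℝ :=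
  θ • Matrix.blockDiagonal (fun _ : Fin n => (!![0, -1; 1, 0] : Matrix (Fin 2) (Fin 2) ℝ))

/-- The bilinear form `y Θ⁻¹ z`. -/
noncomputable def thetaInvForm (n : ℕ) (θ : ℝ) (y z : Space n) : ℝ :=
  ∑ μ, ∑ ν, y μ * (Theta n θ)⁻¹ μ ν * z ν

/-- The integral defining the Moyal product:
`(a ⋆ b)(x) = (π θ)^{-D} ∫∫ a(x + y) b(x + z) exp(-2 i y Θ⁻¹ z) dy dz`. -/
noncomputable def starIntegral (n : ℕ) (θ : ℝ) (a b : 𝓢(Space n, ℂ)) (x : Space n) : ℂ :=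
  (((Real.pi * θ) ^ (2 * n) : ℝ) : ℂ)⁻¹ *
    ∫ y : Space n, ∫ z : Space n,
      a (x + y) * b (x + z) * Complex.exp (-2 * Complex.I * (thetaInvForm n θ y z : ℂ))

open Classical in
/-- The Moyal product `𝓢 × 𝓢 → 𝓢`: the Schwartz function given by `starIntegral`. -/
noncomputable def star (n : ℕ) (θ : ℝ) (a b : 𝓢(Space n, ℂ)) : 𝓢(Space n, ℂ) :=
  if h : ∃ c : 𝓢(Space n, ℂ), ∀ x, c x = starIntegral n θ a b x then h.choose else 0

/-- `T ⋆ a = c` as tempered distributions, where `⟨T ⋆ a, b⟩ = ⟨T, a ⋆ b⟩`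
and `⟨c, b⟩ = ∫ c b`. -/
def StarRightEq (n : ℕ) (θ : ℝ) (T : 𝓢'(Space n, ℂ)) (a c : 𝓢(Space n, ℂ)) : Prop :=
  ∀ b : 𝓢(Space n, ℂ), T (star n θ a b) = (c : 𝓢'(Space n, ℂ)) b

/-- `a ⋆ T = c` as tempered distributions, where `⟨a ⋆ T, b⟩ = ⟨T, b ⋆ a⟩`
and `⟨c, b⟩ = ∫ c b`. -/
def StarLeftEq (n : ℕ) (θ : ℝ) (a : 𝓢(Space n, ℂ)) (T : 𝓢'(Space n, ℂ)) (c : 𝓢(Space n, ℂ)) :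
    Prop :=
  ∀ b : 𝓢(Space n, ℂ), T (star n θ b a) = (c : 𝓢'(Space n, ℂ)) b

/-- `𝓜_L`, the tempered distributions `T` with `a ⋆ T ∈ 𝓢` for all `a ∈ 𝓢`. -/
def leftMultipliers (n : ℕ) (θ : ℝ) : Submodule ℂ 𝓢'(Space n, ℂ) where
  carrier := {T | ∀ a, ∃ c, StarLeftEq n θ a T c}
  add_mem' {T S} hT hS a := by
    obtain ⟨c, hc⟩ := hT a
    obtain ⟨d, hd⟩ := hS a
    refine ⟨c + d, fun b => ?_⟩
    have h1 := hc b
    have h2 := hd b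
    rw [map_add]
    change T _ + S _ = _ + _
    rw [h1, h2]
    rfl
  zero_mem' a := ⟨0, fun b => by rw [map_zero]; rfl⟩
  smul_mem' k T hT a := by
    obtain ⟨c, hc⟩ := hT a
    refine ⟨k • c, fun b => ?_⟩
    have h1 := hc b
    rw [map_smul]
    change k • T _ = k • _
    rw [h1]
    rfl

/-- `𝓜_R`, the tempered distributions `T` with `T ⋆ a ∈ 𝓢` for all `a ∈ 𝓢`. -/
def rightMultipliers (n : ℕ) (θ : ℝ) : Submodule ℂ 𝓢'(Space n, ℂ) where
  carrier := {T | ∀ a, ∃ c, StarRightEq n θ T a c}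
  add_mem' {T S} hT hS a := by
    obtain ⟨c, hc⟩ := hT a
    obtain ⟨d, hd⟩ := hS a
    refine ⟨c + d, fun b => ?_⟩
    have h1 := hc b
    have h2 := hd b
    rw [map_add]
    change T _ + S _ = _ + _
    rw [h1, h2]
    rfl
  zero_mem' a := ⟨0, fun b => by rw [map_zero]; rfl⟩
  smul_mem' k T hT a := by
    obtain ⟨c, hc⟩ := hT a
    refine ⟨k • c, fun b => ?_⟩
    have h1 := hc b
    rw [map_smul]
    change k • T _ = k • _
    rw [h1]
    rfl

/-- The Moyal algebra `𝓜 = 𝓜_L ∩ 𝓜_R`, as a space of tempered distributions. -/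
abbrev Alg (n : ℕ) (θ : ℝ) : Type :=
  ↥(leftMultipliers n θ ⊓ rightMultipliers n θ)

/-- `U = T ⋆ S`, in the sense that `⟨U, a⟩ = ⟨T, S ⋆ a⟩` for all `a ∈ 𝓢`. -/
def IsProduct {n : ℕ} {θ : ℝ} (T S U : Alg n θ) : Prop :=
  ∀ a c : 𝓢(Space n, ℂ), StarRightEq n θ (S : 𝓢'(Space n, ℂ)) a c →
    (U : 𝓢'(Space n, ℂ)) a = (T : 𝓢'(Space n, ℂ)) c

open Classical in
/-- The product `⋆` of the Moyal algebra. -/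
noncomputable instance instMulAlg {n : ℕ} {θ : ℝ} : Mul (Alg n θ) where
  mul T S := if h : ∃ U, IsProduct T S U then h.choose else 0

/-- The polynomial function on `ℝ^D` given by a polynomial with complex coefficients. -/
noncomputable def polyFun {n : ℕ} (p : MvPolynomial (Idx n) ℂ) (x : Space n) : ℂ :=
  MvPolynomial.eval (fun μ => (x μ : ℂ)) p

theorem polyFun_hasTemperateGrowth {n : ℕ} (p : MvPolynomial (Idx n) ℂ) :
    (polyFun p).HasTemperateGrowth := by
  induction p using MvPolynomial.induction_on with
  | C c =>
    have : (polyFun (MvPolynomial.C c) : Space n → ℂ) = fun _ => c := by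
      funext x; simp [polyFun]
    rw [this]
    exact Function.HasTemperateGrowth.const c
  | add p q hp hq =>
    have : (polyFun (p + q) : Space n → ℂ) = polyFun p + polyFun q := by
      funext x; simp [polyFun]
    rw [this]
    exact hp.add hq
  | mul_X p μ hp =>
    have : (polyFun (p * MvPolynomial.X μ) : Space n → ℂ) =
        polyFun p * fun x => ((EuclideanSpace.proj μ : Space n →L[ℝ] ℝ) x : ℂ) := by
      funext x; simp [polyFun]
    rw [this]
    refine hp.mul ?_
    exact (Complex.ofRealCLM.comp
      (EuclideanSpace.proj μ : Space n →L[ℝ] ℝ)).hasTemperateGrowth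

/-- A polynomial function as a tempered distribution, `a ↦ ∫ a(x) p(x) dx`. -/
noncomputable def polyDist {n : ℕ} (p : MvPolynomial (Idx n) ℂ) : 𝓢'(Space n, ℂ) :=
  (polyFun_hasTemperateGrowth p).toTemperedDistribution MeasureTheory.volume

open Classical in
/-- A polynomial function as an element of the Moyal algebra. -/
noncomputable def poly {n : ℕ} (θ : ℝ) (p : MvPolynomial (Idx n) ℂ) : Alg n θ :=
  if h : polyDist p ∈ leftMultipliers n θ ⊓ rightMultipliers n θ then ⟨polyDist p, h⟩ else 0

/-- The unit of the Moyal algebra, the constant function `1`. -/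
noncomputable instance instOneAlg {n : ℕ} {θ : ℝ} : One (Alg n θ) where
  one := poly θ 1

/-- The Moyal bracket `[a, b]⋆ = a ⋆ b - b ⋆ a`. -/
noncomputable def comm {n : ℕ} {θ : ℝ} (a b : Alg n θ) : Alg n θ := a * b - b * a

/-- `X` is a derivation of `𝓜`. -/
structure IsDerivation {n : ℕ} {θ : ℝ} (X : Alg n θ → Alg n θ) : Prop where
  map_add : ∀ a b, X (a + b) = X a + X b
  map_smul : ∀ (k : ℂ) (a), X (k • a) = k • X a
  leibniz : ∀ a b, X (a * b) = X a * b + a * X b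

/-- The bracket `[X, Y] a = X (Y a) - Y (X a)`. -/
noncomputable def bracket {n : ℕ} {θ : ℝ} (X Y : Alg n θ → Alg n θ) : Alg n θ → Alg n θ :=
  fun a => X (Y a) - Y (X a)

/-- `Ad_P : a ↦ [P, a]⋆`. -/
noncomputable def Ad {n : ℕ} {θ : ℝ} (P : Alg n θ) : Alg n θ → Alg n θ := fun a => comm P a

/-- `𝓖₂`, the derivations `Ad_P` with `P` a polynomial function of degree at most `2`. -/
def G2 (n : ℕ) (θ : ℝ) : Set (Alg n θ → Alg n θ) :=
  {X | IsDerivation X ∧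
    ∃ p : MvPolynomial (Idx n) ℂ, p.totalDegree ≤ 2 ∧ X = Ad (poly θ p)}

open Classical in
/-- The map `η : 𝓖₂ → 𝓜`, `η(Ad_P) = P - P(0)` (only its values on `𝓖₂` matter). -/
noncomputable def eta {n : ℕ} {θ : ℝ} (X : Alg n θ → Alg n θ) : Alg n θ :=
  if h : ∃ p : MvPolynomial (Idx n) ℂ, p.totalDegree ≤ 2 ∧ X = Ad (poly θ p) then
    poly θ (h.choose - MvPolynomial.C (MvPolynomial.eval 0 h.choose))
  else 0

/-- The polynomial `ξ_μ = - ∑_ν Θ⁻¹_{μν} x_ν`. -/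
noncomputable def xi (n : ℕ) (θ : ℝ) (μ : Idx n) : MvPolynomial (Idx n) ℂ :=
  - ∑ ν, MvPolynomial.C (((Theta n θ)⁻¹ μ ν : ℝ) : ℂ) * MvPolynomial.X ν

/-- `i ξ_μ ∈ 𝓜`. -/
noncomputable def eta1 (n : ℕ) (θ : ℝ) (μ : Idx n) : Alg n θ :=
  poly θ (MvPolynomial.C Complex.I * xi n θ μ)

/-- `i ξ_μ ξ_ν ∈ 𝓜` (commutative product of polynomials). -/
noncomputable def eta2 (n : ℕ) (θ : ℝ) (μ ν : Idx n) : Alg n θ :=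
  poly θ (MvPolynomial.C Complex.I * (xi n θ μ * xi n θ ν))

/-- The derivation `∂_μ = Ad_{i ξ_μ}`. -/
noncomputable def D1 (n : ℕ) (θ : ℝ) (μ : Idx n) : Alg n θ → Alg n θ := Ad (eta1 n θ μ)

/-- The derivation `X_{(μν)} = Ad_{i ξ_μ ξ_ν}`. -/
noncomputable def D2 (n : ℕ) (θ : ℝ) (μ ν : Idx n) : Alg n θ → Alg n θ := Ad (eta2 n θ μ ν)

/-- `∇` is a connection on the right module `𝓜` for the differential calculus based on `𝓖₂`
(only its values on `𝓖₂` matter; the center of `𝓜` is `ℂ`). -/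
structure IsConnection {n : ℕ} {θ : ℝ}
    (nabla : (Alg n θ → Alg n θ) → Alg n θ → Alg n θ) : Prop where
  map_add : ∀ X ∈ G2 n θ, ∀ m m', nabla X (m + m') = nabla X m + nabla X m'
  map_smul : ∀ X ∈ G2 n θ, ∀ (k : ℂ) (m), nabla X (k • m) = k • nabla X m
  leibniz : ∀ X ∈ G2 n θ, ∀ m a, nabla X (m * a) = m * X a + nabla X m * a
  add_left : ∀ X ∈ G2 n θ, ∀ Y ∈ G2 n θ, ∀ m, nabla (X + Y) m = nabla X m + nabla Y m
  smul_left : ∀ X ∈ G2 n θ, ∀ (k : ℂ) (m), nabla (k • X) m = k • nabla X m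

/-- The curvature `F(X, Y) m = [∇_X, ∇_Y] m - ∇_{[X, Y]} m`. -/
noncomputable def curvature {n : ℕ} {θ : ℝ} (nabla : (Alg n θ → Alg n θ) → Alg n θ → Alg n θ)
    (X Y : Alg n θ → Alg n θ) (m : Alg n θ) : Alg n θ :=
  nabla X (nabla Y m) - nabla Y (nabla X m) - nabla (bracket X Y) m

/-- The canonical connection `∇^inv_X a = X(a) - η(X) ⋆ a`. -/
noncomputable def canonical {n : ℕ} {θ : ℝ} (X : Alg n θ → Alg n θ) (a : Alg n θ) : Alg n θ :=
  X a - eta X * a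

/-- The covariant coordinates `𝒜(X) = A(X) + η(X)`, where `A(X) = ∇_X(1)`. -/
noncomputable def covCoord {n : ℕ} {θ : ℝ}
    (nabla : (Alg n θ → Alg n θ) → Alg n θ → Alg n θ) (X : Alg n θ → Alg n θ) : Alg n θ :=
  nabla X 1 + eta X

attribute [local instance 100] LieRing.ofAssociativeRing

/-- The Lie algebra `isp(2n, ℝ) = sp(2n, ℝ) ⋉ ℝ^{2n}` of affine symplectic transformations,
as the matrices `(A, v; 0, 0)` with `A ∈ sp(2n, ℝ)` and `v ∈ ℝ^{2n}` a column. -/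
def isp (n : ℕ) : LieSubalgebra ℝ (Matrix ((Fin n ⊕ Fin n) ⊕ Unit) ((Fin n ⊕ Fin n) ⊕ Unit) ℝ) where
  carrier := {M | ∃ A ∈ LieAlgebra.Symplectic.sp (Fin n) ℝ,
    ∃ v : Matrix (Fin n ⊕ Fin n) Unit ℝ, M = Matrix.fromBlocks A v 0 0}
  add_mem' := by
    rintro _ _ ⟨A, hA, v, rfl⟩ ⟨B, hB, w, rfl⟩
    exact ⟨A + B, add_mem hA hB, v + w, by simp [Matrix.fromBlocks_add]⟩
  zero_mem' := ⟨0, zero_mem _, 0, by simp⟩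
  smul_mem' := by
    rintro k _ ⟨A, hA, v, rfl⟩
    exact ⟨k • A, Submodule.smul_mem _ k hA, k • v, by simp [Matrix.fromBlocks_smul]⟩
  lie_mem' := by
    rintro _ _ ⟨A, hA, v, rfl⟩ ⟨B, hB, w, rfl⟩
    refine ⟨⁅A, B⁆, LieSubalgebra.lie_mem _ hA hB, A * w - B * v, ?_⟩
    simp [Ring.lie_def, Matrix.fromBlocks_multiply, sub_eq_add_neg, Matrix.fromBlocks_neg,
      Matrix.fromBlocks_add]

end Moyal

/-! With B = πΘ, the substitution y = -Bw turns the Moyal integral into the single integral (a ⋆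
b)(x) = ∫ exp(2πi⟨w,x⟩) a(x - Bw) (𝓕 b)(w) dw. Since B is skew, Fourier inversion and Fubini give
the mirror formula with b(x + Bw) (𝓕 a)(w), then associativity and the trace identity ∫ a ⋆ b = ∫ ab
(`twistedMul_eq_twist`, `twistedMul_assoc`, `integral_twistedMul`). That the product is Schwartz
follows from a closure argument: the span of all such integrals consists of bounded functions and is
stable under derivatives and multiplication by linear forms.

By the trace identity the product dualises to distributions. The delicate point is that a ↦ ⟨T, S ⋆
a⟩ is continuous. It is a pointwise limit of continuous functionals along an approximate right unit,
so Banach–Steinhaus applies, the Schwartz space being complete metrizable and hence Baire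
(`exists_continuous_product`). The same approximate unit gives 1 ⋆ T = T.

For polynomials, P ⋆ ξ_μ and ξ_μ ⋆ P equal ξ_μ P ± (i/2) ∂_μ P. Their sum shows by induction that
polynomials are multipliers; their difference is [P, ξ_μ] = i ∂_μ P (`comm_poly_xi`), so Ad_P
determines P up to a constant and η is well defined. All brackets of the generators follow from the
Leibniz rule.

The Leibniz rule of a connection at m = 1 gives ∇_X m = 𝒜(X) m - m η(X). Left and right
multiplications commute, so the curvature is left multiplication by [𝒜(X), 𝒜(Y)] - 𝒜([X,Y]) plus
right multiplication by η([X,Y]) - [η(X), η(Y)] (`IsConnection.curvature_eq`). On the generators the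
second term vanishes except for two translations, where it is the scalar -iΘ⁻¹.

For isp(2n, ℝ), an affine symplectic matrix is sent to the real combination of the η's whose Ad acts
affinely on the ξ's (`comm_ispPoly_xi`). Brackets are compared on the ξ's by the Jacobi identity. -/

namespace SchwartzMap

/-! ### Membership, convergence and completeness in the Schwartz space -/

open Filter Topology LineDeriv

variable {V : Type*} [NormedAddCommGroup V] [InnerProductSpace ℝ V]

/-- Multiplication of a Schwartz function by the linear form `⟪·, v⟫`. -/
noncomputable def coordMul (v : V) : 𝓢(V, ℂ) →L[ℂ] 𝓢(V, ℂ) :=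
  smulLeftCLM ℂ (fun x => ((inner ℝ x v : ℝ) : ℂ))

theorem hasTemperateGrowth_inner_ofReal (v : V) :
    (fun x : V => ((inner ℝ x v : ℝ) : ℂ)).HasTemperateGrowth :=
  (Complex.ofRealCLM.comp ((innerSL ℝ).flip v)).hasTemperateGrowth

@[simp]
theorem coordMul_apply (v : V) (f : 𝓢(V, ℂ)) (x : V) :
    coordMul v f x = ((inner ℝ x v : ℝ) : ℂ) * f x := by
  rw [coordMul, smulLeftCLM_apply_apply (hasTemperateGrowth_inner_ofReal v), smul_eq_mul]

section Functions

variable [FiniteDimensional ℝ V]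

/-- The map that takes `c` to the linear form `c ⟪v, ·⟫`. -/
noncomputable def innerSmul (v : V) : ℂ →L[ℝ] V →L[ℝ] ℂ :=
  ContinuousLinearMap.smulRightL ℝ V ℂ (innerSL ℝ v)

theorem contDiff_of_closed_fderiv {G : Set (V → ℂ)} (hd : ∀ g ∈ G, Differentiable ℝ g)
    (hG : ∀ g ∈ G, ∀ v, (fun x => fderiv ℝ g x v) ∈ G) {g : V → ℂ} (hg : g ∈ G) (n : ℕ) :
    ContDiff ℝ n g := by
  induction n generalizing g with
  | zero => exact contDiff_zero.2 (hd g hg).continuous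
  | succ n ih =>
    push_cast
    rw [contDiff_succ_iff_fderiv]
    refine ⟨hd g hg, by simp, ?_⟩
    rw [contDiff_clm_apply_iff]
    exact fun v => ih (hG g hg v)

theorem fderiv_eq_sum_stdOrthonormalBasis (g : V → ℂ) (x : V) :
    fderiv ℝ g x = ∑ i, innerSmul (stdOrthonormalBasis ℝ V i)
      (fderiv ℝ g x (stdOrthonormalBasis ℝ V i)) := by
  ext v
  conv_lhs => rw [← (stdOrthonormalBasis ℝ V).sum_repr' v, map_sum]
  simp [innerSmul]

/-- Trades one order of differentiation for directional derivatives along an orthonormal basis, so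
that all Schwartz seminorms reduce by induction to sup norms of functions in a closed class. -/
theorem norm_iteratedFDeriv_succ_le {g : V → ℂ} (hg : ∀ n : ℕ, ContDiff ℝ n g) (n : ℕ) (x : V) :
    ‖iteratedFDeriv ℝ (n + 1) g x‖ ≤ ∑ i, ‖innerSmul (stdOrthonormalBasis ℝ V i)‖ *
        ‖iteratedFDeriv ℝ n (fun y => fderiv ℝ g y (stdOrthonormalBasis ℝ V i)) x‖ := by
  have hd : ∀ i, ContDiff ℝ n (fun y => fderiv ℝ g y (stdOrthonormalBasis ℝ V i)) := fun i => by
    have := (hg (n + 1))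
    push_cast at this
    exact (contDiff_succ_iff_fderiv.1 this).2.2.clm_apply contDiff_const
  rw [← norm_iteratedFDeriv_fderiv]
  have : fderiv ℝ g = fun y => ∑ i, (innerSmul (stdOrthonormalBasis ℝ V i) ∘
        (fun y => fderiv ℝ g y (stdOrthonormalBasis ℝ V i))) y := by
    funext y
    exact fderiv_eq_sum_stdOrthonormalBasis g y
  conv_lhs => rw [this]
  rw [iteratedFDeriv_fun_sum_apply]
  · refine (norm_sum_le _ _).trans (Finset.sum_le_sum fun i _ => ?_)
    exact (innerSmul (stdOrthonormalBasis ℝ V i)).norm_iteratedFDeriv_comp_left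
      (f := fun y => fderiv ℝ g y (stdOrthonormalBasis ℝ V i)) (hd i).contDiffAt le_rfl
  · intro i _
    exact ((innerSmul (stdOrthonormalBasis ℝ V i)).contDiff.comp (hd i)).contDiffAt

theorem norm_le_sum_abs_inner (x : V) : ‖x‖ ≤ ∑ i, |inner ℝ x (stdOrthonormalBasis ℝ V i)| := by
  conv_lhs => rw [← (stdOrthonormalBasis ℝ V).sum_repr' x]
  refine (norm_sum_le _ _).trans (Finset.sum_le_sum fun i _ => ?_)
  rw [norm_smul, (stdOrthonormalBasis ℝ V).orthonormal.1 i, mul_one, Real.norm_eq_abs,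
    real_inner_comm]

/-- A class of bounded differentiable functions that is closed under directional derivatives and
multiplication by linear forms consists of Schwartz functions. -/
theorem exists_of_closed {G : Set (V → ℂ)} (hd : ∀ g ∈ G, Differentiable ℝ g)
    (hb : ∀ g ∈ G, ∃ C, ∀ x, ‖g x‖ ≤ C)
    (hG : ∀ g ∈ G, ∀ v, (fun x => fderiv ℝ g x v) ∈ G)
    (hm : ∀ g ∈ G, ∀ v, (fun x => ((inner ℝ x v : ℝ) : ℂ) * g x) ∈ G)
    {g : V → ℂ} (hg : g ∈ G) : ∃ f : 𝓢(V, ℂ), ⇑f = g := by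
  have hsm : ∀ g ∈ G, ∀ n : ℕ, ContDiff ℝ n g := fun g hg => contDiff_of_closed_fderiv hd hG hg
  have key : ∀ n k : ℕ, ∀ g ∈ G, ∃ C, ∀ x, ‖x‖ ^ k * ‖iteratedFDeriv ℝ n g x‖ ≤ C := by
    intro n
    induction n with
    | zero =>
      intro k
      induction k with
      | zero => simpa using hb
      | succ k ih =>
        intro g hg
        choose C hC using fun i => ih _ (hm g hg (stdOrthonormalBasis ℝ V i))
        refine ⟨∑ i, C i, fun x => ?_⟩
        simp only [norm_iteratedFDeriv_zero, norm_mul, Complex.norm_real, Real.norm_eq_abs]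
          at hC ⊢
        calc ‖x‖ ^ (k + 1) * ‖g x‖ = ‖x‖ ^ k * ‖x‖ * ‖g x‖ := by ring
          _ ≤ ‖x‖ ^ k * (∑ i, |inner ℝ x (stdOrthonormalBasis ℝ V i)|) * ‖g x‖ := by
              gcongr; exact norm_le_sum_abs_inner x
          _ = ∑ i, ‖x‖ ^ k * (|inner ℝ x (stdOrthonormalBasis ℝ V i)| * ‖g x‖) := by
              rw [Finset.mul_sum, Finset.sum_mul]; simp only [mul_assoc]
          _ ≤ _ := Finset.sum_le_sum fun i _ => hC i x
    | succ n ih =>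
      intro k g hg
      choose C hC using fun i => ih k _ (hG g hg (stdOrthonormalBasis ℝ V i))
      refine ⟨∑ i, ‖innerSmul (stdOrthonormalBasis ℝ V i)‖ * C i, fun x => ?_⟩
      refine (mul_le_mul_of_nonneg_left (norm_iteratedFDeriv_succ_le (hsm g hg) n x)
        (by positivity)).trans ?_
      rw [Finset.mul_sum]
      refine Finset.sum_le_sum fun i _ => ?_
      rw [mul_left_comm]
      exact mul_le_mul_of_nonneg_left (hC i x) (ContinuousLinearMap.opNorm_nonneg _)
  exact ⟨⟨g, contDiff_infty.2 (hsm g hg), fun k n => key n k g hg⟩, rfl⟩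

end Functions

section Convergence

variable [FiniteDimensional ℝ V]

theorem seminorm_succ_le (k n : ℕ) (f : 𝓢(V, ℂ)) :
    SchwartzMap.seminorm ℝ k (n + 1) f ≤ ∑ i, ‖innerSmul (stdOrthonormalBasis ℝ V i)‖ *
        SchwartzMap.seminorm ℝ k n (∂_{stdOrthonormalBasis ℝ V i} f) := by
  refine seminorm_le_bound ℝ k (n + 1) f (by positivity) fun x => ?_
  refine (mul_le_mul_of_nonneg_left (norm_iteratedFDeriv_succ_le (fun n => f.smooth n) n x)
    (by positivity)).trans ?_
  rw [Finset.mul_sum]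
  refine Finset.sum_le_sum fun i _ => ?_
  rw [mul_left_comm]
  exact mul_le_mul_of_nonneg_left (le_seminorm ℝ k n (∂_{stdOrthonormalBasis ℝ V i} f) x)
    (ContinuousLinearMap.opNorm_nonneg _)

theorem seminorm_pow_succ_le (k : ℕ) (f : 𝓢(V, ℂ)) :
    SchwartzMap.seminorm ℝ (k + 1) 0 f ≤
      ∑ i, SchwartzMap.seminorm ℝ k 0 (coordMul (stdOrthonormalBasis ℝ V i) f) := by
  refine seminorm_le_bound ℝ (k + 1) 0 f (by positivity) fun x => ?_
  rw [norm_iteratedFDeriv_zero]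
  calc ‖x‖ ^ (k + 1) * ‖f x‖ = ‖x‖ ^ k * ‖x‖ * ‖f x‖ := by ring
    _ ≤ ‖x‖ ^ k * (∑ i, |inner ℝ x (stdOrthonormalBasis ℝ V i)|) * ‖f x‖ := by
        gcongr; exact norm_le_sum_abs_inner x
    _ = ∑ i, ‖x‖ ^ k * ‖coordMul (stdOrthonormalBasis ℝ V i) f x‖ := by
        rw [Finset.mul_sum, Finset.sum_mul]
        simp only [mul_assoc, coordMul_apply, norm_mul, Complex.norm_real, Real.norm_eq_abs]
    _ ≤ _ := Finset.sum_le_sum fun i _ => norm_pow_mul_le_seminorm ℝ _ k x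

/-- A class of families of Schwartz functions that tend to zero uniformly and that is closed under
directional derivatives and multiplication by linear forms consists of families that tend to zero
in the Schwartz space. -/
theorem tendsto_zero_of_closed {α : Type*} {l : Filter α} {G : Set (α → 𝓢(V, ℂ))}
    (hb : ∀ u ∈ G, Tendsto (fun t => SchwartzMap.seminorm ℝ 0 0 (u t)) l (𝓝 0))
    (hG : ∀ u ∈ G, ∀ v : V, (fun t => ∂_{v} (u t)) ∈ G)
    (hm : ∀ u ∈ G, ∀ v, (fun t => coordMul v (u t)) ∈ G)
    {u : α → 𝓢(V, ℂ)} (hu : u ∈ G) : Tendsto u l (𝓝 0) := by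
  have key : ∀ n k : ℕ, ∀ u ∈ G,
      Tendsto (fun t => SchwartzMap.seminorm ℝ k n (u t)) l (𝓝 0) := by
    intro n
    induction n with
    | zero =>
      intro k
      induction k with
      | zero => exact hb
      | succ k ih =>
        intro u hu
        refine squeeze_zero (fun t => apply_nonneg _ _) (fun t => seminorm_pow_succ_le k (u t)) ?_
        simpa only [Finset.sum_const_zero] using tendsto_finsetSum Finset.univ
          fun i _ => ih _ (hm u hu (stdOrthonormalBasis ℝ V i))
    | succ n ih =>
      intro k u hu
      refine squeeze_zero (fun t => apply_nonneg _ _) (fun t => seminorm_succ_le k n (u t)) ?_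
      simpa only [mul_zero, Finset.sum_const_zero] using tendsto_finsetSum Finset.univ
        fun i _ => (ih k _ (hG u hu (stdOrthonormalBasis ℝ V i))).const_mul
          ‖innerSmul (stdOrthonormalBasis ℝ V i)‖
  rw [(schwartz_withSeminorms ℝ V ℂ).tendsto_nhds u 0]
  intro i ε hε
  simp only [sub_zero]
  exact (key i.2 i.1 u hu).eventually_lt_const hε

end Convergence

section Completeness

variable [FiniteDimensional ℝ V]

/-- For a Cauchy sequence u and any continuous operator L, both L u and its derivative converge
uniformly, say L u → g L. A derivative or coordinate multiple of g L is g of L followed by that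
operation, so the limits form a closed class. Hence they are Schwartz by `exists_of_closed`, and
`tendsto_zero_of_closed` upgrades uniform convergence to Schwartz convergence. -/
instance instCompleteSpace : CompleteSpace 𝓢(V, ℂ) := by
  have : (uniformity 𝓢(V, ℂ)).IsCountablyGenerated :=
    IsUniformAddGroup.uniformity_countably_generated
  refine UniformSpace.complete_of_cauchySeq_tendsto fun u hu => ?_
  let T := toBoundedContinuousFunctionCLM ℝ V ℂ
  let T' := (toBoundedContinuousFunctionCLM ℝ V (V →L[ℝ] ℂ)).comp (fderivCLM ℝ V ℂ)
  have hlim : ∀ L : 𝓢(V, ℂ) →L[ℝ] 𝓢(V, ℂ), ∃ g, Tendsto (fun k => T (L (u k))) atTop (𝓝 g) :=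
    fun L => cauchySeq_tendsto_of_complete (hu.map (T.comp L).uniformContinuous)
  have hlim' : ∀ L : 𝓢(V, ℂ) →L[ℝ] 𝓢(V, ℂ), ∃ g, Tendsto (fun k => T' (L (u k))) atTop (𝓝 g) :=
    fun L => cauchySeq_tendsto_of_complete (hu.map (T'.comp L).uniformContinuous)
  choose g hg using hlim
  choose g' hg' using hlim'
  have hpt : ∀ L x, Tendsto (fun k => L (u k) x) atTop (𝓝 (g L x)) := fun L x =>
    (((BoundedContinuousFunction.evalCLM ℝ x).continuous.tendsto _).comp (hg L) :)
  have hfd : ∀ L x, HasFDerivAt (g L) (g' L x) x := by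
    intro L x
    refine hasFDerivAt_of_tendstoUniformlyOn (l := atTop) (𝕜 := ℝ) isOpen_univ
      (f := fun k => L (u k)) (f' := fun k => fderiv ℝ (L (u k))) ?_ ?_ (fun y _ => hpt L y)
      (Set.mem_univ x)
    · rw [tendstoUniformlyOn_univ]
      exact BoundedContinuousFunction.tendsto_iff_tendstoUniformly.1 (hg' L)
    · exact fun k y _ => (L (u k)).hasFDerivAt y
  have hder : ∀ L v x, fderiv ℝ (g L) x v = g ((lineDerivOpCLM ℝ 𝓢(V, ℂ) v).comp L) x := by
    intro L v x
    rw [(hfd L x).fderiv]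
    refine tendsto_nhds_unique ?_ (hpt ((lineDerivOpCLM ℝ 𝓢(V, ℂ) v).comp L) x)
    have := ((BoundedContinuousFunction.evalCLM ℝ x).continuous.tendsto _).comp (hg' L)
    exact ((ContinuousLinearMap.apply ℝ ℂ v).continuous.tendsto _).comp this
  have hmul : ∀ L v x, ((inner ℝ x v : ℝ) : ℂ) * g L x =
      g (((coordMul v).restrictScalars ℝ).comp L) x := by
    intro L v x
    refine tendsto_nhds_unique ((hpt L x).const_mul _) ?_
    simpa using hpt (((coordMul v).restrictScalars ℝ).comp L) x
  have hS : ∀ L, ∃ f : 𝓢(V, ℂ), ⇑f = g L := by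
    intro L
    refine exists_of_closed (G := Set.range fun L => ⇑(g L)) ?_ ?_ ?_ ?_ ⟨L, rfl⟩
    · rintro _ ⟨L, rfl⟩ x
      exact (hfd L x).differentiableAt
    · rintro _ ⟨L, rfl⟩
      exact ⟨‖g L‖, (g L).norm_coe_le_norm⟩
    · rintro _ ⟨L, rfl⟩ v
      exact ⟨_, funext fun x => (hder L v x).symm⟩
    · rintro _ ⟨L, rfl⟩ v
      exact ⟨_, funext fun x => (hmul L v x).symm⟩
  choose f hf using hS
  refine ⟨f (.id ℝ _), ?_⟩
  rw [← tendsto_sub_nhds_zero_iff]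
  refine tendsto_zero_of_closed (G := Set.range fun L k => L (u k) - f L) ?_ ?_ ?_
    ⟨.id ℝ _, rfl⟩
  · rintro _ ⟨L, rfl⟩
    have hT : g L = T (f L) := by
      ext x
      rw [← hf]; rfl
    have h0 := (tendsto_sub_nhds_zero_iff.2 (hT ▸ hg L)).norm
    simp only [norm_zero, ← map_sub] at h0
    refine squeeze_zero (fun t => apply_nonneg _ _) (fun t => ?_) h0
    refine seminorm_le_bound ℝ 0 0 _ (norm_nonneg _) fun x => ?_
    rw [pow_zero, one_mul, norm_iteratedFDeriv_zero]
    exact (T (L (u t) - f L)).norm_coe_le_norm x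
  · rintro _ ⟨L, rfl⟩ v
    refine ⟨(lineDerivOpCLM ℝ 𝓢(V, ℂ) v).comp L, ?_⟩
    have : f ((lineDerivOpCLM ℝ 𝓢(V, ℂ) v).comp L) = ∂_{v} (f L) := by
      ext x
      rw [hf, ← hder, lineDerivOp_apply_eq_fderiv, hf]
    funext k
    simp only [this, ContinuousLinearMap.comp_apply, lineDerivOpCLM_apply]
    exact ((lineDerivOpCLM ℝ 𝓢(V, ℂ) v).map_sub _ _).symm
  · rintro _ ⟨L, rfl⟩ v
    refine ⟨((coordMul v).restrictScalars ℝ).comp L, ?_⟩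
    have : f (((coordMul v).restrictScalars ℝ).comp L) = coordMul v (f L) := by
      ext x
      rw [hf, ← hmul, coordMul_apply, hf]
    funext k
    simp [this]

/-- This is what makes Banach–Steinhaus available in `exists_continuous_product`. -/
instance instBaireSpace : BaireSpace 𝓢(V, ℂ) := by
  have : (uniformity 𝓢(V, ℂ)).IsCountablyGenerated :=
    IsUniformAddGroup.uniformity_countably_generated
  infer_instance

end Completeness

end SchwartzMap

/-! ### Twisted integrals with a deformation parameter s -/

namespace SchwartzMap

open Filter Topology LineDeriv MeasureTheory FourierTransform

variable {V : Type*} [NormedAddCommGroup V] [InnerProductSpace ℝ V]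

/-- The character `exp (2 π i ⟪w, x⟫)`. -/
noncomputable def chi (w x : V) : ℂ :=
  Complex.exp (((2 * Real.pi * inner ℝ w x : ℝ) : ℂ) * Complex.I)

@[simp]
theorem norm_chi (w x : V) : ‖chi w x‖ = 1 := Complex.norm_exp_ofReal_mul_I _

@[simp]
theorem chi_zero_right (w : V) : chi w 0 = 1 := by simp [chi]

theorem chi_add_right (w x y : V) : chi w (x + y) = chi w x * chi w y := by
  rw [chi, chi, chi, ← Complex.exp_add, inner_add_right]
  push_cast
  ring_nf

theorem chi_comm (w x : V) : chi w x = chi x w := by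
  rw [chi, chi, real_inner_comm]

@[fun_prop]
theorem continuous_chi {X : Type*} [TopologicalSpace X] {f g : X → V} (hf : Continuous f)
    (hg : Continuous g) : Continuous (fun t => chi (f t) (g t)) := by
  unfold chi
  fun_prop

theorem norm_chi_sub_one_le (w x : V) : ‖chi w x - 1‖ ≤ 2 * Real.pi * (‖w‖ * ‖x‖) := by
  have h := Real.norm_exp_I_mul_ofReal_sub_one_le (x := 2 * Real.pi * inner ℝ w x)
  rw [mul_comm] at h
  refine h.trans ?_
  rw [norm_mul, Real.norm_of_nonneg (by positivity)]
  gcongr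
  exact abs_real_inner_le_norm w x

theorem hasFDerivAt_chi (w x : V) :
    HasFDerivAt (chi w) ((chi w x * (2 * Real.pi * Complex.I)) •
      (Complex.ofRealCLM.comp (innerSL ℝ w))) x := by
  have h1 : HasFDerivAt (fun x : V => ((2 * Real.pi * inner ℝ w x : ℝ) : ℂ) * Complex.I)
      ((2 * Real.pi * Complex.I) • (Complex.ofRealCLM.comp (innerSL ℝ w))) x := by
    have h : (fun x : V => ((2 * Real.pi * inner ℝ w x : ℝ) : ℂ) * Complex.I) =
        ((2 * Real.pi * Complex.I) • (Complex.ofRealCLM.comp (innerSL ℝ w)) : V →L[ℝ] ℂ) := by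
      funext x
      simp
      ring
    rw [h]
    exact ContinuousLinearMap.hasFDerivAt _
  have h2 := h1.cexp
  rw [smul_smul] at h2
  exact h2

theorem norm_twist_kernel_le (B : V →L[ℝ] V) (s : ℝ) (a : 𝓢(V, ℂ)) (x w : V) :
    ‖chi w (s • x) * a (x + s • B w)‖ ≤ SchwartzMap.seminorm ℝ 0 0 a := by
  rw [norm_mul, norm_chi, one_mul]
  exact norm_le_seminorm ℝ a _

variable [FiniteDimensional ℝ V] [MeasurableSpace V] [BorelSpace V]

/-- The integral `∫ exp (2 π i s ⟪w, x⟫) c(w) a(x + s B w) dw`. -/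
noncomputable def twistIntegral (B : V →L[ℝ] V) (s : ℝ) (c a : 𝓢(V, ℂ)) (x : V) : ℂ :=
  ∫ w, chi w (s • x) * a (x + s • B w) * c w

theorem integrable_bdd_mul_schwartz {k : V → ℂ} (hk : Continuous k) {C : ℝ} (hC : ∀ w, ‖k w‖ ≤ C)
    (c : 𝓢(V, ℂ)) : Integrable (fun w => k w * c w) :=
  c.integrable.bdd_mul (c := C) hk.aestronglyMeasurable (.of_forall hC)

theorem integrable_twist (B : V →L[ℝ] V) (s : ℝ) (c a : 𝓢(V, ℂ)) (x : V) :
    Integrable (fun w => chi w (s • x) * a (x + s • B w) * c w) :=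
  integrable_bdd_mul_schwartz (by fun_prop) (norm_twist_kernel_le B s a x) c

theorem norm_twistIntegral_le (B : V →L[ℝ] V) (s : ℝ) (c a : 𝓢(V, ℂ)) (x : V) :
    ‖twistIntegral B s c a x‖ ≤ SchwartzMap.seminorm ℝ 0 0 a * ∫ w, ‖c w‖ := by
  rw [← integral_const_mul]
  refine norm_integral_le_of_norm_le (c.integrable.norm.const_mul _) (.of_forall fun w => ?_)
  rw [norm_mul]
  exact mul_le_mul_of_nonneg_right (norm_twist_kernel_le B s a x w) (norm_nonneg _)

/-- Differentiation under the integral sign: the derivative is dominated, uniformly in x, by a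
combination of ‖c w‖ and ‖w‖ ‖c w‖. The integrability is recorded as well because
`fderiv_twistIntegral` evaluates the operator-valued integral at a vector. -/
theorem hasFDerivAt_twistIntegral (B : V →L[ℝ] V) (s : ℝ) (c a : 𝓢(V, ℂ)) (x : V) :
    Integrable (fun w => (chi w (s • x) * c w) • fderiv ℝ a (x + s • B w) +
        (chi w (s • x) * a (x + s • B w) * c w * (2 * Real.pi * s * Complex.I)) •
          (Complex.ofRealCLM.comp (innerSL ℝ w))) ∧
    HasFDerivAt (twistIntegral B s c a)
      (∫ w, ((chi w (s • x) * c w) • fderiv ℝ a (x + s • B w) +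
        (chi w (s • x) * a (x + s • B w) * c w * (2 * Real.pi * s * Complex.I)) •
          (Complex.ofRealCLM.comp (innerSL ℝ w)))) x := by
  have hfd : Continuous (fderiv ℝ a) := (fderivCLM ℝ V ℂ a).continuous
  have hin : Continuous (fun w : V => Complex.ofRealCLM.comp (innerSL ℝ w)) :=
    ((ContinuousLinearMap.compL ℝ V ℝ ℂ Complex.ofRealCLM).continuous).comp
      (innerSL ℝ).continuous
  have hmeas : AEStronglyMeasurable (fun w => (chi w (s • x) * c w) • fderiv ℝ a (x + s • B w) +
        (chi w (s • x) * a (x + s • B w) * c w * (2 * Real.pi * s * Complex.I)) •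
          (Complex.ofRealCLM.comp (innerSL ℝ w))) volume := by
    refine Continuous.aestronglyMeasurable ?_
    have h1 : Continuous fun w => chi w (s • x) * c w := by fun_prop
    have h2 : Continuous fun w => fderiv ℝ a (x + s • B w) := hfd.comp (by fun_prop)
    have h3 : Continuous fun w =>
        chi w (s • x) * a (x + s • B w) * c w * (2 * Real.pi * s * Complex.I) := by fun_prop
    exact (h1.smul h2).add (h3.smul hin)
  have hbound : ∀ w x, ‖(chi w (s • x) * c w) • fderiv ℝ a (x + s • B w) +
        (chi w (s • x) * a (x + s • B w) * c w * (2 * Real.pi * s * Complex.I)) •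
          (Complex.ofRealCLM.comp (innerSL ℝ w))‖ ≤
      SchwartzMap.seminorm ℝ 0 1 a * ‖c w‖ +
        SchwartzMap.seminorm ℝ 0 0 a * (2 * Real.pi * |s|) * (‖w‖ ^ 1 * ‖c w‖) := by
    intro w x
    refine (norm_add_le _ _).trans (add_le_add ?_ ?_)
    · rw [norm_smul, norm_mul, norm_chi, one_mul, mul_comm]
      gcongr
      have := norm_iteratedFDeriv_le_seminorm ℝ a 1 (x + s • B w)
      rwa [norm_iteratedFDeriv_one] at this
    · have h1 : ‖Complex.ofRealCLM.comp (innerSL ℝ w)‖ ≤ ‖w‖ :=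
        (ContinuousLinearMap.opNorm_comp_le _ _).trans (by simp)
      have h2 := norm_twist_kernel_le B s a x w
      rw [norm_smul, norm_mul, norm_mul]
      have h3 : ‖(2 * Real.pi * s * Complex.I : ℂ)‖ = 2 * Real.pi * |s| := by
        simp [abs_of_pos Real.pi_pos]
      rw [h3, pow_one]
      calc _ ≤ SchwartzMap.seminorm ℝ 0 0 a * ‖c w‖ * (2 * Real.pi * |s|) * ‖w‖ := by gcongr
        _ = _ := by ring
  have hint : Integrable (fun w => SchwartzMap.seminorm ℝ 0 1 a * ‖c w‖ +
        SchwartzMap.seminorm ℝ 0 0 a * (2 * Real.pi * |s|) * (‖w‖ ^ 1 * ‖c w‖)) :=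
    (c.integrable.norm.const_mul _).add ((c.integrable_pow_mul volume 1).const_mul _)
  refine ⟨hint.mono' hmeas (.of_forall fun w => hbound w x), ?_⟩
  refine hasFDerivAt_integral_of_dominated_of_fderiv_le (𝕜 := ℝ) (s := Set.univ)
    (F' := fun x w => (chi w (s • x) * c w) • fderiv ℝ a (x + s • B w) +
        (chi w (s • x) * a (x + s • B w) * c w * (2 * Real.pi * s * Complex.I)) •
          (Complex.ofRealCLM.comp (innerSL ℝ w))) univ_mem
    (.of_forall fun y => (integrable_twist B s c a y).aestronglyMeasurable)
    (integrable_twist B s c a x) hmeas (.of_forall fun w y _ => hbound w y) hint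
    (.of_forall fun w y _ => ?_)
  have h1 : HasFDerivAt (fun y => chi w (s • y)) ((chi w (s • y) * (2 * Real.pi * Complex.I)) •
      (Complex.ofRealCLM.comp (innerSL ℝ w)) ∘L (s • ContinuousLinearMap.id ℝ V)) y :=
    (hasFDerivAt_chi w (s • y)).comp y ((hasFDerivAt_id y).const_smul s)
  have h2 : HasFDerivAt (fun y => a (y + s • B w)) (fderiv ℝ a (y + s • B w)) y := by
    have := (a.hasFDerivAt (y + s • B w)).comp y ((hasFDerivAt_id y).add_const (s • B w))
    rwa [ContinuousLinearMap.comp_id] at this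
  convert! (h1.mul h2).mul_const (c w) using 1
  ext v
  simp
  ring

theorem differentiable_twistIntegral (B : V →L[ℝ] V) (s : ℝ) (c a : 𝓢(V, ℂ)) :
    Differentiable ℝ (twistIntegral B s c a) :=
  fun x => (hasFDerivAt_twistIntegral B s c a x).2.differentiableAt

theorem fderiv_twistIntegral (B : V →L[ℝ] V) (s : ℝ) (c a : 𝓢(V, ℂ)) (v x : V) :
    fderiv ℝ (twistIntegral B s c a) x v =
      s * twistIntegral B s ((2 * Real.pi * Complex.I) • coordMul v c) a x +
        twistIntegral B s c (∂_{v} a) x := by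
  rw [(hasFDerivAt_twistIntegral B s c a x).2.fderiv,
    ContinuousLinearMap.integral_apply (hasFDerivAt_twistIntegral B s c a x).1, twistIntegral,
    twistIntegral, ← integral_const_mul, ← integral_add]
  · refine integral_congr_ae (.of_forall fun w => ?_)
    simp [lineDerivOp_apply_eq_fderiv]
    ring
  · exact (integrable_twist B s _ a x).const_mul _
  · exact integrable_twist B s c _ x

/-- Inside the integral, ⟨x, v⟩ = ⟨x + sBw, v⟩ - s⟨w, B*v⟩: the first form is absorbed by `a`, the
second by `c`. The result is again a combination of twisted integrals. -/
theorem inner_mul_twistIntegral (B : V →L[ℝ] V) (s : ℝ) (c a : 𝓢(V, ℂ)) (v x : V) :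
    ((inner ℝ x v : ℝ) : ℂ) * twistIntegral B s c a x = twistIntegral B s c (coordMul v a) x -
      s * twistIntegral B s (coordMul (ContinuousLinearMap.adjoint B v) c) a x := by
  rw [twistIntegral, twistIntegral, twistIntegral, ← integral_const_mul, ← integral_const_mul,
    ← integral_sub]
  · refine integral_congr_ae (.of_forall fun w => ?_)
    simp only [coordMul_apply, ContinuousLinearMap.adjoint_inner_right, inner_add_left,
      real_inner_smul_left]
    push_cast
    ring
  · exact integrable_twist B s c _ x
  · exact (integrable_twist B s _ a x).const_mul _

theorem twistIntegral_smul_left (B : V →L[ℝ] V) (s : ℝ) (k : ℂ) (c a : 𝓢(V, ℂ)) (x : V) :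
    twistIntegral B s (k • c) a x = k * twistIntegral B s c a x := by
  rw [twistIntegral, twistIntegral, ← integral_const_mul]
  simp only [smul_apply, smul_eq_mul, mul_left_comm]

theorem twistIntegral_add_right (B : V →L[ℝ] V) (s : ℝ) (c a b : 𝓢(V, ℂ)) (x : V) :
    twistIntegral B s c (a + b) x = twistIntegral B s c a x + twistIntegral B s c b x := by
  rw [twistIntegral, twistIntegral, twistIntegral,
    ← integral_add (integrable_twist B s c a x) (integrable_twist B s c b x)]
  simp only [add_apply, mul_add, add_mul]

theorem twistIntegral_smul_right (B : V →L[ℝ] V) (s : ℝ) (k : ℂ) (c a : 𝓢(V, ℂ)) (x : V) :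
    twistIntegral B s c (k • a) x = k * twistIntegral B s c a x := by
  rw [twistIntegral, twistIntegral, ← integral_const_mul]
  simp only [smul_apply, smul_eq_mul]
  congr! 2
  ring

/-- `exists_of_closed` is applied to the span of all twisted integrals with the same `B` and `s`;
the span is needed because a derivative or a coordinate multiple is a sum of two of them. -/
theorem exists_eq_twistIntegral (B : V →L[ℝ] V) (s : ℝ) (c a : 𝓢(V, ℂ)) :
    ∃ f : 𝓢(V, ℂ), ⇑f = twistIntegral B s c a := by
  let S : Submodule ℂ (V → ℂ) :=
    Submodule.span ℂ (Set.range fun p : 𝓢(V, ℂ) × 𝓢(V, ℂ) => twistIntegral B s p.1 p.2)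
  have hmem : ∀ c a, twistIntegral B s c a ∈ S := fun c a => Submodule.subset_span ⟨(c, a), rfl⟩
  have hd : ∀ g ∈ S, Differentiable ℝ g := by
    intro g hg
    induction hg using Submodule.span_induction with
    | mem g hg => obtain ⟨p, rfl⟩ := hg; exact differentiable_twistIntegral B s _ _
    | zero => exact differentiable_const 0
    | add g h _ _ hg hh => exact hg.add hh
    | smul k g _ hg => exact hg.const_smul k
  refine exists_of_closed (G := S) hd ?_ ?_ ?_ (hmem c a)
  · intro g hg
    induction hg using Submodule.span_induction with
    | mem g hg => obtain ⟨p, rfl⟩ := hg; exact ⟨_, norm_twistIntegral_le B s _ _⟩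
    | zero => exact ⟨0, by simp⟩
    | add g h _ _ hg hh =>
      obtain ⟨C, hC⟩ := hg
      obtain ⟨D, hD⟩ := hh
      exact ⟨C + D, fun x => (norm_add_le _ _).trans (add_le_add (hC x) (hD x))⟩
    | smul k g _ hg =>
      obtain ⟨C, hC⟩ := hg
      refine ⟨‖k‖ * C, fun x => ?_⟩
      rw [Pi.smul_apply, norm_smul]
      exact mul_le_mul_of_nonneg_left (hC x) (norm_nonneg _)
  · intro g hg v
    induction hg using Submodule.span_induction with
    | mem g hg =>
      obtain ⟨p, rfl⟩ := hg
      simp only [fderiv_twistIntegral]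
      exact S.add_mem (S.smul_mem (s : ℂ) (hmem _ _)) (hmem _ _)
    | zero =>
      convert! S.zero_mem using 1
      funext x
      simp
    | add g h hg' hh' hg hh =>
      convert! S.add_mem hg hh using 1
      funext x
      rw [fderiv_add (hd g hg' x) (hd h hh' x)]
      rfl
    | smul k g hg' hg =>
      convert! S.smul_mem k hg using 1
      funext x
      rw [fderiv_const_smul (hd g hg' x)]
      rfl
  · intro g hg v
    induction hg using Submodule.span_induction with
    | mem g hg =>
      obtain ⟨p, rfl⟩ := hg
      simp only [inner_mul_twistIntegral]
      exact S.sub_mem (hmem _ _) (S.smul_mem (s : ℂ) (hmem _ _))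
    | zero =>
      convert! S.zero_mem using 1
      funext x
      simp
    | add g h hg' hh' hg hh =>
      convert! S.add_mem hg hh using 1
      funext x
      simp [mul_add]
    | smul k g hg' hg =>
      convert! S.smul_mem k hg using 1
      funext x
      simp [mul_left_comm]

end SchwartzMap

/-! ### Continuity of the twist and its limit as s tends to 0 -/

namespace SchwartzMap

open Filter Topology LineDeriv MeasureTheory FourierTransform

variable {V : Type*} [NormedAddCommGroup V] [InnerProductSpace ℝ V]

theorem tendsto_seminorm_clm_zero (L : 𝓢(V, ℂ) →L[ℂ] 𝓢(V, ℂ)) :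
    Tendsto (fun a => SchwartzMap.seminorm ℝ 0 0 (L a)) (𝓝 0) (𝓝 0) := by
  have := (((schwartz_withSeminorms ℝ V ℂ).continuous_seminorm (0, 0)).comp L.continuous).tendsto 0
  simpa [Function.comp_def] using this

variable [FiniteDimensional ℝ V]

/-- A version of `tendsto_zero_of_closed` to be checked on generators only: decay of the sup norm
and stability under both operations pass to linear combinations. -/
theorem tendsto_zero_of_span {α : Type*} {l : Filter α} {R : Set (α → 𝓢(V, ℂ))}
    (hb : ∀ u ∈ R, Tendsto (fun t => SchwartzMap.seminorm ℝ 0 0 (u t)) l (𝓝 0))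
    (hG : ∀ u ∈ R, ∀ v : V, (fun t => ∂_{v} (u t)) ∈ Submodule.span ℂ R)
    (hm : ∀ u ∈ R, ∀ v, (fun t => coordMul v (u t)) ∈ Submodule.span ℂ R)
    {u : α → 𝓢(V, ℂ)} (hu : u ∈ R) : Tendsto u l (𝓝 0) := by
  refine tendsto_zero_of_closed (G := Submodule.span ℂ R) ?_ ?_ ?_ (Submodule.subset_span hu)
  · intro u hu
    induction hu using Submodule.span_induction with
    | mem u hu => exact hb u hu
    | zero => simp [tendsto_const_nhds]
    | add u v _ _ hu hv =>
      refine squeeze_zero (fun t => apply_nonneg _ _) (fun t => map_add_le_add _ _ _) ?_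
      simpa using hu.add hv
    | smul k u _ hu =>
      have : ∀ t, SchwartzMap.seminorm ℝ 0 0 ((k • u) t) =
          ‖k‖ * SchwartzMap.seminorm ℝ 0 0 (u t) :=
        fun t => map_smul_eq_mul (SchwartzMap.seminorm ℂ 0 0) k (u t)
      simp only [this]
      simpa using hu.const_mul ‖k‖
  · intro u hu v
    have : (LinearMap.compLeft (lineDerivOpCLM ℂ 𝓢(V, ℂ) v : 𝓢(V, ℂ) →ₗ[ℂ] 𝓢(V, ℂ)) α) u ∈
        Submodule.span ℂ R := by
      refine (Submodule.span_le.2 ?_ :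
        Submodule.span ℂ R ≤ (Submodule.span ℂ R).comap (LinearMap.compLeft _ α)) hu
      exact fun u hu => hG u hu v
    exact this
  · intro u hu v
    have : (LinearMap.compLeft (coordMul v : 𝓢(V, ℂ) →ₗ[ℂ] 𝓢(V, ℂ)) α) u ∈
        Submodule.span ℂ R := by
      refine (Submodule.span_le.2 ?_ :
        Submodule.span ℂ R ≤ (Submodule.span ℂ R).comap (LinearMap.compLeft _ α)) hu
      exact fun u hu => hm u hu v
    exact this

variable [MeasurableSpace V] [BorelSpace V]

/-- The Schwartz function `x ↦ ∫ exp (2 π i s ⟪w, x⟫) c(w) a(x + s B w) dw`. -/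
noncomputable def twist (B : V →L[ℝ] V) (s : ℝ) (c a : 𝓢(V, ℂ)) : 𝓢(V, ℂ) :=
  (exists_eq_twistIntegral B s c a).choose

theorem twist_apply (B : V →L[ℝ] V) (s : ℝ) (c a : 𝓢(V, ℂ)) (x : V) :
    twist B s c a x = twistIntegral B s c a x :=
  congrFun (exists_eq_twistIntegral B s c a).choose_spec x

theorem coe_twist (B : V →L[ℝ] V) (s : ℝ) (c a : 𝓢(V, ℂ)) :
    ⇑(twist B s c a) = twistIntegral B s c a :=
  (exists_eq_twistIntegral B s c a).choose_spec

theorem twist_smul_left (B : V →L[ℝ] V) (s : ℝ) (k : ℂ) (c a : 𝓢(V, ℂ)) :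
    twist B s (k • c) a = k • twist B s c a := by
  ext x
  simp only [smul_apply, twist_apply, twistIntegral_smul_left, smul_eq_mul]

theorem twist_add_right (B : V →L[ℝ] V) (s : ℝ) (c a b : 𝓢(V, ℂ)) :
    twist B s c (a + b) = twist B s c a + twist B s c b := by
  ext x
  simp only [add_apply, twist_apply, twistIntegral_add_right]

theorem twist_smul_right (B : V →L[ℝ] V) (s : ℝ) (k : ℂ) (c a : 𝓢(V, ℂ)) :
    twist B s c (k • a) = k • twist B s c a := by
  ext x
  simp only [smul_apply, twist_apply, twistIntegral_smul_right, smul_eq_mul]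

theorem lineDerivOp_twist (B : V →L[ℝ] V) (s : ℝ) (c a : 𝓢(V, ℂ)) (v : V) :
    ∂_{v} (twist B s c a) =
      (s : ℂ) • twist B s ((2 * Real.pi * Complex.I) • coordMul v c) a + twist B s c (∂_{v} a) := by
  ext x
  rw [lineDerivOp_apply_eq_fderiv, coe_twist, fderiv_twistIntegral]
  simp only [add_apply, smul_apply, twist_apply, smul_eq_mul]

theorem coordMul_twist (B : V →L[ℝ] V) (s : ℝ) (c a : 𝓢(V, ℂ)) (v : V) :
    coordMul v (twist B s c a) = twist B s c (coordMul v a) -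
      (s : ℂ) • twist B s (coordMul (ContinuousLinearMap.adjoint B v) c) a := by
  ext x
  rw [coordMul_apply, twist_apply, inner_mul_twistIntegral]
  simp only [sub_apply, smul_apply, twist_apply, smul_eq_mul]

theorem seminorm_twist_le (B : V →L[ℝ] V) (s : ℝ) (c a : 𝓢(V, ℂ)) :
    SchwartzMap.seminorm ℝ 0 0 (twist B s c a) ≤
      SchwartzMap.seminorm ℝ 0 0 a * ∫ w, ‖c w‖ := by
  refine seminorm_le_bound ℝ 0 0 _ (by positivity) fun x => ?_
  rw [pow_zero, one_mul, norm_iteratedFDeriv_zero, twist_apply]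
  exact norm_twistIntegral_le B s c a x

/-- By additivity continuity at 0 suffices. The generating families are a ↦ `twist B s c (L a)` with
`c` and the continuous operator `L` both free: derivatives and coordinate factors are absorbed into
one or the other. -/
theorem continuous_twist_right (B : V →L[ℝ] V) (s : ℝ) (c : 𝓢(V, ℂ)) :
    Continuous (twist B s c) := by
  let f : 𝓢(V, ℂ) →+ 𝓢(V, ℂ) := AddMonoidHom.mk' (twist B s c) (twist_add_right B s c)
  refine continuous_of_continuousAt_zero f ?_
  rw [ContinuousAt, map_zero]
  have hmem : ∀ c (L : 𝓢(V, ℂ) →L[ℂ] 𝓢(V, ℂ)), (fun a => twist B s c (L a)) ∈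
      Set.range fun p : 𝓢(V, ℂ) × (𝓢(V, ℂ) →L[ℂ] 𝓢(V, ℂ)) => fun a => twist B s p.1 (p.2 a) :=
    fun c L => ⟨(c, L), rfl⟩
  refine tendsto_zero_of_span ?_ ?_ ?_ (hmem c (.id ℂ _))
  · rintro _ ⟨⟨c, L⟩, rfl⟩
    refine squeeze_zero (fun t => apply_nonneg _ _) (fun t => seminorm_twist_le B s c (L t)) ?_
    simpa using (tendsto_seminorm_clm_zero L).mul_const (∫ w, ‖c w‖)
  · rintro _ ⟨⟨c, L⟩, rfl⟩ v
    simp only [lineDerivOp_twist]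
    exact Submodule.add_mem _ (Submodule.smul_mem _ (s : ℂ) (Submodule.subset_span (hmem _ L)))
      (Submodule.subset_span (hmem c ((lineDerivOpCLM ℂ 𝓢(V, ℂ) v).comp L)))
  · rintro _ ⟨⟨c, L⟩, rfl⟩ v
    simp only [coordMul_twist]
    exact Submodule.sub_mem _ (Submodule.subset_span (hmem c ((coordMul v).comp L)))
      (Submodule.smul_mem _ (s : ℂ) (Submodule.subset_span (hmem _ L)))

/-- The increment splits into χ·(a(x + sBw) - a(x)) and (χ - 1)·a(x). The first is O(|s| ‖w‖)
because `a` is Lipschitz; the second is O(|s| ‖w‖ ‖x‖ ‖a x‖), and the decay of `a` bounds ‖x‖ ‖a x‖.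
-/
theorem norm_twistIntegral_sub_le (B : V →L[ℝ] V) (c a : 𝓢(V, ℂ)) :
    ∃ C, ∀ s x, ‖twistIntegral B s c a x - (∫ w, c w) * a x‖ ≤ |s| * C := by
  have hlip : ∀ x y, ‖a (x + y) - a x‖ ≤ SchwartzMap.seminorm ℝ 0 1 a * ‖y‖ := by
    intro x y
    have := Convex.norm_image_sub_le_of_norm_fderiv_le (𝕜 := ℝ) (f := a) (s := Set.univ)
      (fun z _ => a.differentiableAt)
      (fun z _ => by
        have := norm_iteratedFDeriv_le_seminorm ℝ a 1 z
        rwa [norm_iteratedFDeriv_one] at this)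
      convex_univ (Set.mem_univ x) (Set.mem_univ (x + y))
    simpa using this
  refine ⟨∫ w, (SchwartzMap.seminorm ℝ 0 1 a * ‖B‖ +
    2 * Real.pi * SchwartzMap.seminorm ℝ 1 0 a) * (‖w‖ ^ 1 * ‖c w‖), fun s x => ?_⟩
  rw [twistIntegral, ← integral_mul_const, ← integral_sub (integrable_twist B s c a x)
    (c.integrable.mul_const _), ← integral_const_mul]
  refine norm_integral_le_of_norm_le
    (((c.integrable_pow_mul volume 1).const_mul _).const_mul _) (.of_forall fun w => ?_)
  have h1 : ‖chi w (s • x) * (a (x + s • B w) - a x)‖ ≤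
      |s| * (SchwartzMap.seminorm ℝ 0 1 a * ‖B‖ * ‖w‖) := by
    rw [norm_mul, norm_chi, one_mul]
    refine (hlip _ _).trans ?_
    rw [norm_smul, Real.norm_eq_abs]
    calc _ ≤ SchwartzMap.seminorm ℝ 0 1 a * (|s| * (‖B‖ * ‖w‖)) := by
          gcongr; exact B.le_opNorm w
      _ = _ := by ring
  have h2 : ‖(chi w (s • x) - 1) * a x‖ ≤
      |s| * (2 * Real.pi * SchwartzMap.seminorm ℝ 1 0 a * ‖w‖) := by
    rw [norm_mul]
    have h := norm_pow_mul_le_seminorm ℝ a 1 x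
    rw [pow_one] at h
    calc _ ≤ 2 * Real.pi * (‖w‖ * ‖s • x‖) * ‖a x‖ := by
          gcongr; exact norm_chi_sub_one_le _ _
      _ = |s| * (2 * Real.pi * (‖x‖ * ‖a x‖) * ‖w‖) := by
          rw [norm_smul, Real.norm_eq_abs]; ring
      _ ≤ _ := by gcongr
  have : chi w (s • x) * a (x + s • B w) * c w - c w * a x =
      (chi w (s • x) * (a (x + s • B w) - a x) + (chi w (s • x) - 1) * a x) * c w := by ring
  rw [this, norm_mul]
  calc _ ≤ (|s| * (SchwartzMap.seminorm ℝ 0 1 a * ‖B‖ * ‖w‖) +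
        |s| * (2 * Real.pi * SchwartzMap.seminorm ℝ 1 0 a * ‖w‖)) * ‖c w‖ := by
        gcongr; exact (norm_add_le _ _).trans (add_le_add h1 h2)
    _ = _ := by ring

/-- A derivative or coordinate multiple of the error is another error plus or minus s times a twist.
The class is therefore enlarged by the families s^(m+1) · twist, which tend to 0 uniformly and
reproduce themselves with higher powers of s. -/
theorem tendsto_twist_zero (B : V →L[ℝ] V) (c a : 𝓢(V, ℂ)) :
    Tendsto (fun s : ℝ => twist B s c a) (𝓝 0) (𝓝 ((∫ w, c w) • a)) := by
  let R : Set (ℝ → 𝓢(V, ℂ)) :=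
    {u | (∃ (m : ℕ) (c a : 𝓢(V, ℂ)), u = fun s : ℝ => ((s : ℂ) ^ (m + 1)) • twist B s c a) ∨
      ∃ c a : 𝓢(V, ℂ), u = fun s => twist B s c a - (∫ w, c w) • a}
  have hR₁ : ∀ (m : ℕ) c a, (fun s : ℝ => ((s : ℂ) ^ (m + 1)) • twist B s c a) ∈
      Submodule.span ℂ R := fun m c a => Submodule.subset_span (Or.inl ⟨m, c, a, rfl⟩)
  have hR₂ : ∀ c a, (fun s : ℝ => twist B s c a - (∫ w, c w) • a) ∈ Submodule.span ℂ R :=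
    fun c a => Submodule.subset_span (Or.inr ⟨c, a, rfl⟩)
  rw [← tendsto_sub_nhds_zero_iff]
  refine tendsto_zero_of_span (R := R) ?_ ?_ ?_ (Or.inr ⟨c, a, rfl⟩)
  · rintro _ (⟨m, c, a, rfl⟩ | ⟨c, a, rfl⟩)
    · refine squeeze_zero (g := fun s : ℝ => ‖(s : ℂ) ^ (m + 1)‖ *
        (SchwartzMap.seminorm ℝ 0 0 a * ∫ w, ‖c w‖)) (fun t => apply_nonneg _ _) (fun s => ?_) ?_
      · have := map_smul_eq_mul (SchwartzMap.seminorm ℂ 0 0) ((s : ℂ) ^ (m + 1)) (twist B s c a)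
        refine (le_of_eq this).trans ?_
        exact mul_le_mul_of_nonneg_left (seminorm_twist_le B s c a) (norm_nonneg _)
      · have : Continuous fun s : ℝ => ‖(s : ℂ) ^ (m + 1)‖ *
          (SchwartzMap.seminorm ℝ 0 0 a * ∫ w, ‖c w‖) := by fun_prop
        simpa using this.tendsto 0
    · obtain ⟨C, hC⟩ := norm_twistIntegral_sub_le B c a
      have hC0 : ∀ s, 0 ≤ |s| * C := fun s => (norm_nonneg _).trans (hC s 0)
      refine squeeze_zero (g := fun s => |s| * C) (fun t => apply_nonneg _ _) (fun s => ?_) ?_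
      · refine seminorm_le_bound ℝ 0 0 _ (hC0 s) fun x => ?_
        rw [pow_zero, one_mul, norm_iteratedFDeriv_zero]
        simpa [twist_apply] using hC s x
      · have : Continuous fun s : ℝ => |s| * C := by fun_prop
        simpa using this.tendsto 0
  · rintro _ (⟨m, c, a, rfl⟩ | ⟨c, a, rfl⟩) v
    · convert! Submodule.add_mem _ (hR₁ (m + 1) ((2 * Real.pi * Complex.I) • coordMul v c) a)
        (hR₁ m c (∂_{v} a)) using 1
      funext s
      rw [lineDerivOp_smul, lineDerivOp_twist, smul_add, smul_smul, ← pow_succ]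
      rfl
    · convert! Submodule.add_mem _ (hR₁ 0 ((2 * Real.pi * Complex.I) • coordMul v c) a)
        (hR₂ c (∂_{v} a)) using 1
      funext s
      change ∂_{v} (twist B s c a - (∫ w, c w) • a) = _
      rw [sub_eq_add_neg, lineDerivOp_add, lineDerivOp_neg, lineDerivOp_smul, lineDerivOp_twist]
      simp only [Pi.add_apply, zero_add, pow_one]
      abel
  · rintro _ (⟨m, c, a, rfl⟩ | ⟨c, a, rfl⟩) v
    · convert! Submodule.sub_mem _ (hR₁ m c (coordMul v a))
        (hR₁ (m + 1) (coordMul (ContinuousLinearMap.adjoint B v) c) a) using 1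
      funext s
      rw [map_smul, coordMul_twist, smul_sub, smul_smul, ← pow_succ]
      rfl
    · convert! Submodule.sub_mem _ (hR₂ c (coordMul v a))
        (hR₁ 0 (coordMul (ContinuousLinearMap.adjoint B v) c) a) using 1
      funext s
      rw [map_sub, map_smul, coordMul_twist]
      simp only [Pi.sub_apply, zero_add, pow_one]
      abel

end SchwartzMap

/-! ### The twisted product of Schwartz functions -/

namespace SchwartzMap

open Filter Topology LineDeriv MeasureTheory FourierTransform

variable {V : Type*} [NormedAddCommGroup V] [InnerProductSpace ℝ V]

theorem inner_skew_self {B : V →L[ℝ] V} (hB : ∀ x y, inner ℝ (B x) y = -inner ℝ x (B y)) (x : V) :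
    inner ℝ x (B x) = 0 := by
  have := hB x x
  rw [real_inner_comm] at this
  linarith

theorem chi_skew {B : V →L[ℝ] V} (hB : ∀ x y, inner ℝ (B x) y = -inner ℝ x (B y))
    (v w : V) : chi w (B v) = chi v (-B w) := by
  rw [chi, chi, inner_neg_right, ← hB, real_inner_comm]

variable [FiniteDimensional ℝ V]

variable (V) in
-- Seed of the approximate unit: by Fourier inversion at 0, e(0) = 1 means ∫ 𝓕 e = 1.
theorem exists_schwartz_apply_zero_eq_one : ∃ e : 𝓢(V, ℂ), e 0 = 1 := by
  let f : ContDiffBump (0 : V) := ⟨1, 2, one_pos, one_lt_two⟩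
  have h1 : HasCompactSupport (Complex.ofRealCLM ∘ f) := f.hasCompactSupport.comp_left rfl
  have h2 : ContDiff ℝ (⊤ : ℕ∞) (Complex.ofRealCLM ∘ f) :=
    Complex.ofRealCLM.contDiff.comp f.contDiff
  refine ⟨h1.toSchwartzMap h2, ?_⟩
  have : f 0 = 1 := f.one_of_mem_closedBall (by simp [f])
  simp [this]

variable [MeasurableSpace V] [BorelSpace V]

/-- The twisted product
`(a, b) ↦ (x ↦ ∫ exp (2 π i ⟪w, x⟫) a(x - B w) (𝓕 b)(w) dw)` of Schwartz functions. -/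
noncomputable def twistedMul (B : V →L[ℝ] V) (a b : 𝓢(V, ℂ)) : 𝓢(V, ℂ) := twist (-B) 1 (𝓕 b) a

theorem twistedMul_apply (B : V →L[ℝ] V) (a b : 𝓢(V, ℂ)) (x : V) :
    twistedMul B a b x = ∫ w, chi w x * a (x - B w) * 𝓕 b w := by
  simp [twistedMul, twist_apply, twistIntegral, sub_eq_add_neg]

theorem twistedMul_add_left (B : V →L[ℝ] V) (a b c : 𝓢(V, ℂ)) :
    twistedMul B (a + b) c = twistedMul B a c + twistedMul B b c :=
  twist_add_right _ _ _ _ _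

theorem twistedMul_smul_left (B : V →L[ℝ] V) (k : ℂ) (a b : 𝓢(V, ℂ)) :
    twistedMul B (k • a) b = k • twistedMul B a b :=
  twist_smul_right _ _ _ _ _

theorem continuous_twistedMul_left (B : V →L[ℝ] V) (b : 𝓢(V, ℂ)) :
    Continuous (fun a => twistedMul B a b) :=
  continuous_twist_right _ _ _

theorem integral_kernel_swap {k : V → V → ℂ} (hk : Continuous (Function.uncurry k)) {C : ℝ}
    (hC : ∀ v w, ‖k v w‖ ≤ C) (f g : 𝓢(V, ℂ)) :
    ∫ v, (∫ w, k v w * g w) * f v = ∫ w, (∫ v, k v w * f v) * g w := by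
  have hint : Integrable (Function.uncurry fun v w => k v w * (f v * g w))
      (volume.prod volume) :=
    (f.integrable.mul_prod g.integrable).bdd_mul (c := C) hk.aestronglyMeasurable
      (.of_forall fun p => hC p.1 p.2)
  have h := integral_integral_swap hint
  simp only [← integral_mul_const]
  convert! h using 3 with v w
  · congr! 2
    ring
  · congr! 2
    ring

theorem eq_integral_chi_fourier (a : 𝓢(V, ℂ)) (x : V) : a x = ∫ w, chi w x * 𝓕 a w := by
  have h : (𝓕⁻ (𝓕 a) : 𝓢(V, ℂ)) x = a x := by rw [fourierInv_fourier_eq]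
  rw [← h, fourierInv_coe, Real.fourierInv_eq']
  rfl

theorem fourier_apply_eq_integral_chi (a : 𝓢(V, ℂ)) (w : V) :
    𝓕 a w = ∫ x, chi w (-x) * a x := by
  rw [fourier_coe, Real.fourier_eq']
  refine integral_congr_ae (.of_forall fun x => ?_)
  simp [chi, real_inner_comm]

/-- Expanding the remaining unexpanded factor by Fourier inversion turns both sides into double
integrals over 𝓕 a and 𝓕 b. Their phases agree because ⟨w, Bv⟩ = -⟨v, Bw⟩, and Fubini exchanges the
order. -/
theorem twistedMul_eq_twist {B : V →L[ℝ] V} (hB : ∀ x y, inner ℝ (B x) y = -inner ℝ x (B y))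
    (a b : 𝓢(V, ℂ)) : twistedMul B a b = twist B 1 (𝓕 a) b := by
  ext x
  rw [twistedMul_apply, twist_apply, twistIntegral]
  have h1 : ∀ w, chi w x * a (x - B w) = ∫ v, chi w x * chi v (x - B w) * 𝓕 a v := by
    intro w
    rw [eq_integral_chi_fourier a (x - B w), ← integral_const_mul]
    simp only [mul_assoc]
  have h2 : ∀ v, chi v ((1 : ℝ) • x) * b (x + (1 : ℝ) • B v) =
      ∫ w, chi w x * chi v (x - B w) * 𝓕 b w := by
    intro v
    rw [one_smul, one_smul, eq_integral_chi_fourier b (x + B v), ← integral_const_mul]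
    refine integral_congr_ae (.of_forall fun w => ?_)
    simp only
    rw [chi_add_right, sub_eq_add_neg, chi_add_right, chi_skew hB v w]
    ring
  simp only [h1, h2]
  refine integral_kernel_swap (k := fun w v => chi w x * chi v (x - B w)) (C := 1) ?_ ?_ _ _
  · simp only [Function.uncurry_def]
    fun_prop
  · intro v w
    simp

theorem twistedMul_apply' {B : V →L[ℝ] V} (hB : ∀ x y, inner ℝ (B x) y = -inner ℝ x (B y))
    (a b : 𝓢(V, ℂ)) (x : V) :
    twistedMul B a b x = ∫ w, chi w x * b (x + B w) * 𝓕 a w := by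
  simp [twistedMul_eq_twist hB, twist_apply, twistIntegral]

/-- With `a` and `c` on the Fourier side and `b` left alone, both bracketings become the double
integral of b(x - Bv + Bw) against (𝓕 a)(w) (𝓕 c)(v), with equal phases by skewness. -/
theorem twistedMul_assoc {B : V →L[ℝ] V} (hB : ∀ x y, inner ℝ (B x) y = -inner ℝ x (B y))
    (a b c : 𝓢(V, ℂ)) :
    twistedMul B (twistedMul B a b) c = twistedMul B a (twistedMul B b c) := by
  ext x
  rw [twistedMul_apply, twistedMul_apply' hB]
  have h1 : ∀ v, chi v x * twistedMul B a b (x - B v) =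
      ∫ w, chi v x * chi w (x - B v) * b (x - B v + B w) * 𝓕 a w := by
    intro v
    rw [twistedMul_apply' hB, ← integral_const_mul]
    simp only [mul_assoc]
  have h2 : ∀ w, chi w x * twistedMul B b c (x + B w) =
      ∫ v, chi v x * chi w (x - B v) * b (x - B v + B w) * 𝓕 c v := by
    intro w
    rw [twistedMul_apply, ← integral_const_mul]
    refine integral_congr_ae (.of_forall fun v => ?_)
    simp only
    rw [chi_add_right, sub_eq_add_neg x, chi_add_right, chi_skew hB w v,
      show x + B w - B v = x + -B v + B w by abel]
    ring
  simp only [h1, h2]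
  refine integral_kernel_swap
    (k := fun v w => chi v x * chi w (x - B v) * b (x - B v + B w))
    (C := SchwartzMap.seminorm ℝ 0 0 b) ?_ ?_ _ _
  · simp only [Function.uncurry_def]
    fun_prop
  · intro v w
    simpa using norm_le_seminorm ℝ b _

/-- Translating x by Bw costs only the phase exp(2πi⟨w, Bw⟩) = 1. What remains is ∫ 𝓕⁻a · 𝓕 b = ∫
ab. -/
theorem integral_twistedMul {B : V →L[ℝ] V} (hB : ∀ x y, inner ℝ (B x) y = -inner ℝ x (B y))
    (a b : 𝓢(V, ℂ)) : ∫ x, twistedMul B a b x = ∫ x, a x * b x := by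
  have hint : Integrable (Function.uncurry fun x w => chi w x * a (x - B w) * 𝓕 b w)
      (volume.prod volume) := by
    rw [integrable_prod_iff']
    · refine ⟨.of_forall fun w => ?_, ?_⟩
      · simp only [Function.uncurry_apply_pair]
        refine (Integrable.bdd_mul (c := 1) (a.integrable.comp_sub_right (B w))
          (by fun_prop) (.of_forall fun x => ?_)).mul_const _
        simp
      · simp only [Function.uncurry_apply_pair, norm_mul, norm_chi, one_mul, integral_mul_const]
        have : ∀ w, ∫ x, ‖a (x - B w)‖ = ∫ x, ‖a x‖ := fun w =>
          integral_sub_right_eq_self (fun x => ‖a x‖) (B w)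
        simp only [this]
        exact (𝓕 b).integrable.norm.const_mul _
    · refine Continuous.aestronglyMeasurable ?_
      simp only [Function.uncurry_def]
      fun_prop
  simp only [twistedMul_apply]
  rw [integral_integral_swap hint]
  have h : ∀ w, ∫ x, chi w x * a (x - B w) * 𝓕 b w = 𝓕⁻ a w * 𝓕 b w := by
    intro w
    rw [integral_mul_const, ← integral_add_right_eq_self _ (B w), fourierInv_coe,
      Real.fourierInv_eq']
    congr 1
    refine integral_congr_ae (.of_forall fun x => ?_)
    have : chi w (B w) = 1 := by simp [chi, inner_skew_self hB]
    simp only [add_sub_cancel_right, chi_add_right, this, mul_one, chi_comm w x]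
    rfl
  simp only [h]
  rw [integral_fourierInv_mul_eq a (𝓕 b), fourierInv_fourier_eq]

theorem fourier_lineDerivOp_eq_coordMul (b : 𝓢(V, ℂ)) (v : V) :
    𝓕 (∂_{v} b) = (2 * Real.pi * Complex.I) • coordMul v (𝓕 b) := by
  have h : (inner ℝ · v : V → ℝ).HasTemperateGrowth := by fun_prop
  ext x
  rw [fourier_lineDerivOp_eq]
  simp [smulLeftCLM_apply_apply h]

theorem coordMul_fourier (b : 𝓢(V, ℂ)) (v : V) :
    coordMul v (𝓕 b) = -(Complex.I / (2 * Real.pi)) • 𝓕 (∂_{v} b) := by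
  rw [fourier_lineDerivOp_eq_coordMul, smul_smul]
  have : -(Complex.I / (2 * Real.pi)) * (2 * Real.pi * Complex.I) = 1 := by
    field_simp
    simp
  rw [this, one_smul]

/-- Write ⟨x, v⟩ = ⟨x - Bw, v⟩ - ⟨w, Bv⟩: the first term multiplies `a`, and the second, a linear
factor on the Fourier side, is a derivative of `b`. Together with its mirror image this determines
how linear functions act in the Moyal algebra. -/
theorem coordMul_twistedMul_left {B : V →L[ℝ] V} (hB : ∀ x y, inner ℝ (B x) y = -inner ℝ x (B y))
    (a b : 𝓢(V, ℂ)) (v : V) :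
    coordMul v (twistedMul B a b) = twistedMul B (coordMul v a) b +
      (Complex.I / (2 * Real.pi)) • twistedMul B a (∂_{B v} b) := by
  have hadj : ContinuousLinearMap.adjoint (-B) v = B v := by
    refine ext_inner_right ℝ fun y => ?_
    rw [ContinuousLinearMap.adjoint_inner_left, neg_apply, inner_neg_right, hB]
  rw [twistedMul, coordMul_twist, hadj, coordMul_fourier, twist_smul_left, Complex.ofReal_one,
    one_smul, neg_smul, sub_neg_eq_add]
  rfl

theorem coordMul_twistedMul_right {B : V →L[ℝ] V} (hB : ∀ x y, inner ℝ (B x) y = -inner ℝ x (B y))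
    (a b : 𝓢(V, ℂ)) (v : V) :
    coordMul v (twistedMul B a b) = twistedMul B a (coordMul v b) -
      (Complex.I / (2 * Real.pi)) • twistedMul B (∂_{B v} a) b := by
  have hadj : ContinuousLinearMap.adjoint B v = -B v := by
    refine ext_inner_right ℝ fun y => ?_
    rw [ContinuousLinearMap.adjoint_inner_left, inner_neg_left, hB, neg_neg]
  rw [twistedMul_eq_twist hB, coordMul_twist, hadj, Complex.ofReal_one, one_smul,
    twistedMul_eq_twist hB, twistedMul_eq_twist hB]
  have : coordMul (-B v) (𝓕 a) = (Complex.I / (2 * Real.pi)) • 𝓕 (∂_{B v} a) := by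
    have h := coordMul_fourier a (B v)
    rw [neg_smul] at h
    rw [← neg_eq_iff_eq_neg.2 h]
    ext x
    simp
  rw [this, twist_smul_left]

/-- The substitution w ↦ sw converts a dilation of the right factor into the parameter s of `twist`;
the Jacobian cancels the scaling factor of the Fourier transform. The limit s → 0 then yields an
approximate unit. -/
theorem twistedMul_comp_smul (B : V →L[ℝ] V) (a e : 𝓢(V, ℂ)) {s : ℝ} (hs : s ≠ 0) :
    twistedMul B a (compCLMOfContinuousLinearEquiv ℂ
      (ContinuousLinearEquiv.smulLeft (Units.mk0 s hs) : V ≃L[ℝ] V) e) =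
      twist (-B) s (𝓕 e) a := by
  have hF : ∀ w : V, 𝓕 (compCLMOfContinuousLinearEquiv ℂ
      (ContinuousLinearEquiv.smulLeft (Units.mk0 s hs) : V ≃L[ℝ] V) e) (s • w) =
      |(s ^ Module.finrank ℝ V)⁻¹| • 𝓕 e w := by
    intro w
    rw [fourier_apply_eq_integral_chi, fourier_apply_eq_integral_chi,
      ← Measure.integral_comp_smul volume (fun x => chi w (-x) * e x) s]
    refine integral_congr_ae (.of_forall fun x => ?_)
    have : chi (s • w) (-x) = chi w (-(s • x)) := by
      simp [chi, real_inner_smul_left, real_inner_smul_right]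
    simp only [this]
    rfl
  ext x
  have hpos : |(s ^ Module.finrank ℝ V)⁻¹| ≠ 0 := by positivity
  rw [twistedMul_apply, twist_apply, twistIntegral]
  refine smul_right_injective ℂ hpos ?_
  simp only
  rw [← Measure.integral_comp_smul, ← integral_smul]
  refine integral_congr_ae (.of_forall fun w => ?_)
  have : chi (s • w) x = chi w (s • x) := by
    simp [chi, real_inner_smul_left, real_inner_smul_right]
  simp only [hF, this, map_smul, neg_apply, smul_neg, ← sub_eq_add_neg,
    Complex.real_smul]
  ring

/-- The twisted product has a sequential approximate right unit. -/
theorem exists_tendsto_twistedMul (B : V →L[ℝ] V) :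
    ∃ e : ℕ → 𝓢(V, ℂ), ∀ a, Tendsto (fun k => twistedMul B a (e k)) atTop (𝓝 a) := by
  obtain ⟨e, he⟩ := exists_schwartz_apply_zero_eq_one V
  have hs : ∀ k : ℕ, (1 / ((k : ℝ) + 1)) ≠ 0 := fun k => by positivity
  refine ⟨fun k => compCLMOfContinuousLinearEquiv ℂ
      (ContinuousLinearEquiv.smulLeft (Units.mk0 _ (hs k)) : V ≃L[ℝ] V) e, fun a => ?_⟩
  simp only [twistedMul_comp_smul]
  have hint : ∫ w, 𝓕 e w = 1 := by
    rw [← he, eq_integral_chi_fourier e 0]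
    simp
  have h := (tendsto_twist_zero (-B) (𝓕 e) a).comp tendsto_one_div_add_atTop_nhds_zero_nat
  rw [hint, one_smul] at h
  exact h

end SchwartzMap

/-! ### The Moyal integral as a twisted product -/

namespace Moyal

open Filter Topology LineDeriv MeasureTheory FourierTransform SchwartzMap

theorem Theta_transpose (n : ℕ) (θ : ℝ) : (Theta n θ).transpose = -Theta n θ := by
  ext ⟨i, k⟩ ⟨j, l⟩
  fin_cases i <;> fin_cases j <;>
    simp [Theta, Matrix.blockDiagonal_apply, eq_comm (a := k) (b := l)] <;> split_ifs <;> simp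

theorem Theta_det (n : ℕ) (θ : ℝ) : (Theta n θ).det = θ ^ (2 * n) := by
  rw [Theta, Matrix.det_smul, Matrix.det_blockDiagonal]
  simp [Matrix.det_fin_two]

theorem isUnit_Theta_det (n : ℕ) {θ : ℝ} (hθ : θ ≠ 0) : IsUnit (Theta n θ).det := by
  rw [Theta_det]
  exact (pow_ne_zero _ hθ).isUnit

theorem Theta_inv_transpose (n : ℕ) {θ : ℝ} (hθ : θ ≠ 0) :
    (Theta n θ)⁻¹.transpose = -(Theta n θ)⁻¹ := by
  rw [Matrix.transpose_nonsing_inv, Theta_transpose]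
  refine Matrix.inv_eq_right_inv ?_
  rw [neg_mul_neg, Matrix.mul_nonsing_inv _ (isUnit_Theta_det n hθ)]

theorem Theta_inv_apply_swap (n : ℕ) {θ : ℝ} (hθ : θ ≠ 0) (μ ν : Idx n) :
    (Theta n θ)⁻¹ ν μ = -(Theta n θ)⁻¹ μ ν :=
  congrFun (congrFun (Theta_inv_transpose n hθ) μ) ν

/-- The linear map `π Θ`. -/
noncomputable def piTheta (n : ℕ) (θ : ℝ) : Space n →L[ℝ] Space n :=
  Real.pi • Matrix.toEuclideanCLM (𝕜 := ℝ) (Theta n θ)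

theorem inner_piTheta (n : ℕ) (θ : ℝ) (x y : Space n) :
    inner ℝ (piTheta n θ x) y = -inner ℝ x (piTheta n θ y) := by
  rw [real_inner_comm]
  simp only [piTheta, smul_apply, inner_smul_right,
    Matrix.inner_toEuclideanCLM]
  rw [Matrix.dotProduct_mulVec, dotProduct_comm, ← Matrix.mulVec_transpose, Theta_transpose,
    Matrix.neg_mulVec, dotProduct_neg, mul_neg]

/-- Under y = -πΘw the phase -2i yΘ⁻¹z becomes -2πi⟨w, z⟩, the Fourier kernel. -/
theorem thetaInvForm_piTheta (n : ℕ) {θ : ℝ} (hθ : θ ≠ 0) (w z : Space n) :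
    thetaInvForm n θ (-piTheta n θ w) z = Real.pi * inner ℝ w z := by
  have h : ∀ y z : Space n, thetaInvForm n θ y z =
      inner ℝ y (Matrix.toEuclideanCLM (𝕜 := ℝ) (Theta n θ)⁻¹ z) := by
    intro y z
    rw [Matrix.inner_toEuclideanCLM]
    simp only [thetaInvForm, dotProduct, Matrix.mulVec, Finset.mul_sum, mul_assoc]
  rw [h, inner_neg_left, inner_piTheta, neg_neg, piTheta, smul_apply,
    inner_smul_right, ← mul_apply_eq_comp, ← map_mul,
    Matrix.mul_nonsing_inv _ (isUnit_Theta_det n hθ), map_one, one_apply_eq_self]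

/-- The Jacobian cancels the prefactor (πθ)^(-D) of the Moyal product; no absolute value is needed
on the right because D = 2n is even. -/
theorem abs_det_neg_piTheta (n : ℕ) (θ : ℝ) :
    |LinearMap.det ((-piTheta n θ : Space n →L[ℝ] Space n) : Space n →ₗ[ℝ] Space n)| =
      (Real.pi * θ) ^ (2 * n) := by
  have : ((-piTheta n θ : Space n →L[ℝ] Space n) : Space n →ₗ[ℝ] Space n) =
      (-Real.pi) • Matrix.toEuclideanLin (Theta n θ) := by
    ext x : 1
    simp [piTheta, ← Matrix.coe_toEuclideanCLM_eq_toEuclideanLin]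
  rw [this, LinearMap.det_smul, Matrix.toEuclideanLin_eq_toLin_orthonormal, LinearMap.det_toLin,
    Theta_det, finrank_euclideanSpace]
  simp only [Fintype.card_prod, Fintype.card_fin]
  rw [← mul_pow, abs_of_nonneg ((even_two_mul n).pow_nonneg _), neg_mul, (even_two_mul n).neg_pow]

theorem integral_eq_abs_det_smul {E : Type*} [NormedAddCommGroup E] [InnerProductSpace ℝ E]
    [FiniteDimensional ℝ E] [MeasurableSpace E] [BorelSpace E] (f : E →ₗ[ℝ] E)
    (hf : LinearMap.det f ≠ 0) (F : E → ℂ) :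
    ∫ y, F y = |LinearMap.det f| • ∫ w, F (f w) := by
  have hemb : MeasurableEmbedding f :=
    (LinearEquiv.ofIsUnitDet (f := f) (v := Module.finBasis ℝ E) (v' := Module.finBasis ℝ E)
      (by rw [LinearMap.det_toMatrix]; exact hf.isUnit)).toContinuousLinearEquiv
        |>.toHomeomorph.measurableEmbedding
  rw [← hemb.integral_map, Measure.map_linearMap_addHaar_eq_smul_addHaar volume hf,
    integral_smul_measure, ENNReal.toReal_ofReal (abs_nonneg _), smul_smul, ← abs_mul,
    mul_inv_cancel₀ hf, abs_one, one_smul]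

theorem starIntegral_eq_twistedMul (n : ℕ) {θ : ℝ} (hθ : θ ≠ 0) (a b : 𝓢(Space n, ℂ))
    (x : Space n) : starIntegral n θ a b x = twistedMul (piTheta n θ) a b x := by
  have hpos : (Real.pi * θ) ^ (2 * n) ≠ 0 := pow_ne_zero _ (mul_ne_zero Real.pi_ne_zero hθ)
  have hdet : LinearMap.det ((-piTheta n θ : Space n →L[ℝ] Space n) : Space n →ₗ[ℝ] Space n)
      ≠ 0 := by
    rw [← abs_ne_zero, abs_det_neg_piTheta]
    exact hpos
  rw [starIntegral, integral_eq_abs_det_smul _ hdet, abs_det_neg_piTheta, Complex.real_smul,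
    inv_mul_cancel_left₀ (by exact_mod_cast hpos), twistedMul_apply]
  refine integral_congr_ae (.of_forall fun w => ?_)
  simp only [ContinuousLinearMap.coe_coe, neg_apply, ← sub_eq_add_neg]
  have h1 : ∀ z, Complex.exp (-2 * Complex.I * (thetaInvForm n θ (-piTheta n θ w) z : ℂ)) =
      chi w (-z) := by
    intro z
    rw [thetaInvForm_piTheta n hθ, chi, inner_neg_right]
    push_cast
    ring_nf
  have h2 : chi w x * 𝓕 b w = ∫ z, b (x + z) * chi w (-z) := by
    rw [fourier_apply_eq_integral_chi,
      ← integral_add_left_eq_self (fun z => chi w (-z) * b z) x, ← integral_const_mul]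
    refine integral_congr_ae (.of_forall fun z => ?_)
    simp only
    rw [mul_comm (b _), ← mul_assoc, ← chi_add_right]
    simp
  simp only [h1]
  simp only [mul_assoc, integral_const_mul]
  rw [← h2]
  ring

theorem star_eq_twistedMul (n : ℕ) {θ : ℝ} (hθ : θ ≠ 0) (a b : 𝓢(Space n, ℂ)) :
    star n θ a b = twistedMul (piTheta n θ) a b := by
  have h : ∃ c : 𝓢(Space n, ℂ), ∀ x, c x = starIntegral n θ a b x :=
    ⟨_, fun x => (starIntegral_eq_twistedMul n hθ a b x).symm⟩
  ext x
  rw [star, dif_pos h, h.choose_spec, starIntegral_eq_twistedMul n hθ]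

theorem star_apply (n : ℕ) {θ : ℝ} (hθ : θ ≠ 0) (a b : 𝓢(Space n, ℂ)) (x : Space n) :
    star n θ a b x = starIntegral n θ a b x := by
  rw [star_eq_twistedMul n hθ, starIntegral_eq_twistedMul n hθ]

end Moyal

theorem Continuous.eq_zero_of_forall_integral_schwartz_smul {E : Type*} [NormedAddCommGroup E]
    [InnerProductSpace ℝ E] [FiniteDimensional ℝ E] [MeasurableSpace E] [BorelSpace E] {f : E → ℂ}
    (hf : Continuous f) (h : ∀ φ : 𝓢(E, ℂ), ∫ x, φ x • f x = 0) : f = 0 := by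
  refine (MeasureTheory.Measure.eq_of_ae_eq (μ := MeasureTheory.volume) ?_ hf continuous_zero)
  refine ae_eq_zero_of_integral_contDiff_smul_eq_zero hf.locallyIntegrable fun g hg hc => ?_
  have h1 : HasCompactSupport (Complex.ofRealCLM ∘ g) := hc.comp_left rfl
  have h2 : ContDiff ℝ (⊤ : ℕ∞) (Complex.ofRealCLM ∘ g) := Complex.ofRealCLM.contDiff.comp hg
  simpa using h (h1.toSchwartzMap h2)

/-! ### Multipliers and the algebra structure -/

namespace Moyal

open Filter Topology LineDeriv MeasureTheory FourierTransform SchwartzMap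

theorem schwartz_eq_of_forall_integral {n : ℕ} {c d : 𝓢(Space n, ℂ)}
    (h : ∀ b : 𝓢(Space n, ℂ), (c : 𝓢'(Space n, ℂ)) b = (d : 𝓢'(Space n, ℂ)) b) : c = d := by
  have : ⇑(c - d) = 0 := by
    refine Continuous.eq_zero_of_forall_integral_schwartz_smul (c - d).continuous fun φ => ?_
    have h1 := sub_eq_zero.2 (h φ)
    rw [← sub_apply, ← map_sub, coe_apply] at h1
    exact h1
  ext x
  exact sub_eq_zero.1 (congrFun this x)

section Star

variable {n : ℕ} {θ : ℝ} [hθ : NeZero θ]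

theorem star_add_left (a b c : 𝓢(Space n, ℂ)) :
    star n θ (a + b) c = star n θ a c + star n θ b c := by
  simp only [star_eq_twistedMul n hθ.out, twistedMul_add_left]

theorem star_smul_left (k : ℂ) (a b : 𝓢(Space n, ℂ)) :
    star n θ (k • a) b = k • star n θ a b := by
  simp only [star_eq_twistedMul n hθ.out, twistedMul_smul_left]

theorem star_assoc (a b c : 𝓢(Space n, ℂ)) :
    star n θ (star n θ a b) c = star n θ a (star n θ b c) := by
  simp only [star_eq_twistedMul n hθ.out]
  exact twistedMul_assoc (inner_piTheta n θ) a b c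

theorem integral_star (a b : 𝓢(Space n, ℂ)) : ∫ x, star n θ a b x = ∫ x, a x * b x := by
  simp only [star_eq_twistedMul n hθ.out]
  exact integral_twistedMul (inner_piTheta n θ) a b

/-- Right multiplication by `b` on the Schwartz space. -/
noncomputable def starRightCLM (n : ℕ) (θ : ℝ) [hθ : NeZero θ] (b : 𝓢(Space n, ℂ)) :
    𝓢(Space n, ℂ) →L[ℂ] 𝓢(Space n, ℂ) where
  toFun a := star n θ a b
  map_add' a c := star_add_left a c b
  map_smul' k a := star_smul_left k a b
  cont := by
    simp only [star_eq_twistedMul n hθ.out]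
    exact continuous_twistedMul_left (piTheta n θ) b

variable (n θ) in
theorem exists_tendsto_star :
    ∃ e : ℕ → 𝓢(Space n, ℂ), ∀ a, Tendsto (fun k => star n θ a (e k)) atTop (𝓝 a) := by
  simp only [star_eq_twistedMul n hθ.out]
  exact exists_tendsto_twistedMul (piTheta n θ)

/-- Both sides equal ∫ a ⋆ b ⋆ c, by the trace identity and associativity. Thus the product of
distributions extends that of Schwartz functions. -/
theorem pairing_star_left (a b c : 𝓢(Space n, ℂ)) :
    (star n θ a b : 𝓢'(Space n, ℂ)) c = (a : 𝓢'(Space n, ℂ)) (star n θ b c) := by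
  simp only [coe_apply, smul_eq_mul]
  have h1 := integral_star (θ := θ) (star n θ a b) c
  have h2 := integral_star (θ := θ) a (star n θ b c)
  rw [star_assoc, h2] at h1
  simpa only [mul_comm] using h1.symm

theorem pairing_comm (a b : 𝓢(Space n, ℂ)) :
    (a : 𝓢'(Space n, ℂ)) b = (b : 𝓢'(Space n, ℂ)) a := by
  simp only [coe_apply, smul_eq_mul, mul_comm]

theorem pairing_star_right (a b c : 𝓢(Space n, ℂ)) :
    (star n θ a b : 𝓢'(Space n, ℂ)) c = (b : 𝓢'(Space n, ℂ)) (star n θ c a) := by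
  rw [pairing_comm, ← pairing_star_left, pairing_comm]

end Star

section Multipliers

variable {n : ℕ} {θ : ℝ}

/-- The Schwartz function `T ⋆ a`. -/
noncomputable def rightAct (T : Alg n θ) (a : 𝓢(Space n, ℂ)) : 𝓢(Space n, ℂ) :=
  (T.2.2 a).choose

/-- The Schwartz function `a ⋆ T`. -/
noncomputable def leftAct (a : 𝓢(Space n, ℂ)) (T : Alg n θ) : 𝓢(Space n, ℂ) :=
  (T.2.1 a).choose

theorem starRightEq_rightAct (T : Alg n θ) (a : 𝓢(Space n, ℂ)) :
    StarRightEq n θ (T : 𝓢'(Space n, ℂ)) a (rightAct T a) :=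
  (T.2.2 a).choose_spec

theorem starLeftEq_leftAct (a : 𝓢(Space n, ℂ)) (T : Alg n θ) :
    StarLeftEq n θ a (T : 𝓢'(Space n, ℂ)) (leftAct a T) :=
  (T.2.1 a).choose_spec

/-- A Schwartz function is determined by its pairings, so the choice in `rightAct` is harmless; its
properties, linearity included, are derived from this uniqueness. -/
theorem rightAct_eq {T : Alg n θ} {a c : 𝓢(Space n, ℂ)}
    (h : StarRightEq n θ (T : 𝓢'(Space n, ℂ)) a c) : rightAct T a = c :=
  schwartz_eq_of_forall_integral fun b => (starRightEq_rightAct T a b).symm.trans (h b)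

theorem rightAct_add_left (T S : Alg n θ) (a : 𝓢(Space n, ℂ)) :
    rightAct (T + S) a = rightAct T a + rightAct S a :=
  rightAct_eq fun c => by
    rw [map_add]
    exact congrArg₂ (· + ·) (starRightEq_rightAct T a c) (starRightEq_rightAct S a c)

theorem rightAct_smul_left (k : ℂ) (T : Alg n θ) (a : 𝓢(Space n, ℂ)) :
    rightAct (k • T) a = k • rightAct T a :=
  rightAct_eq fun c => by
    rw [map_smul]
    exact congrArg (k • ·) (starRightEq_rightAct T a c)

theorem alg_ext {T S : Alg n θ}
    (h : ∀ a, (T : 𝓢'(Space n, ℂ)) a = (S : 𝓢'(Space n, ℂ)) a) : T = S :=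
  Subtype.ext (DFunLike.ext _ _ h)

theorem polyDist_one_apply (a : 𝓢(Space n, ℂ)) :
    polyDist (1 : MvPolynomial (Idx n) ℂ) a = ∫ x, a x := by
  simp [polyDist, polyFun]

variable [hθ : NeZero θ]

theorem rightAct_star (T : Alg n θ) (a b : 𝓢(Space n, ℂ)) :
    rightAct T (star n θ a b) = star n θ (rightAct T a) b :=
  rightAct_eq fun c => by
    rw [star_assoc, starRightEq_rightAct, pairing_star_left]

/-- Continuity of a ↦ S ⋆ a is not part of the definition of a multiplier. With an approximate unit
e_k, ⟨T, (S ⋆ a) ⋆ e_k⟩ = ⟨S, a ⋆ (e_k ⋆ T)⟩ is continuous in `a`, because e_k ⋆ T is a fixed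
Schwartz function. These functionals converge pointwise to the desired one, and Banach–Steinhaus
makes the limit continuous. -/
theorem exists_continuous_product (T S : Alg n θ) :
    ∃ U : 𝓢'(Space n, ℂ), ∀ a, U a = (T : 𝓢'(Space n, ℂ)) (rightAct S a) := by
  obtain ⟨e, he⟩ := exists_tendsto_star n θ
  let S' : 𝓢(Space n, ℂ) →L[ℂ] ℂ := (S : 𝓢'(Space n, ℂ))
  let g : ℕ → 𝓢(Space n, ℂ) →L[ℂ] ℂ := fun k => S'.comp (starRightCLM n θ (leftAct (e k) T))
  have hg : ∀ k a, g k a = (T : 𝓢'(Space n, ℂ)) (star n θ (rightAct S a) (e k)) := by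
    intro k a
    rw [starLeftEq_leftAct, pairing_comm]
    exact starRightEq_rightAct S a (leftAct (e k) T)
  have hlim : Tendsto (fun k a => g k a) atTop
      (𝓝 fun a => (T : 𝓢'(Space n, ℂ)) (rightAct S a)) := by
    rw [tendsto_pi_nhds]
    intro a
    simp only [hg]
    exact ((T : 𝓢'(Space n, ℂ)).continuous.tendsto _).comp (he _)
  exact ⟨ContinuousLinearMap.toPointwiseConvergenceCLM _ _ _ _
    (continuousLinearMapOfTendsto g hlim), fun a => rfl⟩

/-- The product is again a two-sided multiplier: a ⋆ (T ⋆ S) = (a ⋆ T) ⋆ S and (T ⋆ S) ⋆ a = T ⋆ (S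
⋆ a) are Schwartz functions. -/
theorem exists_isProduct (T S : Alg n θ) : ∃ U, IsProduct T S U := by
  obtain ⟨U, hU⟩ := exists_continuous_product T S
  refine ⟨⟨U, ?_, ?_⟩, ?_⟩
  · intro a
    refine ⟨leftAct (leftAct a T) S, fun b => ?_⟩
    rw [hU, rightAct_star, starLeftEq_leftAct, pairing_comm, ← starRightEq_rightAct,
      starLeftEq_leftAct]
  · intro a
    refine ⟨rightAct T (rightAct S a), fun b => ?_⟩
    rw [hU, rightAct_star, starRightEq_rightAct]
  · intro a c hc
    rw [← rightAct_eq hc]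
    exact hU a

theorem isProduct_mul (T S : Alg n θ) : IsProduct T S (T * S) := by
  have h := exists_isProduct T S
  have h1 : T * S = h.choose := dif_pos h
  rw [h1]
  exact h.choose_spec

theorem mul_apply_schwartz (T S : Alg n θ) (a : 𝓢(Space n, ℂ)) :
    ((T * S : Alg n θ) : 𝓢'(Space n, ℂ)) a = (T : 𝓢'(Space n, ℂ)) (rightAct S a) :=
  isProduct_mul T S a _ (starRightEq_rightAct S a)

theorem rightAct_mul (T S : Alg n θ) (a : 𝓢(Space n, ℂ)) :
    rightAct (T * S) a = rightAct T (rightAct S a) :=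
  rightAct_eq fun b => by
    rw [mul_apply_schwartz, rightAct_star, starRightEq_rightAct]

theorem coe_one : ((1 : Alg n θ) : 𝓢'(Space n, ℂ)) = polyDist 1 := by
  have h : polyDist (1 : MvPolynomial (Idx n) ℂ) ∈
      leftMultipliers n θ ⊓ rightMultipliers n θ := by
    refine ⟨fun a => ⟨a, fun b => ?_⟩, fun a => ⟨a, fun b => ?_⟩⟩
    · rw [polyDist_one_apply, integral_star, coe_apply]
      simp only [smul_eq_mul]
    · rw [polyDist_one_apply, integral_star, coe_apply]
      simp only [smul_eq_mul, mul_comm]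
  have h1 : (1 : Alg n θ) = ⟨polyDist 1, h⟩ := dif_pos h
  rw [h1]

theorem rightAct_one (a : 𝓢(Space n, ℂ)) : rightAct (1 : Alg n θ) a = a :=
  rightAct_eq fun b => by
    rw [coe_one, polyDist_one_apply, integral_star, coe_apply]
    simp only [smul_eq_mul, mul_comm]

/-- The claim is ∫ T ⋆ a = ⟨T, a⟩. For a ⋆ e_k in place of `a` it follows from the trace identity,
and both sides converge as k grows. -/
theorem one_mul_alg (T : Alg n θ) : 1 * T = T := by
  refine alg_ext fun a => ?_
  obtain ⟨e, he⟩ := exists_tendsto_star n θ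
  rw [mul_apply_schwartz, coe_one, polyDist_one_apply]
  have h1 : Tendsto (fun k => (T : 𝓢'(Space n, ℂ)) (star n θ a (e k))) atTop
      (𝓝 ((T : 𝓢'(Space n, ℂ)) a)) := ((T : 𝓢'(Space n, ℂ)).continuous.tendsto _).comp (he _)
  have h2 : Tendsto (fun k => ∫ x, star n θ (rightAct T a) (e k) x) atTop
      (𝓝 (∫ x, rightAct T a x)) :=
    ((integralCLM ℂ (volume : Measure (Space n))).continuous.tendsto _).comp (he (rightAct T a))
  refine tendsto_nhds_unique h2 (h1.congr fun k => ?_)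
  rw [starRightEq_rightAct, coe_apply, integral_star]
  simp only [smul_eq_mul, mul_comm]

/-- Built on `instMulAlg` and `instOneAlg`, so ring lemmas apply to the product and the unit
occurring in the definitions. -/
noncomputable instance instRingAlg : Ring (Alg n θ) where
  __ := (inferInstance : AddCommGroup (Alg n θ))
  __ := instMulAlg
  __ := instOneAlg
  left_distrib T S U := alg_ext fun a => by
    change _ = ((T * S : Alg n θ) : 𝓢'(Space n, ℂ)) a + ((T * U : Alg n θ) : 𝓢'(Space n, ℂ)) a
    simp only [mul_apply_schwartz, rightAct_add_left, map_add]
  right_distrib T S U := alg_ext fun a => by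
    change _ = ((T * U : Alg n θ) : 𝓢'(Space n, ℂ)) a + ((S * U : Alg n θ) : 𝓢'(Space n, ℂ)) a
    simp only [mul_apply_schwartz]
    rfl
  zero_mul T := alg_ext fun a => by
    rw [mul_apply_schwartz]
    rfl
  mul_zero T := alg_ext fun a => by
    have : rightAct (0 : Alg n θ) a = 0 := rightAct_eq fun b => by rw [map_zero]; rfl
    rw [mul_apply_schwartz, this, map_zero]
    rfl
  mul_assoc T S U := alg_ext fun a => by
    simp only [mul_apply_schwartz, rightAct_mul]
  one_mul := one_mul_alg
  mul_one T := alg_ext fun a => by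
    rw [mul_apply_schwartz, rightAct_one]

noncomputable instance instAlgebraAlg : Algebra ℂ (Alg n θ) :=
  Algebra.ofModule
    (fun k T S => alg_ext fun a => by
      change _ = k • ((T * S : Alg n θ) : 𝓢'(Space n, ℂ)) a
      simp only [mul_apply_schwartz]
      rfl)
    (fun k T S => alg_ext fun a => by
      change _ = k • ((T * S : Alg n θ) : 𝓢'(Space n, ℂ)) a
      simp only [mul_apply_schwartz, rightAct_smul_left, map_smul])

end Multipliers

end Moyal

/-! ### Polynomials as distributions and as multipliers -/

namespace SchwartzMap

open MeasureTheory FourierTransform LineDeriv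

variable {V : Type*} [NormedAddCommGroup V] [InnerProductSpace ℝ V] [FiniteDimensional ℝ V]
  [MeasurableSpace V] [BorelSpace V]

/-- The integral is the Fourier transform at 0, where the linear factor produced by the derivative
vanishes. -/
theorem integral_lineDerivOp_eq_zero (f : 𝓢(V, ℂ)) (v : V) : ∫ x, ∂_{v} f x = 0 := by
  have h : ∀ g : 𝓢(V, ℂ), 𝓕 g 0 = ∫ x, g x := fun g => by
    rw [fourier_apply_eq_integral_chi]
    simp [chi]
  rw [← h, fourier_lineDerivOp_eq_coordMul]
  simp

end SchwartzMap

namespace Moyal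

open Filter Topology LineDeriv MeasureTheory FourierTransform SchwartzMap

section Polynomials

variable {n : ℕ}

/-- The linear form `⟪·, v⟫` as a polynomial. -/
noncomputable def linForm (v : Space n) : MvPolynomial (Idx n) ℂ :=
  ∑ μ, MvPolynomial.C (v μ : ℂ) * MvPolynomial.X μ

/-- The derivative of a polynomial in the direction `v`. -/
noncomputable def dirDeriv (v : Space n) :
    Derivation ℂ (MvPolynomial (Idx n) ℂ) (MvPolynomial (Idx n) ℂ) :=
  MvPolynomial.mkDerivation ℂ fun μ => MvPolynomial.C (v μ : ℂ)

theorem dirDeriv_X (v : Space n) (μ : Idx n) :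
    dirDeriv v (MvPolynomial.X μ) = MvPolynomial.C (v μ : ℂ) :=
  MvPolynomial.mkDerivation_X _ _ _

theorem dirDeriv_single (μ : Idx n) :
    dirDeriv (EuclideanSpace.single μ (1 : ℝ)) = MvPolynomial.pderiv (R := ℂ) μ := by
  refine MvPolynomial.derivation_ext fun ν => ?_
  rw [dirDeriv_X, MvPolynomial.pderiv_X, PiLp.single_apply, Pi.single_apply]
  split_ifs <;> simp

theorem dirDeriv_C (v : Space n) (c : ℂ) : dirDeriv v (MvPolynomial.C c) = 0 :=
  (dirDeriv v).map_algebraMap c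

theorem dirDeriv_linForm (v w : Space n) :
    dirDeriv v (linForm w) = MvPolynomial.C ((inner ℝ v w : ℝ) : ℂ) := by
  simp only [linForm, map_sum, Derivation.leibniz, dirDeriv_X, dirDeriv_C, smul_eq_mul, ← map_mul,
    PiLp.inner_apply]
  rw [Complex.ofReal_sum, map_sum]
  simp

@[simp]
theorem polyFun_add (p q : MvPolynomial (Idx n) ℂ) (x : Space n) :
    polyFun (p + q) x = polyFun p x + polyFun q x := by simp [polyFun]

@[simp]
theorem polyFun_smul (k : ℂ) (p : MvPolynomial (Idx n) ℂ) (x : Space n) :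
    polyFun (k • p) x = k * polyFun p x := by simp [polyFun]

@[simp]
theorem polyFun_mul (p q : MvPolynomial (Idx n) ℂ) (x : Space n) :
    polyFun (p * q) x = polyFun p x * polyFun q x := by simp [polyFun]

theorem polyFun_linForm (v x : Space n) : polyFun (linForm v) x = ((inner ℝ x v : ℝ) : ℂ) := by
  simp [polyFun, linForm, PiLp.inner_apply]

theorem hasFDerivAt_polyFun (p : MvPolynomial (Idx n) ℂ) (x : Space n) :
    ∃ f' : Space n →L[ℝ] ℂ, HasFDerivAt (polyFun p) f' x ∧
      ∀ v, f' v = polyFun (dirDeriv v p) x := by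
  induction p using MvPolynomial.induction_on with
  | C c =>
    have : (polyFun (MvPolynomial.C c) : Space n → ℂ) = fun _ => c := by
      funext x; simp [polyFun]
    exact ⟨0, this ▸ hasFDerivAt_const c x, fun v => by simp [polyFun]⟩
  | add p q hp hq =>
    obtain ⟨f', hf, hf'⟩ := hp
    obtain ⟨g', hg, hg'⟩ := hq
    have : (polyFun (p + q) : Space n → ℂ) = polyFun p + polyFun q := by
      funext x; simp
    exact ⟨f' + g', this ▸ hf.add hg, fun v => by simp [hf', hg']⟩
  | mul_X p μ hp =>
    obtain ⟨f', hf, hf'⟩ := hp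
    let L : Space n →L[ℝ] ℂ := Complex.ofRealCLM.comp (EuclideanSpace.proj μ : Space n →L[ℝ] ℝ)
    have : (polyFun (p * MvPolynomial.X μ) : Space n → ℂ) = polyFun p * L := by
      funext x; simp [polyFun, L]
    refine ⟨_, this ▸ hf.mul L.hasFDerivAt, fun v => ?_⟩
    rw [Derivation.leibniz, dirDeriv_X]
    simp [hf', L, polyFun]

/-- Multiplication of a Schwartz function by a polynomial. -/
noncomputable def polyMul (p : MvPolynomial (Idx n) ℂ) : 𝓢(Space n, ℂ) →L[ℂ] 𝓢(Space n, ℂ) :=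
  smulLeftCLM ℂ (polyFun p)

@[simp]
theorem polyMul_apply (p : MvPolynomial (Idx n) ℂ) (a : 𝓢(Space n, ℂ)) (x : Space n) :
    polyMul p a x = polyFun p x * a x := by
  rw [polyMul, smulLeftCLM_apply_apply (polyFun_hasTemperateGrowth p), smul_eq_mul]

theorem polyDist_apply (p : MvPolynomial (Idx n) ℂ) (a : 𝓢(Space n, ℂ)) :
    polyDist p a = ∫ x, polyMul p a x := by
  simp [polyDist, mul_comm]

theorem lineDerivOp_polyMul (p : MvPolynomial (Idx n) ℂ) (a : 𝓢(Space n, ℂ)) (v : Space n) :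
    ∂_{v} (polyMul p a) = polyMul (dirDeriv v p) a + polyMul p (∂_{v} a) := by
  ext x
  obtain ⟨f', hf, hf'⟩ := hasFDerivAt_polyFun p x
  have h : ⇑(polyMul p a) = polyFun p * ⇑a := by
    funext x; simp
  rw [lineDerivOp_apply_eq_fderiv, h, (hf.mul (a.hasFDerivAt x)).fderiv]
  simp [hf', lineDerivOp_apply_eq_fderiv]
  ring

theorem polyDist_lineDerivOp (p : MvPolynomial (Idx n) ℂ) (a : 𝓢(Space n, ℂ)) (v : Space n) :
    polyDist p (∂_{v} a) = -polyDist (dirDeriv v p) a := by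
  have h := integral_lineDerivOp_eq_zero (polyMul p a) v
  rw [lineDerivOp_polyMul] at h
  simp only [add_apply] at h
  rw [integral_add (integrable _) (integrable _), ← polyDist_apply, ← polyDist_apply] at h
  exact eq_neg_of_add_eq_zero_right h

theorem polyDist_coordMul (p : MvPolynomial (Idx n) ℂ) (a : 𝓢(Space n, ℂ)) (v : Space n) :
    polyDist p (coordMul v a) = polyDist (linForm v * p) a := by
  rw [polyDist_apply, polyDist_apply]
  refine integral_congr_ae (.of_forall fun x => ?_)
  simp only [polyMul_apply, coordMul_apply, polyFun_mul, polyFun_linForm]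
  ring

/-- Polynomials as tempered distributions, as a linear map. -/
noncomputable def polyDistL (n : ℕ) : MvPolynomial (Idx n) ℂ →ₗ[ℂ] 𝓢'(Space n, ℂ) where
  toFun := polyDist
  map_add' p q := by
    refine DFunLike.ext _ _ fun a => ?_
    change _ = polyDist p a + polyDist q a
    simp only [polyDist_apply]
    rw [← integral_add (integrable _) (integrable _)]
    simp [add_mul]
  map_smul' k p := by
    refine DFunLike.ext _ _ fun a => ?_
    change _ = k • polyDist p a
    simp only [polyDist_apply]
    rw [← integral_smul]
    simp [mul_assoc]

theorem polyDistL_injective (n : ℕ) : Function.Injective (polyDistL n) := by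
  rw [← LinearMap.ker_eq_bot, LinearMap.ker_eq_bot']
  intro p hp
  have h : (polyFun p : Space n → ℂ) = 0 := by
    refine Continuous.eq_zero_of_forall_integral_schwartz_smul
      (polyFun_hasTemperateGrowth p).1.continuous fun φ => ?_
    exact DFunLike.congr_fun hp φ
  -- A complex polynomial vanishing at all real points is zero, because ℝ is infinite in each
  -- coordinate.
  refine MvPolynomial.funext_set (fun _ => Set.range ((↑) : ℝ → ℂ))
    (fun _ => Set.infinite_range_of_injective Complex.ofReal_injective) fun x hx => ?_
  choose y hy using fun μ => hx μ (Set.mem_univ μ)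
  have := congrFun h (WithLp.toLp 2 y)
  simpa [polyFun, hy] using this

end Polynomials

section PolynomialMultipliers

variable {n : ℕ} {θ : ℝ}

theorem polyDist_linForm (v : Space n) (a : 𝓢(Space n, ℂ)) :
    polyDist (linForm v) a = polyDist 1 (coordMul v a) := by
  rw [polyDist_coordMul 1 a v, mul_one]

theorem pairing_lineDerivOp (a b : 𝓢(Space n, ℂ)) (v : Space n) :
    (a : 𝓢'(Space n, ℂ)) (∂_{v} b) = -((∂_{v} a : 𝓢(Space n, ℂ)) : 𝓢'(Space n, ℂ)) b := by
  rw [coe_apply, coe_apply]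
  simp only [smul_eq_mul, mul_comm _ (a _), mul_comm (b _)]
  exact integral_mul_lineDerivOp_right_eq_neg_left a b v

variable (n θ) in
/-- `a ↦ ⟪·, v⟫ ⋆ a`. -/
noncomputable def linRight (v : Space n) : 𝓢(Space n, ℂ) →L[ℂ] 𝓢(Space n, ℂ) :=
  coordMul v - (Complex.I / (2 * Real.pi)) • lineDerivOpCLM ℂ 𝓢(Space n, ℂ) (piTheta n θ v)

variable (n θ) in
/-- `a ↦ a ⋆ ⟪·, v⟫`. -/
noncomputable def linLeft (v : Space n) : 𝓢(Space n, ℂ) →L[ℂ] 𝓢(Space n, ℂ) :=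
  coordMul v + (Complex.I / (2 * Real.pi)) • lineDerivOpCLM ℂ 𝓢(Space n, ℂ) (piTheta n θ v)

/-- Integration by parts moves the operator onto `p`; the polynomial on the right is the Moyal
product of `p` with the linear form, in this order. -/
theorem polyDist_linRight (p : MvPolynomial (Idx n) ℂ) (v : Space n) (a : 𝓢(Space n, ℂ)) :
    polyDist p (linRight n θ v a) = polyDistL n (linForm v * p +
      (Complex.I / (2 * Real.pi)) • dirDeriv (piTheta n θ v) p) a := by
  have h : linRight n θ v a = coordMul v a -
    (Complex.I / (2 * Real.pi)) • ∂_{piTheta n θ v} a := rfl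
  rw [h, map_sub, map_smul, polyDist_lineDerivOp, polyDist_coordMul, map_add, map_smul,
    smul_neg, sub_neg_eq_add]
  rfl

theorem polyDist_linLeft (p : MvPolynomial (Idx n) ℂ) (v : Space n) (a : 𝓢(Space n, ℂ)) :
    polyDist p (linLeft n θ v a) = polyDistL n (linForm v * p -
      (Complex.I / (2 * Real.pi)) • dirDeriv (piTheta n θ v) p) a := by
  have h : linLeft n θ v a = coordMul v a +
    (Complex.I / (2 * Real.pi)) • ∂_{piTheta n θ v} a := rfl
  rw [h, map_add, map_smul, polyDist_lineDerivOp, polyDist_coordMul, map_sub, map_smul,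
    smul_neg, ← sub_eq_add_neg]
  rfl

variable [hθ : NeZero θ]

theorem polyDist_one_star (a b : 𝓢(Space n, ℂ)) :
    polyDist 1 (star n θ a b) = (a : 𝓢'(Space n, ℂ)) b := by
  rw [polyDist_one_apply, integral_star, coe_apply]
  simp only [smul_eq_mul, mul_comm]

theorem starRightEq_linForm (v : Space n) (a : 𝓢(Space n, ℂ)) :
    StarRightEq n θ (polyDist (linForm v)) a (linRight n θ v a) := by
  intro b
  have h := coordMul_twistedMul_left (inner_piTheta n θ) a b v
  simp only [← star_eq_twistedMul n hθ.out] at h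
  have h' : linRight n θ v a = coordMul v a -
    (Complex.I / (2 * Real.pi)) • ∂_{piTheta n θ v} a := rfl
  rw [polyDist_linForm, h, map_add, map_smul, polyDist_one_star, polyDist_one_star,
    pairing_lineDerivOp, h', map_sub, map_smul, smul_neg, ← sub_eq_add_neg]
  rfl

theorem starLeftEq_linForm (v : Space n) (a : 𝓢(Space n, ℂ)) :
    StarLeftEq n θ a (polyDist (linForm v)) (linLeft n θ v a) := by
  intro b
  have h := coordMul_twistedMul_right (inner_piTheta n θ) b a v
  simp only [← star_eq_twistedMul n hθ.out] at h
  have h' : linLeft n θ v a = coordMul v a +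
    (Complex.I / (2 * Real.pi)) • ∂_{piTheta n θ v} a := rfl
  rw [polyDist_linForm, h, map_sub, map_smul, polyDist_one_star, polyDist_one_star,
    pairing_comm, pairing_comm _ a, pairing_lineDerivOp, h', map_add, map_smul, smul_neg,
    sub_neg_eq_add]
  rfl

variable (n θ) in
/-- The element `⟪·, v⟫` of the Moyal algebra. -/
noncomputable def lin (v : Space n) : Alg n θ :=
  ⟨polyDist (linForm v), fun a => ⟨_, starLeftEq_linForm v a⟩,
    fun a => ⟨_, starRightEq_linForm v a⟩⟩

theorem mul_lin_apply (T : Alg n θ) (v : Space n) (a : 𝓢(Space n, ℂ)) :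
    ((T * lin n θ v : Alg n θ) : 𝓢'(Space n, ℂ)) a =
      (T : 𝓢'(Space n, ℂ)) (linRight n θ v a) := by
  rw [mul_apply_schwartz, rightAct_eq (starRightEq_linForm v a)]

/-- The product unfolds to T ⋆ a, which is not explicit for general `T`. On a ⋆ e_k the two-sided
multiplier identities move the linear form from T ⋆ a to e_k, and the limit along the approximate
unit gives the general case. -/
theorem lin_mul_apply (T : Alg n θ) (v : Space n) (a : 𝓢(Space n, ℂ)) :
    ((lin n θ v * T : Alg n θ) : 𝓢'(Space n, ℂ)) a =
      (T : 𝓢'(Space n, ℂ)) (linLeft n θ v a) := by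
  obtain ⟨e, he⟩ := exists_tendsto_star n θ
  have h1 : Tendsto (fun k => ((lin n θ v * T : Alg n θ) : 𝓢'(Space n, ℂ)) (star n θ a (e k)))
      atTop (𝓝 (((lin n θ v * T : Alg n θ) : 𝓢'(Space n, ℂ)) a)) :=
    (((lin n θ v * T : Alg n θ) : 𝓢'(Space n, ℂ)).continuous.tendsto _).comp (he a)
  have h2 : Tendsto (fun k => (T : 𝓢'(Space n, ℂ)) (linLeft n θ v (star n θ a (e k))))
      atTop (𝓝 ((T : 𝓢'(Space n, ℂ)) (linLeft n θ v a))) :=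
    (((T : 𝓢'(Space n, ℂ)).continuous.comp (linLeft n θ v).continuous).tendsto _).comp (he a)
  refine tendsto_nhds_unique h1 (h2.congr fun k => ?_)
  have h3 : linLeft n θ v (star n θ a (e k)) = star n θ a (linLeft n θ v (e k)) := by
    refine schwartz_eq_of_forall_integral fun b => ?_
    rw [← starLeftEq_linForm (θ := θ) v (star n θ a (e k)) b, ← star_assoc,
      starLeftEq_linForm (θ := θ) v (e k), pairing_star_right]
  rw [h3, starRightEq_rightAct, mul_apply_schwartz, rightAct_star, pairing_comm]
  exact (starLeftEq_linForm v (e k) (rightAct T a)).symm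

end PolynomialMultipliers

end Moyal

/-- A coefficient at m ≠ 0 reappears in some partial derivative multiplied by a positive exponent,
which is nonzero in characteristic 0. -/
theorem MvPolynomial.eq_C_of_forall_pderiv_eq_zero {σ R : Type*} [CommRing R] [IsDomain R]
    [CharZero R] {p : MvPolynomial σ R} (h : ∀ i, MvPolynomial.pderiv i p = 0) :
    p = MvPolynomial.C (MvPolynomial.eval 0 p) := by
  classical
  ext m
  rw [MvPolynomial.coeff_C]
  split_ifs with hm
  · subst hm
    simp [MvPolynomial.eval_zero, MvPolynomial.constantCoeff_eq]
  · obtain ⟨i, hi⟩ := Finsupp.ne_iff.1 (Ne.symm hm)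
    have h1 := congrArg (MvPolynomial.coeff (m - Finsupp.single i 1)) (h i)
    have h2 : m - Finsupp.single i 1 + Finsupp.single i 1 = m :=
      tsub_add_cancel_of_le (Finsupp.single_le_iff.2 (Nat.one_le_iff_ne_zero.2 hi))
    rw [MvPolynomial.coeff_pderiv, h2, MvPolynomial.coeff_zero] at h1
    refine (mul_eq_zero.1 h1).resolve_right ?_
    exact Nat.cast_add_one_ne_zero _

/-! ### Commutation relations of polynomials of degree at most two -/

namespace Moyal

open SchwartzMap

section

variable {n : ℕ} {θ : ℝ}

variable (n θ) in
/-- The vector with `ξ_μ = ⟪·, v⟫`. -/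
noncomputable def xiVec (μ : Idx n) : Space n := WithLp.toLp 2 fun ν => -(Theta n θ)⁻¹ μ ν

theorem linForm_xiVec (μ : Idx n) : linForm (xiVec n θ μ) = xi n θ μ := by
  simp [linForm, xi, xiVec]

theorem pderiv_xi (μ ν : Idx n) : MvPolynomial.pderiv μ (xi n θ ν) =
    MvPolynomial.C (-((Theta n θ)⁻¹ ν μ : ℝ) : ℂ) := by
  rw [← linForm_xiVec, ← dirDeriv_single, dirDeriv_linForm]
  rw [EuclideanSpace.inner_single_left]
  simp [xiVec]

theorem poly_one : poly θ (1 : MvPolynomial (Idx n) ℂ) = 1 := rfl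

theorem eta2_symm (μ ν : Idx n) : eta2 n θ μ ν = eta2 n θ ν μ := by
  rw [eta2, eta2, mul_comm (xi n θ μ)]

variable [hθ : NeZero θ]

-- Induction on `p`: in p ⋆ x_μ + x_μ ⋆ p the derivative terms cancel, so x_μ p is half a sum of two
-- elements of the algebra.
variable (θ) in
theorem polyDist_mem (p : MvPolynomial (Idx n) ℂ) :
    polyDist p ∈ leftMultipliers n θ ⊓ rightMultipliers n θ := by
  change p ∈ (leftMultipliers n θ ⊓ rightMultipliers n θ).comap (polyDistL n)
  induction p using MvPolynomial.induction_on with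
  | C c =>
    have h1 : (1 : MvPolynomial (Idx n) ℂ) ∈
        (leftMultipliers n θ ⊓ rightMultipliers n θ).comap (polyDistL n) := by
      change polyDist 1 ∈ leftMultipliers n θ ⊓ rightMultipliers n θ
      rw [← coe_one (θ := θ)]
      exact (1 : Alg n θ).2
    have h2 := Submodule.smul_mem _ c h1
    rwa [MvPolynomial.smul_eq_C_mul, mul_one] at h2
  | add p q hp hq => exact add_mem hp hq
  | mul_X p μ hp =>
    let T : Alg n θ := ⟨polyDist p, hp⟩
    let v : Space n := EuclideanSpace.single μ 1
    have h1 : linForm v * p + (Complex.I / (2 * Real.pi)) • dirDeriv (piTheta n θ v) p ∈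
        (leftMultipliers n θ ⊓ rightMultipliers n θ).comap (polyDistL n) := by
      rw [Submodule.mem_comap]
      have : ((T * lin n θ v : Alg n θ) : 𝓢'(Space n, ℂ)) = polyDistL n _ :=
        DFunLike.ext _ _ fun a => (mul_lin_apply T v a).trans (polyDist_linRight p v a)
      rw [← this]
      exact (T * lin n θ v).2
    have h2 : linForm v * p - (Complex.I / (2 * Real.pi)) • dirDeriv (piTheta n θ v) p ∈
        (leftMultipliers n θ ⊓ rightMultipliers n θ).comap (polyDistL n) := by
      rw [Submodule.mem_comap]
      have : ((lin n θ v * T : Alg n θ) : 𝓢'(Space n, ℂ)) = polyDistL n _ :=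
        DFunLike.ext _ _ fun a => (lin_mul_apply T v a).trans (polyDist_linLeft p v a)
      rw [← this]
      exact (lin n θ v * T).2
    have h3 := Submodule.smul_mem _ (1 / 2 : ℂ) (add_mem h1 h2)
    have h4 : linForm v = MvPolynomial.X μ := by
      simp only [linForm, v, PiLp.single_apply]
      rw [Finset.sum_eq_single μ (fun ν _ h => by simp [h]) (by simp)]
      simp
    rw [h4, add_add_sub_cancel, ← two_smul ℂ, smul_smul] at h3
    norm_num at h3
    rwa [mul_comm]

theorem coe_poly (p : MvPolynomial (Idx n) ℂ) :
    ((poly θ p : Alg n θ) : 𝓢'(Space n, ℂ)) = polyDist p := by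
  rw [poly, dif_pos (polyDist_mem θ p)]

theorem poly_apply (p : MvPolynomial (Idx n) ℂ) (a : 𝓢(Space n, ℂ)) :
    ((poly θ p : Alg n θ) : 𝓢'(Space n, ℂ)) a = polyDist p a := by
  rw [coe_poly]

theorem poly_add (p q : MvPolynomial (Idx n) ℂ) : poly θ (p + q) = poly θ p + poly θ q := by
  apply Subtype.ext
  rw [Submodule.coe_add]
  simp only [coe_poly]
  exact map_add (polyDistL n) p q

theorem poly_smul (k : ℂ) (p : MvPolynomial (Idx n) ℂ) : poly θ (k • p) = k • poly θ p := by
  apply Subtype.ext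
  rw [Submodule.coe_smul]
  simp only [coe_poly]
  exact map_smul (polyDistL n) k p

variable (n θ) in
/-- The embedding of the polynomials into the Moyal algebra, as a linear map. -/
noncomputable def polyL : MvPolynomial (Idx n) ℂ →ₗ[ℂ] Alg n θ where
  toFun := poly θ
  map_add' := poly_add
  map_smul' := poly_smul

theorem polyL_apply (p : MvPolynomial (Idx n) ℂ) : polyL n θ p = poly θ p := rfl

theorem poly_sub (p q : MvPolynomial (Idx n) ℂ) : poly θ (p - q) = poly θ p - poly θ q :=
  map_sub (polyL n θ) p q

theorem poly_C (c : ℂ) : poly θ (MvPolynomial.C c : MvPolynomial (Idx n) ℂ) = c • 1 := by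
  rw [← poly_one, ← poly_smul, MvPolynomial.smul_eq_C_mul, mul_one]

theorem poly_C_mul (c : ℂ) (p : MvPolynomial (Idx n) ℂ) :
    poly θ (MvPolynomial.C c * p) = c • poly θ p := by
  rw [← MvPolynomial.smul_eq_C_mul, poly_smul]

theorem poly_injective : Function.Injective (poly θ : MvPolynomial (Idx n) ℂ → Alg n θ) := by
  intro p q h
  have := congrArg ((↑) : Alg n θ → 𝓢'(Space n, ℂ)) h
  rw [coe_poly, coe_poly] at this
  exact polyDistL_injective n this

theorem poly_linForm (v : Space n) : poly θ (linForm v) = lin n θ v :=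
  Subtype.ext (coe_poly _)

/-- By antisymmetry the vector of ξ_μ is the μ-th column of Θ⁻¹. Hence the derivative attached to
ξ_μ points in a coordinate direction, and the factor π cancels the one in i/(2π). -/
theorem piTheta_xiVec (μ : Idx n) :
    piTheta n θ (xiVec n θ μ) = Real.pi • EuclideanSpace.single μ (1 : ℝ) := by
  rw [piTheta, smul_apply]
  congr 1
  ext ν
  have h := congrFun (congrFun (Matrix.mul_nonsing_inv _ (isUnit_Theta_det n hθ.out)) ν) μ
  simp only [Matrix.mul_apply, Theta_inv_apply_swap n hθ.out μ, Matrix.one_apply] at h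
  simpa [xiVec, Matrix.mulVec, dotProduct] using h

theorem dirDeriv_xiVec (μ : Idx n) (p : MvPolynomial (Idx n) ℂ) :
    dirDeriv (piTheta n θ (xiVec n θ μ)) p = (Real.pi : ℂ) • MvPolynomial.pderiv μ p := by
  have : dirDeriv (piTheta n θ (xiVec n θ μ)) =
      (Real.pi : ℂ) • MvPolynomial.pderiv (R := ℂ) μ := by
    refine MvPolynomial.derivation_ext fun ν => ?_
    rw [dirDeriv_X, piTheta_xiVec, ← dirDeriv_single, Derivation.smul_apply, dirDeriv_X,
      MvPolynomial.smul_eq_C_mul, ← map_mul]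
    congr 1
    simp only [PiLp.smul_apply, smul_eq_mul, Complex.ofReal_mul]
  rw [this, Derivation.smul_apply]

theorem poly_mul_xi (p : MvPolynomial (Idx n) ℂ) (μ : Idx n) :
    poly θ p * poly θ (xi n θ μ) =
      poly θ (xi n θ μ * p + (Complex.I / 2) • MvPolynomial.pderiv μ p) := by
  refine alg_ext fun a => ?_
  rw [← linForm_xiVec, poly_linForm, mul_lin_apply, poly_apply, polyDist_linRight,
    dirDeriv_xiVec, poly_apply, smul_smul]
  have : (Real.pi : ℂ) ≠ 0 := by exact_mod_cast Real.pi_ne_zero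
  rw [show Complex.I / (2 * Real.pi) * Real.pi = Complex.I / 2 by field_simp]
  rfl

theorem xi_mul_poly (p : MvPolynomial (Idx n) ℂ) (μ : Idx n) :
    poly θ (xi n θ μ) * poly θ p =
      poly θ (xi n θ μ * p - (Complex.I / 2) • MvPolynomial.pderiv μ p) := by
  refine alg_ext fun a => ?_
  rw [← linForm_xiVec, poly_linForm, lin_mul_apply, poly_apply, polyDist_linLeft,
    dirDeriv_xiVec, poly_apply, smul_smul]
  have : (Real.pi : ℂ) ≠ 0 := by exact_mod_cast Real.pi_ne_zero
  rw [show Complex.I / (2 * Real.pi) * Real.pi = Complex.I / 2 by field_simp]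
  rfl

/-- The inner derivation of a polynomial, evaluated on the ξ's, recovers its gradient.
Well-definedness of `eta` and injectivity of `ispRep` rest on this. -/
theorem comm_poly_xi (p : MvPolynomial (Idx n) ℂ) (μ : Idx n) :
    comm (poly θ p) (poly θ (xi n θ μ)) = Complex.I • poly θ (MvPolynomial.pderiv μ p) := by
  rw [comm, poly_mul_xi, xi_mul_poly, ← poly_sub, ← poly_smul, add_sub_sub_cancel, ← add_smul,
    add_halves]

theorem comm_xi_xi (μ ν : Idx n) : comm (poly θ (xi n θ μ)) (poly θ (xi n θ ν)) =
    (-(Complex.I * ((Theta n θ)⁻¹ μ ν : ℝ))) • 1 := by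
  rw [comm_poly_xi, pderiv_xi, poly_C, smul_smul]
  congr 1
  ring

theorem eta1_eq (μ : Idx n) : eta1 n θ μ = Complex.I • poly θ (xi n θ μ) := poly_C_mul _ _

/-- The commutative and the Moyal product of two ξ's differ by a constant. Constants are central, so
commutators with `eta2` follow from the Leibniz rule for ⋆. -/
theorem eta2_eq (μ ν : Idx n) : eta2 n θ μ ν =
    Complex.I • (poly θ (xi n θ μ) * poly θ (xi n θ ν)) -
      (((Theta n θ)⁻¹ μ ν : ℝ) / 2 : ℂ) • 1 := by
  rw [eta2, poly_C_mul, xi_mul_poly, pderiv_xi, Theta_inv_apply_swap n hθ.out μ ν, poly_sub,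
    poly_smul _ (MvPolynomial.C _), poly_C, smul_sub, smul_smul, smul_smul, sub_sub, ← add_smul]
  rw [eq_comm, sub_eq_self]
  convert zero_smul ℂ _
  push_cast
  linear_combination (((Theta n θ)⁻¹ μ ν : ℝ) / 2 : ℂ) * Complex.I_sq

end

section

variable {n : ℕ} {θ : ℝ}

theorem comm_swap (a b : Alg n θ) : comm b a = -comm a b := by simp [comm]

variable (θ) in
theorem totalDegree_xi_le (μ : Idx n) : (xi n θ μ).totalDegree ≤ 1 := by
  rw [xi, MvPolynomial.totalDegree_neg]
  refine MvPolynomial.totalDegree_finsetSum_le fun ν _ => ?_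
  rw [← MvPolynomial.smul_eq_C_mul]
  exact (MvPolynomial.totalDegree_smul_le _ _).trans (MvPolynomial.totalDegree_X ν).le

theorem eval_zero_xi (μ : Idx n) : MvPolynomial.eval 0 (xi n θ μ) = 0 := by simp [xi]

variable [hθ : NeZero θ]

theorem comm_add_left (a b c : Alg n θ) : comm (a + b) c = comm a c + comm b c := by
  simp only [comm]; noncomm_ring

theorem comm_add_right (a b c : Alg n θ) : comm a (b + c) = comm a b + comm a c := by
  simp only [comm]; noncomm_ring

theorem comm_sub_left (a b c : Alg n θ) : comm (a - b) c = comm a c - comm b c := by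
  simp only [comm]; noncomm_ring

theorem comm_sub_right (a b c : Alg n θ) : comm a (b - c) = comm a b - comm a c := by
  simp only [comm]; noncomm_ring

theorem comm_smul_left (k : ℂ) (a b : Alg n θ) : comm (k • a) b = k • comm a b := by
  simp only [comm, smul_mul_assoc, mul_smul_comm, smul_sub]

theorem comm_smul_right (k : ℂ) (a b : Alg n θ) : comm a (k • b) = k • comm a b := by
  simp only [comm, smul_mul_assoc, mul_smul_comm, smul_sub]

theorem comm_one_left (a : Alg n θ) : comm 1 a = 0 := by simp [comm]

theorem comm_one_right (a : Alg n θ) : comm a 1 = 0 := by simp [comm]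

theorem comm_mul_right (a b c : Alg n θ) : comm a (b * c) = comm a b * c + b * comm a c := by
  simp only [comm]; noncomm_ring

theorem comm_jacobi (a b c : Alg n θ) :
    comm (comm a b) c = comm a (comm b c) - comm b (comm a c) := by
  simp only [comm]; noncomm_ring

theorem bracket_Ad (P Q : Alg n θ) : bracket (Ad P) (Ad Q) = Ad (comm P Q) := by
  funext a
  exact (comm_jacobi P Q a).symm

theorem isDerivation_Ad (P : Alg n θ) : IsDerivation (Ad P) where
  map_add := comm_add_right P
  map_smul k a := comm_smul_right k P a
  leibniz := comm_mul_right P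

theorem mem_G2_iff {X : Alg n θ → Alg n θ} : X ∈ G2 n θ ↔
    ∃ p : MvPolynomial (Idx n) ℂ, p.totalDegree ≤ 2 ∧ X = Ad (poly θ p) := by
  refine ⟨fun h => h.2, fun h => ⟨?_, h⟩⟩
  obtain ⟨p, -, rfl⟩ := h
  exact isDerivation_Ad _

theorem Ad_poly_sub_C (p : MvPolynomial (Idx n) ℂ) (c : ℂ) :
    Ad (poly θ (p - MvPolynomial.C c)) = Ad (poly θ p) := by
  funext a
  rw [Ad, Ad, poly_sub, poly_C, comm_sub_left, comm_smul_left, comm_one_left, smul_zero, sub_zero]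

theorem pderiv_eq_of_comm_eq {p q : MvPolynomial (Idx n) ℂ} {μ : Idx n}
    (h : comm (poly θ p) (poly θ (xi n θ μ)) = comm (poly θ q) (poly θ (xi n θ μ))) :
    MvPolynomial.pderiv μ p = MvPolynomial.pderiv μ q := by
  rw [comm_poly_xi, comm_poly_xi] at h
  exact poly_injective (smul_right_injective (Alg n θ) Complex.I_ne_zero h)

theorem sub_C_eq_of_comm_eq {p q : MvPolynomial (Idx n) ℂ}
    (h : ∀ μ, comm (poly θ p) (poly θ (xi n θ μ)) = comm (poly θ q) (poly θ (xi n θ μ))) :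
    p - MvPolynomial.C (MvPolynomial.eval 0 p) = q - MvPolynomial.C (MvPolynomial.eval 0 q) := by
  have h1 := MvPolynomial.eq_C_of_forall_pderiv_eq_zero (p := p - q) fun μ => by
    rw [map_sub, pderiv_eq_of_comm_eq (h μ), sub_self]
  rw [map_sub, map_sub] at h1
  linear_combination h1

/-- The polynomial chosen inside `eta` has the same commutators with the ξ's as `p`, hence differs
from it by a constant, which the subtraction removes. -/
theorem eta_Ad_poly {p : MvPolynomial (Idx n) ℂ} (hp : p.totalDegree ≤ 2) :
    eta (Ad (poly θ p)) = poly θ (p - MvPolynomial.C (MvPolynomial.eval 0 p)) := by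
  have h : ∃ q : MvPolynomial (Idx n) ℂ, q.totalDegree ≤ 2 ∧ Ad (poly θ p) = Ad (poly θ q) :=
    ⟨p, hp, rfl⟩
  rw [eta, dif_pos h]
  exact congrArg (poly θ) (sub_C_eq_of_comm_eq fun μ => congrFun h.choose_spec.2.symm _)

theorem Ad_eta {X : Alg n θ → Alg n θ} (hX : X ∈ G2 n θ) : Ad (eta X) = X := by
  obtain ⟨p, hp, rfl⟩ := mem_G2_iff.1 hX
  rw [eta_Ad_poly hp, Ad_poly_sub_C]

theorem eta_add {X Y : Alg n θ → Alg n θ} (hX : X ∈ G2 n θ) (hY : Y ∈ G2 n θ) :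
    eta (X + Y) = eta X + eta Y := by
  obtain ⟨p, hp, rfl⟩ := mem_G2_iff.1 hX
  obtain ⟨q, hq, rfl⟩ := mem_G2_iff.1 hY
  have h : Ad (poly θ p) + Ad (poly θ q) = Ad (poly θ (p + q)) := by
    funext a
    rw [poly_add]
    exact (comm_add_left _ _ _).symm
  rw [h, eta_Ad_poly hp, eta_Ad_poly hq,
    eta_Ad_poly ((MvPolynomial.totalDegree_add p q).trans (max_le hp hq)), ← poly_add, map_add,
    map_add, add_sub_add_comm]

theorem eta_smul (k : ℂ) {X : Alg n θ → Alg n θ} (hX : X ∈ G2 n θ) :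
    eta (k • X) = k • eta X := by
  obtain ⟨p, hp, rfl⟩ := mem_G2_iff.1 hX
  have h : k • Ad (poly θ p) = Ad (poly θ (k • p)) := by
    funext a
    rw [poly_smul]
    exact (comm_smul_left _ _ _).symm
  rw [h, eta_Ad_poly hp, eta_Ad_poly ((MvPolynomial.totalDegree_smul_le k p).trans hp),
    ← poly_smul, smul_sub, MvPolynomial.smul_eval, map_mul, MvPolynomial.smul_eq_C_mul _ k,
    MvPolynomial.smul_eq_C_mul _ k]

variable (n θ) in
/-- The linear map `P ↦ Ad_P` on polynomials. -/
noncomputable def AdPoly : MvPolynomial (Idx n) ℂ →ₗ[ℂ] (Alg n θ → Alg n θ) where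
  toFun p := Ad (poly θ p)
  map_add' p q := by
    funext a
    rw [poly_add]
    exact comm_add_left _ _ _
  map_smul' k p := by
    funext a
    rw [poly_smul]
    exact comm_smul_left _ _ _

/-- A nonzero scalar here is invisible to Ad but not to the Moyal bracket: this is the central
extension that separates η([X,Y]) from [η(X), η(Y)]. -/
theorem comm_eta1_eta1 (μ ν : Idx n) : comm (eta1 n θ μ) (eta1 n θ ν) =
    (Complex.I * (((Theta n θ)⁻¹ μ ν : ℝ) : ℂ)) • 1 := by
  rw [eta1_eq, eta1_eq, comm_smul_left, comm_smul_right, comm_xi_xi, smul_smul, smul_smul]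
  congr 1
  linear_combination -Complex.I * ((Theta n θ)⁻¹ μ ν : ℝ) * Complex.I_sq

theorem comm_eta1_eta2 (μ ρ σ : Idx n) : comm (eta1 n θ μ) (eta2 n θ ρ σ) =
    (((Theta n θ)⁻¹ μ ρ : ℝ) : ℂ) • eta1 n θ σ + (((Theta n θ)⁻¹ μ σ : ℝ) : ℂ) • eta1 n θ ρ := by
  rw [eta2_eq, comm_sub_right, comm_smul_right, comm_smul_right, comm_one_right, smul_zero,
    sub_zero, comm_mul_right]
  simp only [eta1_eq, comm_smul_left, comm_xi_xi, smul_mul_assoc, mul_smul_comm, one_mul, mul_one,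
    smul_add, smul_smul]
  congr 2 <;>
  linear_combination -Complex.I * (((Theta n θ)⁻¹ μ _ : ℝ) : ℂ) * Complex.I_sq

theorem comm_eta2_xi (μ ν ρ : Idx n) : comm (eta2 n θ μ ν) (poly θ (xi n θ ρ)) =
    (((Theta n θ)⁻¹ ν ρ : ℝ) : ℂ) • poly θ (xi n θ μ) +
      (((Theta n θ)⁻¹ μ ρ : ℝ) : ℂ) • poly θ (xi n θ ν) := by
  have h := comm_eta1_eta2 (θ := θ) ρ μ ν
  rw [eta1_eq, eta1_eq, eta1_eq, comm_smul_left, comm_swap (eta2 n θ μ ν), smul_comm _ Complex.I,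
    smul_comm _ Complex.I, ← smul_add] at h
  have h1 := smul_right_injective (Alg n θ) Complex.I_ne_zero h
  rw [neg_eq_iff_eq_neg] at h1
  rw [h1, Theta_inv_apply_swap n hθ.out μ ρ, Theta_inv_apply_swap n hθ.out ν ρ]
  simp only [Complex.ofReal_neg]
  module

theorem comm_eta2_eta2 (μ ν ρ σ : Idx n) : comm (eta2 n θ μ ν) (eta2 n θ ρ σ) =
    -((((Theta n θ)⁻¹ ρ ν : ℝ) : ℂ) • eta2 n θ μ σ + (((Theta n θ)⁻¹ σ ν : ℝ) : ℂ) • eta2 n θ μ ρ +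
      (((Theta n θ)⁻¹ ρ μ : ℝ) : ℂ) • eta2 n θ ν σ +
      (((Theta n θ)⁻¹ σ μ : ℝ) : ℂ) • eta2 n θ ν ρ) := by
  -- The swaps by `eta2_symm` put the factors in the order in which the Leibniz rule produces them;
  -- the four constants from `eta2_eq` then cancel in pairs by antisymmetry of Θ⁻¹.
  rw [eta2_eq ρ σ, comm_sub_right, comm_smul_right, comm_smul_right, comm_one_right, smul_zero,
    sub_zero, comm_mul_right, comm_eta2_xi, comm_eta2_xi, eta2_symm μ ρ, eta2_symm ν ρ, eta2_eq,
    eta2_eq, eta2_eq, eta2_eq, Theta_inv_apply_swap n hθ.out ν ρ,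
    Theta_inv_apply_swap n hθ.out ν σ, Theta_inv_apply_swap n hθ.out μ ρ,
    Theta_inv_apply_swap n hθ.out μ σ]
  simp only [add_mul, mul_add, smul_mul_assoc, mul_smul_comm, Complex.ofReal_neg]
  module

end

/-! ### The Lie algebra 𝓖₂ and its generators -/

section

variable {n : ℕ} {θ : ℝ}

theorem totalDegree_C_mul_xi_le (μ : Idx n) :
    (MvPolynomial.C Complex.I * xi n θ μ).totalDegree ≤ 2 := by
  rw [← MvPolynomial.smul_eq_C_mul]
  exact (MvPolynomial.totalDegree_smul_le _ _).trans ((totalDegree_xi_le θ μ).trans one_le_two)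

theorem totalDegree_C_mul_xi_mul_xi_le (μ ν : Idx n) :
    (MvPolynomial.C Complex.I * (xi n θ μ * xi n θ ν)).totalDegree ≤ 2 := by
  rw [← MvPolynomial.smul_eq_C_mul]
  exact (MvPolynomial.totalDegree_smul_le _ _).trans ((MvPolynomial.totalDegree_mul _ _).trans
    (add_le_add (totalDegree_xi_le θ μ) (totalDegree_xi_le θ ν)))

theorem eval_zero_C_mul_xi (μ : Idx n) :
    MvPolynomial.eval 0 (MvPolynomial.C Complex.I * xi n θ μ) = 0 := by
  rw [map_mul, eval_zero_xi, mul_zero]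

theorem eval_zero_C_mul_xi_mul_xi (μ ν : Idx n) :
    MvPolynomial.eval 0 (MvPolynomial.C Complex.I * (xi n θ μ * xi n θ ν)) = 0 := by
  rw [map_mul, map_mul, eval_zero_xi, zero_mul, mul_zero]

variable [hθ : NeZero θ]

variable (θ) in
theorem X_mem_span_xi (μ : Idx n) :
    (MvPolynomial.X μ : MvPolynomial (Idx n) ℂ) ∈ Submodule.span ℂ (Set.range (xi n θ)) := by
  -- Inverts ξ = -Θ⁻¹x.
  have h : (MvPolynomial.X μ : MvPolynomial (Idx n) ℂ) =
      ∑ ν, (-(Theta n θ μ ν : ℝ) : ℂ) • xi n θ ν := by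
    simp only [xi, smul_neg, neg_smul, Finset.sum_neg_distrib, neg_neg, Finset.smul_sum]
    rw [Finset.sum_comm]
    have h1 : ∀ κ, ∑ ν, (Theta n θ μ ν : ℂ) •
        (MvPolynomial.C (((Theta n θ)⁻¹ ν κ : ℝ) : ℂ) * MvPolynomial.X κ) =
        (MvPolynomial.C (((1 : Matrix (Idx n) (Idx n) ℝ) μ κ : ℝ) : ℂ) * MvPolynomial.X κ :
          MvPolynomial (Idx n) ℂ) := by
      intro κ
      rw [← Matrix.mul_nonsing_inv _ (isUnit_Theta_det n hθ.out), Matrix.mul_apply]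
      simp only [MvPolynomial.smul_eq_C_mul, ← mul_assoc, ← map_mul, ← Finset.sum_mul, ← map_sum]
      push_cast
      rfl
    simp only [h1]
    rw [Finset.sum_eq_single μ (fun κ _ h => by simp [Matrix.one_apply_ne' h]) (by simp)]
    simp
  rw [h]
  exact sum_mem fun ν _ => Submodule.smul_mem _ _ (Submodule.subset_span ⟨ν, rfl⟩)

variable (n θ) in
theorem restrictTotalDegree_two_eq_span : MvPolynomial.restrictTotalDegree (Idx n) ℂ 2 =
    Submodule.span ℂ (insert 1 (Set.range (fun μ => MvPolynomial.C Complex.I * xi n θ μ) ∪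
      Set.range (fun q : Idx n × Idx n =>
        MvPolynomial.C Complex.I * (xi n θ q.1 * xi n θ q.2)))) := by
  refine le_antisymm (fun p hp => ?_) (Submodule.span_le.2 ?_)
  · rw [MvPolynomial.mem_restrictTotalDegree] at hp
    set S := Submodule.span ℂ (insert 1 (Set.range (fun μ => MvPolynomial.C Complex.I * xi n θ μ) ∪
      Set.range (fun q : Idx n × Idx n =>
        MvPolynomial.C Complex.I * (xi n θ q.1 * xi n θ q.2)))) with hS
    have h1 : (1 : MvPolynomial (Idx n) ℂ) ∈ S := Submodule.subset_span (Or.inl rfl)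
    have hI : ∀ q : MvPolynomial (Idx n) ℂ, MvPolynomial.C Complex.I * q ∈ S → q ∈ S := by
      intro q hq
      have := Submodule.smul_mem _ (-Complex.I) hq
      rwa [← MvPolynomial.smul_eq_C_mul, smul_smul, neg_mul, Complex.I_mul_I, neg_neg,
        one_smul] at this
    have h2 : ∀ μ, (MvPolynomial.X μ : MvPolynomial (Idx n) ℂ) ∈ S := fun μ => by
      refine Submodule.span_le.2 ?_ (X_mem_span_xi θ μ)
      rintro _ ⟨ν, rfl⟩
      exact hI _ (Submodule.subset_span (Or.inr (Or.inl ⟨ν, rfl⟩)))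
    have h3 : ∀ μ ν, (MvPolynomial.X μ * MvPolynomial.X ν : MvPolynomial (Idx n) ℂ) ∈ S := by
      intro μ ν
      have h := Submodule.mul_mem_mul (X_mem_span_xi θ μ) (X_mem_span_xi θ ν)
      rw [Submodule.span_mul_span] at h
      refine Submodule.span_le.2 ?_ h
      rintro _ ⟨_, ⟨ρ, rfl⟩, _, ⟨σ, rfl⟩, rfl⟩
      exact hI _ (Submodule.subset_span (Or.inr (Or.inr ⟨(ρ, σ), rfl⟩)))
    rw [p.as_sum]
    refine sum_mem fun m hm => ?_
    have hd : m.degree ≤ 2 := (MvPolynomial.le_totalDegree hm).trans hp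
    have hsplit : ∀ m : Idx n →₀ ℕ, m ≠ 0 → ∃ i m', m = m' + Finsupp.single i 1 := by
      intro m hm
      obtain ⟨i, hi⟩ := Finsupp.ne_iff.1 hm
      exact ⟨i, m - Finsupp.single i 1, (tsub_add_cancel_of_le
        (Finsupp.single_le_iff.2 (Nat.one_le_iff_ne_zero.2 hi))).symm⟩
    rw [← mul_one (MvPolynomial.coeff m p), ← smul_eq_mul, ← MvPolynomial.smul_monomial]
    refine Submodule.smul_mem _ _ ?_
    by_cases hm0 : m = 0
    · rwa [hm0, ← MvPolynomial.one_def]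
    obtain ⟨i, m', rfl⟩ := hsplit m hm0
    rw [← mul_one (1 : ℂ), ← MvPolynomial.monomial_mul]
    by_cases hm1 : m' = 0
    · rw [hm1, ← MvPolynomial.one_def, one_mul]
      exact h2 i
    obtain ⟨j, m'', rfl⟩ := hsplit m' hm1
    simp only [map_add, Finsupp.degree_single] at hd
    have : m'' = 0 := (Finsupp.degree_eq_zero_iff m'').1 (by omega)
    rw [this, zero_add]
    exact h3 j i
  · rintro _ (rfl | ⟨μ, rfl⟩ | ⟨q, rfl⟩)
    · exact (MvPolynomial.mem_restrictTotalDegree _ _ _).2 (by simp)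
    · exact (MvPolynomial.mem_restrictTotalDegree _ _ _).2 (totalDegree_C_mul_xi_le μ)
    · exact (MvPolynomial.mem_restrictTotalDegree _ _ _).2 (totalDegree_C_mul_xi_mul_xi_le _ _)

/-- Serves the maps P ↦ Ad_P and P ↦ P - P(0), which both kill constants; this yields the two
spanning statements. -/
theorem map_restrictTotalDegree_two {M : Type*} [AddCommGroup M] [Module ℂ M]
    (L : MvPolynomial (Idx n) ℂ →ₗ[ℂ] M) (hL : L 1 = 0) :
    (MvPolynomial.restrictTotalDegree (Idx n) ℂ 2).map L =
      Submodule.span ℂ (Set.range (fun μ => L (MvPolynomial.C Complex.I * xi n θ μ)) ∪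
        Set.range (fun q : Idx n × Idx n =>
          L (MvPolynomial.C Complex.I * (xi n θ q.1 * xi n θ q.2)))) := by
  rw [restrictTotalDegree_two_eq_span n θ, Submodule.map_span, Set.image_insert_eq, hL,
    Submodule.span_insert_zero, Set.image_union, ← Set.range_comp, ← Set.range_comp]
  rfl

theorem coe_map_restrictTotalDegree {M : Type*} [AddCommGroup M] [Module ℂ M]
    (L : MvPolynomial (Idx n) ℂ →ₗ[ℂ] M) (d : ℕ) :
    ((MvPolynomial.restrictTotalDegree (Idx n) ℂ d).map L : Set M) =
      {y | ∃ p : MvPolynomial (Idx n) ℂ, p.totalDegree ≤ d ∧ L p = y} := by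
  ext y
  simp [MvPolynomial.mem_restrictTotalDegree]

variable (n θ) in
theorem G2_eq_span : G2 n θ = (Submodule.span ℂ (Set.range (D1 n θ) ∪
    Set.range (fun q : Idx n × Idx n => D2 n θ q.1 q.2)) : Set (Alg n θ → Alg n θ)) := by
  have h1 : AdPoly n θ 1 = 0 := by
    funext a
    exact comm_one_left a
  have h := map_restrictTotalDegree_two (θ := θ) (AdPoly n θ) h1
  refine Eq.trans ?_ (congrArg _ h)
  rw [coe_map_restrictTotalDegree]
  ext X
  rw [mem_G2_iff]
  exact exists_congr fun p => and_congr_right fun _ => eq_comm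

variable (n θ) in
theorem eta_image_G2_eq_span : eta '' G2 n θ = (Submodule.span ℂ (Set.range (eta1 n θ) ∪
    Set.range (fun q : Idx n × Idx n => eta2 n θ q.1 q.2)) : Set (Alg n θ)) := by
  let L : MvPolynomial (Idx n) ℂ →ₗ[ℂ] Alg n θ :=
    polyL n θ ∘ₗ (LinearMap.id -
      Algebra.linearMap ℂ (MvPolynomial (Idx n) ℂ) ∘ₗ (MvPolynomial.aeval 0).toLinearMap)
  have hL : ∀ p, L p = poly θ (p - MvPolynomial.C (MvPolynomial.eval 0 p)) := fun p => rfl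
  have h := map_restrictTotalDegree_two (θ := θ) L (by
    rw [hL, map_one, map_one, sub_self]
    exact map_zero (polyL n θ))
  simp only [hL, eval_zero_C_mul_xi, eval_zero_C_mul_xi_mul_xi, map_zero, sub_zero] at h
  refine Eq.trans ?_ (congrArg _ h)
  rw [coe_map_restrictTotalDegree]
  ext T
  constructor
  · rintro ⟨X, hX, rfl⟩
    obtain ⟨p, hp, rfl⟩ := mem_G2_iff.1 hX
    exact ⟨p, hp, (eta_Ad_poly hp).symm⟩
  · rintro ⟨p, hp, rfl⟩
    exact ⟨_, mem_G2_iff.2 ⟨p, hp, rfl⟩, eta_Ad_poly hp⟩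

/-- By bilinearity it suffices to look at 1, `eta1` and `eta2`, whose commutators have been
computed. -/
theorem exists_comm_poly_eq {p q : MvPolynomial (Idx n) ℂ} (hp : p.totalDegree ≤ 2)
    (hq : q.totalDegree ≤ 2) : ∃ r : MvPolynomial (Idx n) ℂ, r.totalDegree ≤ 2 ∧
      comm (poly θ p) (poly θ q) = poly θ r := by
  let S : Submodule ℂ (Alg n θ) := (MvPolynomial.restrictTotalDegree (Idx n) ℂ 2).map (polyL n θ)
  have h1 : (1 : Alg n θ) ∈ S :=
    ⟨1, (MvPolynomial.mem_restrictTotalDegree _ _ _).2 (by simp), rfl⟩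
  have h2 : ∀ μ, eta1 n θ μ ∈ S := fun μ =>
    ⟨_, (MvPolynomial.mem_restrictTotalDegree _ _ _).2 (totalDegree_C_mul_xi_le μ), rfl⟩
  have h3 : ∀ μ ν, eta2 n θ μ ν ∈ S := fun μ ν =>
    ⟨_, (MvPolynomial.mem_restrictTotalDegree _ _ _).2 (totalDegree_C_mul_xi_mul_xi_le μ ν), rfl⟩
  suffices h : comm (poly θ p) (poly θ q) ∈ S by
    obtain ⟨r, hr, h⟩ := h
    exact ⟨r, (MvPolynomial.mem_restrictTotalDegree _ _ _).1 hr, h.symm⟩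
  rw [← MvPolynomial.mem_restrictTotalDegree, restrictTotalDegree_two_eq_span n θ] at hp hq
  induction hp, hq using Submodule.span_induction₂ with
  | mem_mem p q hp hq =>
    rcases hp with rfl | ⟨μ, rfl⟩ | ⟨a, rfl⟩
    · rw [poly_one, comm_one_left]
      exact zero_mem _
    · rcases hq with rfl | ⟨ν, rfl⟩ | ⟨b, rfl⟩
      · rw [poly_one, comm_one_right]
        exact zero_mem _
      · exact (comm_eta1_eta1 (θ := θ) μ ν) ▸ S.smul_mem _ h1
      · exact (comm_eta1_eta2 (θ := θ) μ b.1 b.2) ▸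
          add_mem (S.smul_mem _ (h2 _)) (S.smul_mem _ (h2 _))
    · rcases hq with rfl | ⟨ν, rfl⟩ | ⟨b, rfl⟩
      · rw [poly_one, comm_one_right]
        exact zero_mem _
      · rw [comm_swap]
        exact (comm_eta1_eta2 (θ := θ) ν a.1 a.2) ▸
          neg_mem (add_mem (S.smul_mem _ (h2 _)) (S.smul_mem _ (h2 _)))
      · exact (comm_eta2_eta2 (θ := θ) a.1 a.2 b.1 b.2) ▸
          neg_mem (add_mem (add_mem (add_mem (S.smul_mem _ (h3 _ _)) (S.smul_mem _ (h3 _ _)))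
            (S.smul_mem _ (h3 _ _))) (S.smul_mem _ (h3 _ _)))
  | zero_left q hq =>
    rw [← polyL_apply, map_zero]
    simp [comm]
  | zero_right p hp =>
    rw [← polyL_apply 0, map_zero]
    simp [comm]
  | add_left p p' q _ _ _ h h' =>
    rw [poly_add, comm_add_left]
    exact add_mem h h'
  | add_right p q q' _ _ _ h h' =>
    rw [poly_add, comm_add_right]
    exact add_mem h h'
  | smul_left k p q _ _ h =>
    rw [poly_smul, comm_smul_left]
    exact S.smul_mem k h
  | smul_right k p q _ _ h =>
    rw [poly_smul, comm_smul_right]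
    exact S.smul_mem k h

theorem bracket_mem_G2 {X Y : Alg n θ → Alg n θ} (hX : X ∈ G2 n θ) (hY : Y ∈ G2 n θ) :
    bracket X Y ∈ G2 n θ := by
  obtain ⟨p, hp, rfl⟩ := mem_G2_iff.1 hX
  obtain ⟨q, hq, rfl⟩ := mem_G2_iff.1 hY
  obtain ⟨r, hr, h⟩ := exists_comm_poly_eq (θ := θ) hp hq
  exact mem_G2_iff.2 ⟨r, hr, by rw [bracket_Ad, h]⟩

theorem D1_mem_G2 (μ : Idx n) : D1 n θ μ ∈ G2 n θ :=
  mem_G2_iff.2 ⟨_, totalDegree_C_mul_xi_le μ, rfl⟩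

theorem D2_mem_G2 (μ ν : Idx n) : D2 n θ μ ν ∈ G2 n θ :=
  mem_G2_iff.2 ⟨_, totalDegree_C_mul_xi_mul_xi_le μ ν, rfl⟩

theorem smul_mem_G2 (k : ℂ) {X : Alg n θ → Alg n θ} (hX : X ∈ G2 n θ) : k • X ∈ G2 n θ := by
  rw [G2_eq_span] at hX ⊢
  exact Submodule.smul_mem _ k hX

theorem add_mem_G2 {X Y : Alg n θ → Alg n θ} (hX : X ∈ G2 n θ) (hY : Y ∈ G2 n θ) :
    X + Y ∈ G2 n θ := by
  rw [G2_eq_span] at hX hY ⊢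
  exact Submodule.add_mem _ hX hY

theorem eta_D1 (μ : Idx n) : eta (D1 n θ μ) = eta1 n θ μ := by
  rw [D1, eta1, eta_Ad_poly (totalDegree_C_mul_xi_le μ), eval_zero_C_mul_xi, map_zero,
    sub_zero]

theorem eta_D2 (μ ν : Idx n) : eta (D2 n θ μ ν) = eta2 n θ μ ν := by
  rw [D2, eta2, eta_Ad_poly (totalDegree_C_mul_xi_mul_xi_le μ ν), eval_zero_C_mul_xi_mul_xi,
    map_zero, sub_zero]

theorem bracket_D1_D1 (μ ν : Idx n) : bracket (D1 n θ μ) (D1 n θ ν) = 0 := by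
  funext a
  rw [D1, D1, bracket_Ad, comm_eta1_eta1, Ad, comm_smul_left, comm_one_left, smul_zero]
  rfl

theorem bracket_D1_D2 (μ ρ σ : Idx n) : bracket (D1 n θ μ) (D2 n θ ρ σ) =
    (((Theta n θ)⁻¹ μ ρ : ℝ) : ℂ) • D1 n θ σ + (((Theta n θ)⁻¹ μ σ : ℝ) : ℂ) • D1 n θ ρ := by
  funext a
  rw [D1, D2, bracket_Ad, comm_eta1_eta2, Ad, comm_add_left, comm_smul_left, comm_smul_left]
  rfl

theorem bracket_D2_D2 (μ ν ρ σ : Idx n) : bracket (D2 n θ μ ν) (D2 n θ ρ σ) =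
    (-1 : ℂ) • ((((Theta n θ)⁻¹ ρ ν : ℝ) : ℂ) • D2 n θ μ σ +
      (((Theta n θ)⁻¹ σ ν : ℝ) : ℂ) • D2 n θ μ ρ + (((Theta n θ)⁻¹ ρ μ : ℝ) : ℂ) • D2 n θ ν σ +
      (((Theta n θ)⁻¹ σ μ : ℝ) : ℂ) • D2 n θ ν ρ) := by
  funext a
  rw [D2, D2, bracket_Ad, comm_eta2_eta2, Ad, ← neg_one_smul ℂ, comm_smul_left]
  simp only [comm_add_left, comm_smul_left]
  rfl

end

/-! ### Connections and curvature -/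

section Connections

variable {n : ℕ} {θ : ℝ} [hθ : NeZero θ]

/-- Because X = [η(X), ·]⋆, subtracting left multiplication by η(X) leaves only right
multiplication, which reduces the connection axioms to ring identities. -/
theorem canonical_eq {X : Alg n θ → Alg n θ} (hX : X ∈ G2 n θ) (m : Alg n θ) :
    canonical X m = -(m * eta X) := by
  have h : X m = eta X * m - m * eta X := congrFun (Ad_eta hX).symm m
  rw [canonical, h]
  abel

theorem covCoord_canonical {X : Alg n θ → Alg n θ} (hX : X ∈ G2 n θ) :
    covCoord canonical X = 0 := by
  rw [covCoord, canonical_eq hX, one_mul, neg_add_cancel]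

variable (n θ) in
theorem isConnection_canonical : IsConnection (canonical (n := n) (θ := θ)) where
  map_add X hX m m' := by
    rw [canonical_eq hX, canonical_eq hX, canonical_eq hX, add_mul, neg_add]
  map_smul X hX k m := by
    rw [canonical_eq hX, canonical_eq hX, smul_mul_assoc, smul_neg]
  leibniz X hX m a := by
    have h : X a = eta X * a - a * eta X := congrFun (Ad_eta hX).symm a
    rw [canonical_eq hX, canonical_eq hX, h]
    noncomm_ring
  add_left X hX Y hY m := by
    rw [canonical_eq hX, canonical_eq hY, canonical_eq (add_mem_G2 hX hY), eta_add hX hY, mul_add,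
      neg_add]
  smul_left X hX k m := by
    rw [canonical_eq hX, canonical_eq (smul_mem_G2 k hX), eta_smul k hX, mul_smul_comm, smul_neg]

variable {nabla : (Alg n θ → Alg n θ) → Alg n θ → Alg n θ}

theorem IsConnection.apply_eq (h : IsConnection nabla) {X : Alg n θ → Alg n θ} (hX : X ∈ G2 n θ)
    (m : Alg n θ) : nabla X m = canonical X m + covCoord nabla X * m := by
  have h1 := h.leibniz X hX 1 m
  rw [one_mul, one_mul] at h1
  rw [h1, canonical, covCoord]
  noncomm_ring

theorem IsConnection.covCoord_add (h : IsConnection nabla) {X Y : Alg n θ → Alg n θ}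
    (hX : X ∈ G2 n θ) (hY : Y ∈ G2 n θ) :
    covCoord nabla (X + Y) = covCoord nabla X + covCoord nabla Y := by
  rw [covCoord, h.add_left X hX Y hY, eta_add hX hY, covCoord, covCoord]
  abel

theorem IsConnection.covCoord_smul (h : IsConnection nabla) (k : ℂ) {X : Alg n θ → Alg n θ}
    (hX : X ∈ G2 n θ) : covCoord nabla (k • X) = k • covCoord nabla X := by
  rw [covCoord, h.smul_left X hX, eta_smul k hX, covCoord, smul_add]

/-- ∇_X is left multiplication by 𝒜(X) minus right multiplication by η(X); the mixed terms cancel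
because the two kinds of multiplication commute. The right-hand summand measures the failure of η to
preserve brackets. -/
theorem IsConnection.curvature_eq (h : IsConnection nabla) {X Y : Alg n θ → Alg n θ}
    (hX : X ∈ G2 n θ) (hY : Y ∈ G2 n θ) (m : Alg n θ) :
    curvature nabla X Y m = (comm (covCoord nabla X) (covCoord nabla Y) -
      covCoord nabla (bracket X Y)) * m + m * (eta (bracket X Y) - comm (eta X) (eta Y)) := by
  have hXY := bracket_mem_G2 hX hY
  simp only [curvature, h.apply_eq hX, h.apply_eq hY, h.apply_eq hXY, canonical_eq hX,
    canonical_eq hY, canonical_eq hXY, comm]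
  noncomm_ring

variable (n θ) in
theorem zero_mem_G2 : (0 : Alg n θ → Alg n θ) ∈ G2 n θ := by
  rw [G2_eq_span]
  exact Submodule.zero_mem _

variable (n θ) in
theorem eta_zero : eta (0 : Alg n θ → Alg n θ) = 0 := by
  simpa using eta_smul 0 (zero_mem_G2 n θ)

theorem IsConnection.covCoord_zero (h : IsConnection nabla) : covCoord nabla 0 = 0 := by
  simpa using h.covCoord_smul 0 (zero_mem_G2 n θ)

/-- The translations commute as derivations while their images under η do not, so the whole scalar
term comes from the right-hand summand of `curvature_eq`. -/
theorem IsConnection.curvature_D1_D1 (h : IsConnection nabla) (μ ν : Idx n) (m : Alg n θ) :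
    curvature nabla (D1 n θ μ) (D1 n θ ν) m =
      (comm (covCoord nabla (D1 n θ μ)) (covCoord nabla (D1 n θ ν)) -
        (Complex.I * (((Theta n θ)⁻¹ μ ν : ℝ) : ℂ)) • 1) * m := by
  rw [h.curvature_eq (D1_mem_G2 μ) (D1_mem_G2 ν), bracket_D1_D1, h.covCoord_zero, eta_zero, eta_D1,
    eta_D1, comm_eta1_eta1, sub_zero, zero_sub, mul_neg, mul_smul_comm, mul_one, sub_mul,
    smul_mul_assoc, one_mul, sub_eq_add_neg]

theorem IsConnection.curvature_D1_D2 (h : IsConnection nabla) (μ ρ σ : Idx n) (m : Alg n θ) :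
    curvature nabla (D1 n θ μ) (D2 n θ ρ σ) m =
      (comm (covCoord nabla (D1 n θ μ)) (covCoord nabla (D2 n θ ρ σ)) -
        (((Theta n θ)⁻¹ μ ρ : ℝ) : ℂ) • covCoord nabla (D1 n θ σ) -
        (((Theta n θ)⁻¹ μ σ : ℝ) : ℂ) • covCoord nabla (D1 n θ ρ)) * m := by
  have h1 := fun (k : ℂ) (μ : Idx n) => smul_mem_G2 k (D1_mem_G2 (θ := θ) μ)
  rw [h.curvature_eq (D1_mem_G2 μ) (D2_mem_G2 ρ σ), bracket_D1_D2,
    h.covCoord_add (h1 _ _) (h1 _ _), h.covCoord_smul _ (D1_mem_G2 _),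
    h.covCoord_smul _ (D1_mem_G2 _), eta_add (h1 _ _) (h1 _ _), eta_smul _ (D1_mem_G2 _),
    eta_smul _ (D1_mem_G2 _), eta_D1, eta_D1, eta_D1, eta_D2, comm_eta1_eta2, sub_self, mul_zero,
    add_zero, sub_sub]

theorem IsConnection.curvature_D2_D2 (h : IsConnection nabla) (μ ν ρ σ : Idx n) (m : Alg n θ) :
    curvature nabla (D2 n θ μ ν) (D2 n θ ρ σ) m =
      (comm (covCoord nabla (D2 n θ μ ν)) (covCoord nabla (D2 n θ ρ σ)) +
        (((Theta n θ)⁻¹ ρ ν : ℝ) : ℂ) • covCoord nabla (D2 n θ μ σ) +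
        (((Theta n θ)⁻¹ σ ν : ℝ) : ℂ) • covCoord nabla (D2 n θ μ ρ) +
        (((Theta n θ)⁻¹ ρ μ : ℝ) : ℂ) • covCoord nabla (D2 n θ ν σ) +
        (((Theta n θ)⁻¹ σ μ : ℝ) : ℂ) • covCoord nabla (D2 n θ ν ρ)) * m := by
  -- Membership of every partial sum of the bracket is recorded because `eta` and `covCoord` are
  -- linear only on 𝓖₂.
  have h1 := fun (k : ℂ) (μ ν : Idx n) => smul_mem_G2 k (D2_mem_G2 (θ := θ) μ ν)
  have h2 := fun (k k' : ℂ) (μ ν μ' ν' : Idx n) => add_mem_G2 (h1 k μ ν) (h1 k' μ' ν')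
  have h3 := fun (k k' k'' : ℂ) (μ ν μ' ν' μ'' ν'' : Idx n) =>
    add_mem_G2 (h2 k k' μ ν μ' ν') (h1 k'' μ'' ν'')
  have h4 := fun (k k' k'' l : ℂ) (μ ν μ' ν' μ'' ν'' ρ σ : Idx n) =>
    add_mem_G2 (h3 k k' k'' μ ν μ' ν' μ'' ν'') (h1 l ρ σ)
  rw [h.curvature_eq (D2_mem_G2 μ ν) (D2_mem_G2 ρ σ), bracket_D2_D2]
  have hA : eta ((-1 : ℂ) • ((((Theta n θ)⁻¹ ρ ν : ℝ) : ℂ) • D2 n θ μ σ +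
      (((Theta n θ)⁻¹ σ ν : ℝ) : ℂ) • D2 n θ μ ρ + (((Theta n θ)⁻¹ ρ μ : ℝ) : ℂ) • D2 n θ ν σ +
      (((Theta n θ)⁻¹ σ μ : ℝ) : ℂ) • D2 n θ ν ρ)) =
      comm (eta (D2 n θ μ ν)) (eta (D2 n θ ρ σ)) := by
    rw [eta_smul _ (h4 _ _ _ _ _ _ _ _ _ _ _ _), eta_add (h3 _ _ _ _ _ _ _ _ _) (h1 _ _ _),
      eta_add (h2 _ _ _ _ _ _) (h1 _ _ _), eta_add (h1 _ _ _) (h1 _ _ _)]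
    simp only [eta_smul _ (D2_mem_G2 _ _), eta_D2, comm_eta2_eta2, neg_one_smul]
  rw [hA, sub_self, mul_zero, add_zero, h.covCoord_smul _ (h4 _ _ _ _ _ _ _ _ _ _ _ _),
    h.covCoord_add (h3 _ _ _ _ _ _ _ _ _) (h1 _ _ _), h.covCoord_add (h2 _ _ _ _ _ _) (h1 _ _ _),
    h.covCoord_add (h1 _ _ _) (h1 _ _ _)]
  simp only [h.covCoord_smul _ (D2_mem_G2 _ _), neg_one_smul, sub_neg_eq_add, ← add_assoc]

end Connections

/-! ### The affine symplectic Lie algebra -/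

open scoped Matrix

section AffineSymplectic

variable {n : ℕ} {θ : ℝ}

variable (n) in
/-- The enumeration of the coordinates in which `Θ` is a multiple of the standard
symplectic matrix. -/
def sumEquivIdx : Fin n ⊕ Fin n ≃ Idx n where
  toFun := Sum.elim (fun k => (0, k)) fun k => (1, k)
  invFun μ := if μ.1 = 0 then Sum.inl μ.2 else Sum.inr μ.2
  left_inv := by rintro (k | k) <;> simp
  right_inv := by
    rintro ⟨j, k⟩
    fin_cases j <;> simp

theorem Theta_submatrix : (Theta n θ).submatrix (sumEquivIdx n) (sumEquivIdx n) =
    θ • Matrix.J (Fin n) ℝ := by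
  ext (i | i) (j | j) <;>
    simp [Theta, sumEquivIdx, Matrix.J, Matrix.blockDiagonal_apply, Matrix.one_apply]
  split_ifs <;> simp

theorem Theta_inv_submatrix (hθ : θ ≠ 0) :
    (Theta n θ)⁻¹.submatrix (sumEquivIdx n) (sumEquivIdx n) = (-θ⁻¹) • Matrix.J (Fin n) ℝ := by
  rw [← Matrix.inv_submatrix_equiv, Theta_submatrix]
  refine Matrix.inv_eq_right_inv ?_
  rw [Matrix.smul_mul, Matrix.mul_smul, Matrix.J_squared, smul_smul, mul_neg, mul_inv_cancel₀ hθ]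
  simp

theorem mem_sp_iff {A : Matrix (Fin n ⊕ Fin n) (Fin n ⊕ Fin n) ℝ} :
    A ∈ LieAlgebra.Symplectic.sp (Fin n) ℝ ↔
      Aᵀ * Matrix.J (Fin n) ℝ = Matrix.J (Fin n) ℝ * -A := by
  rw [LieAlgebra.Symplectic.sp, mem_skewAdjointMatricesLieSubalgebra,
    mem_skewAdjointMatricesSubmodule]
  rfl

theorem sub_mul_mem_sp {A B : Matrix (Fin n ⊕ Fin n) (Fin n ⊕ Fin n) ℝ}
    (hA : A ∈ LieAlgebra.Symplectic.sp (Fin n) ℝ) (hB : B ∈ LieAlgebra.Symplectic.sp (Fin n) ℝ) :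
    A * B - B * A ∈ LieAlgebra.Symplectic.sp (Fin n) ℝ := by
  rw [mem_sp_iff] at *
  rw [Matrix.transpose_sub, Matrix.transpose_mul, Matrix.transpose_mul, Matrix.sub_mul,
    Matrix.mul_assoc, Matrix.mul_assoc, hA, hB, ← Matrix.mul_assoc, ← Matrix.mul_assoc, hA, hB]
  noncomm_ring

/-- The quadratic polynomial that generates the affine symplectic transformation `(A, v; 0, 0)`. -/
noncomputable def ispPoly (θ : ℝ) (M : Matrix ((Fin n ⊕ Fin n) ⊕ Unit) ((Fin n ⊕ Fin n) ⊕ Unit) ℝ) :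
    MvPolynomial (Idx n) ℂ :=
  ∑ i, ∑ j, (((M.toBlocks₁₁ * (θ • Matrix.J (Fin n) ℝ)) i j : ℝ) / 2 : ℂ) •
      (MvPolynomial.C Complex.I * (xi n θ (sumEquivIdx n i) * xi n θ (sumEquivIdx n j))) -
    ∑ i, ((M.toBlocks₁₂ i () : ℝ) : ℂ) • (MvPolynomial.C Complex.I * xi n θ (sumEquivIdx n i))

theorem totalDegree_ispPoly_le
    (M : Matrix ((Fin n ⊕ Fin n) ⊕ Unit) ((Fin n ⊕ Fin n) ⊕ Unit) ℝ) :
    (ispPoly θ M).totalDegree ≤ 2 := by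
  rw [← MvPolynomial.mem_restrictTotalDegree]
  refine sub_mem (sum_mem fun i _ => sum_mem fun j _ => Submodule.smul_mem _ _ ?_)
    (sum_mem fun i _ => Submodule.smul_mem _ _ ?_)
  · exact (MvPolynomial.mem_restrictTotalDegree _ _ _).2 (totalDegree_C_mul_xi_mul_xi_le _ _)
  · exact (MvPolynomial.mem_restrictTotalDegree _ _ _).2 (totalDegree_C_mul_xi_le _)

theorem eval_zero_ispPoly
    (M : Matrix ((Fin n ⊕ Fin n) ⊕ Unit) ((Fin n ⊕ Fin n) ⊕ Unit) ℝ) :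
    MvPolynomial.eval 0 (ispPoly θ M) = 0 := by
  simp only [ispPoly, map_sub, map_sum, MvPolynomial.smul_eval, eval_zero_C_mul_xi,
    eval_zero_C_mul_xi_mul_xi, mul_zero, Finset.sum_const_zero, sub_zero]

theorem ispPoly_add (M N : Matrix ((Fin n ⊕ Fin n) ⊕ Unit) ((Fin n ⊕ Fin n) ⊕ Unit) ℝ) :
    ispPoly θ (M + N) = ispPoly θ M + ispPoly θ N := by
  have h1 : (M + N).toBlocks₁₁ = M.toBlocks₁₁ + N.toBlocks₁₁ := rfl
  have h2 : (M + N).toBlocks₁₂ = M.toBlocks₁₂ + N.toBlocks₁₂ := rfl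
  simp only [ispPoly, h1, h2, Matrix.add_mul, Matrix.add_apply, Complex.ofReal_add, add_div,
    add_smul, Finset.sum_add_distrib]
  abel

theorem ispPoly_smul (r : ℝ) (M : Matrix ((Fin n ⊕ Fin n) ⊕ Unit) ((Fin n ⊕ Fin n) ⊕ Unit) ℝ) :
    ispPoly θ (r • M) = (r : ℂ) • ispPoly θ M := by
  have h1 : (r • M).toBlocks₁₁ = r • M.toBlocks₁₁ := rfl
  have h2 : (r • M).toBlocks₁₂ = r • M.toBlocks₁₂ := rfl
  simp only [ispPoly, h1, h2, Matrix.smul_mul, Matrix.smul_apply, smul_eq_mul, Complex.ofReal_mul,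
    mul_div_assoc, mul_smul, smul_sub, Finset.smul_sum]

variable [hθ : NeZero θ]

variable (n θ) in
/-- The representation of `isp(2n, ℝ)` by polynomials of degree at most two. -/
noncomputable def ispRep : isp n →ₗ[ℝ] Alg n θ where
  toFun u := poly θ (ispPoly θ (u : Matrix _ _ ℝ))
  map_add' u v := by
    rw [← poly_add, ← ispPoly_add]
    rfl
  map_smul' r u := by
    refine Eq.trans ?_ (poly_smul (r : ℂ) _)
    rw [← ispPoly_smul]
    rfl

theorem poly_ispPoly (M : Matrix ((Fin n ⊕ Fin n) ⊕ Unit) ((Fin n ⊕ Fin n) ⊕ Unit) ℝ) :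
    poly θ (ispPoly θ M) =
      ∑ i, ∑ j, (((M.toBlocks₁₁ * (θ • Matrix.J (Fin n) ℝ)) i j : ℝ) / 2 : ℂ) •
        eta2 n θ (sumEquivIdx n i) (sumEquivIdx n j) -
      ∑ i, ((M.toBlocks₁₂ i () : ℝ) : ℂ) • eta1 n θ (sumEquivIdx n i) := by
  rw [← polyL_apply, ispPoly]
  simp only [map_sub, map_sum, map_smul]
  rfl

theorem comm_sum_left {ι : Type*} (s : Finset ι) (f : ι → Alg n θ) (b : Alg n θ) :
    comm (∑ i ∈ s, f i) b = ∑ i ∈ s, comm (f i) b := by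
  simp only [comm, Finset.sum_mul, Finset.mul_sum, Finset.sum_sub_distrib]

theorem comm_sum_right {ι : Type*} (s : Finset ι) (f : ι → Alg n θ) (b : Alg n θ) :
    comm b (∑ i ∈ s, f i) = ∑ i ∈ s, comm b (f i) := by
  simp only [comm, Finset.sum_mul, Finset.mul_sum, Finset.sum_sub_distrib]

theorem Theta_inv_sumEquivIdx (i j : Fin n ⊕ Fin n) :
    (Theta n θ)⁻¹ (sumEquivIdx n i) (sumEquivIdx n j) = (-θ⁻¹ • Matrix.J (Fin n) ℝ) i j :=
  congrFun (congrFun (Theta_inv_submatrix hθ.out) i) j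

/-- In these coordinates Θ⁻¹ is W = -θ⁻¹J, and twice the quadratic coefficients form B = θAJ, so
that BW = A. Membership of `A` in sp makes B symmetric; hence the two halves from `comm_eta2_xi`
coincide and add up to `A`. The minus sign of the linear part of `ispPoly` turns Wᵀ into -W and
gives the constant Wv. -/
theorem comm_ispPoly_xi {A : Matrix (Fin n ⊕ Fin n) (Fin n ⊕ Fin n) ℝ}
    (hA : A ∈ LieAlgebra.Symplectic.sp (Fin n) ℝ) (v : Matrix (Fin n ⊕ Fin n) Unit ℝ)
    (ρ : Fin n ⊕ Fin n) :
    comm (poly θ (ispPoly θ (Matrix.fromBlocks A v 0 0))) (poly θ (xi n θ (sumEquivIdx n ρ))) =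
      ∑ i, (A i ρ : ℂ) • poly θ (xi n θ (sumEquivIdx n i)) +
        (((-θ⁻¹ • Matrix.J (Fin n) ℝ) * v) ρ () : ℂ) • 1 := by
  set W : Matrix (Fin n ⊕ Fin n) (Fin n ⊕ Fin n) ℝ := -θ⁻¹ • Matrix.J (Fin n) ℝ with hW
  set B : Matrix (Fin n ⊕ Fin n) (Fin n ⊕ Fin n) ℝ := A * (θ • Matrix.J (Fin n) ℝ) with hB
  have hBW : B * W = A := by
    rw [hB, hW, Matrix.mul_assoc, Matrix.smul_mul, Matrix.mul_smul (Matrix.J _ _),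
      Matrix.J_squared, smul_smul,
      mul_neg, mul_inv_cancel₀ hθ.out]
    simp
  have hA' : Aᵀ * Matrix.J (Fin n) ℝ = Matrix.J (Fin n) ℝ * -A := mem_sp_iff.1 hA
  have hBt : Bᵀ = B := by
    have h := congrArg (Matrix.J (Fin n) ℝ * · * Matrix.J (Fin n) ℝ) hA'
    simp only [Matrix.mul_assoc, Matrix.J_squared] at h
    rw [← Matrix.mul_assoc (Matrix.J (Fin n) ℝ) (Matrix.J (Fin n) ℝ), Matrix.J_squared] at h
    rw [hB, Matrix.transpose_mul, Matrix.transpose_smul, Matrix.J_transpose, Matrix.mul_smul,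
      Matrix.smul_mul]
    congr 1
    simpa using h
  have hWt : ∀ i, W i ρ = -W ρ i := fun i => by
    rw [hW, ← Theta_inv_sumEquivIdx, ← Theta_inv_sumEquivIdx, Theta_inv_apply_swap n hθ.out]
  have h1 : ∀ i, comm (eta1 n θ (sumEquivIdx n i)) (poly θ (xi n θ (sumEquivIdx n ρ))) =
      (W i ρ : ℂ) • 1 := fun i => by
    rw [eta1_eq, comm_smul_left, comm_xi_xi, smul_smul, Theta_inv_sumEquivIdx]
    congr 1
    linear_combination -(W i ρ : ℂ) * Complex.I_sq
  have h2 : ∑ i, ∑ j, (B i j * W j ρ / 2 : ℂ) • poly θ (xi n θ (sumEquivIdx n i)) =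
      ∑ i, (A i ρ / 2 : ℂ) • poly θ (xi n θ (sumEquivIdx n i)) := by
    refine Finset.sum_congr rfl fun i _ => ?_
    rw [← Finset.sum_smul, ← Finset.sum_div, ← hBW, Matrix.mul_apply]
    push_cast
    rfl
  have h3 : ∑ i, ∑ j, (B i j * W i ρ / 2 : ℂ) • poly θ (xi n θ (sumEquivIdx n j)) =
      ∑ i, (A i ρ / 2 : ℂ) • poly θ (xi n θ (sumEquivIdx n i)) := by
    rw [Finset.sum_comm, ← h2]
    refine Finset.sum_congr rfl fun i _ => Finset.sum_congr rfl fun j _ => ?_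
    rw [← hBt, Matrix.transpose_apply, hBt]
  rw [poly_ispPoly, Matrix.toBlocks_fromBlocks₁₁, Matrix.toBlocks_fromBlocks₁₂, comm_sub_left]
  simp only [comm_sum_left, comm_smul_left, comm_eta2_xi, Theta_inv_sumEquivIdx, h1, ← hB, ← hW,
    smul_add, smul_smul, Finset.sum_add_distrib]
  simp only [div_mul_eq_mul_div, h2, h3]
  rw [← Finset.sum_add_distrib, sub_eq_add_neg]
  congr 1
  · simp only [← add_smul, add_halves]
  · rw [← Finset.sum_smul, ← neg_smul, Matrix.mul_apply]
    congr 1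
    push_cast
    rw [← Finset.sum_neg_distrib]
    refine Finset.sum_congr rfl fun i _ => ?_
    rw [hWt]
    push_cast
    ring

theorem comm_ispPoly_comm_ispPoly_xi {A B : Matrix (Fin n ⊕ Fin n) (Fin n ⊕ Fin n) ℝ}
    {a b : Matrix (Fin n ⊕ Fin n) Unit ℝ} (hA : A ∈ LieAlgebra.Symplectic.sp (Fin n) ℝ)
    (hB : B ∈ LieAlgebra.Symplectic.sp (Fin n) ℝ) (ρ : Fin n ⊕ Fin n) :
    comm (poly θ (ispPoly θ (Matrix.fromBlocks A a 0 0)))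
      (comm (poly θ (ispPoly θ (Matrix.fromBlocks B b 0 0)))
        (poly θ (xi n θ (sumEquivIdx n ρ)))) =
    ∑ i, ((A * B) i ρ : ℂ) • poly θ (xi n θ (sumEquivIdx n i)) -
      (((-θ⁻¹ • Matrix.J (Fin n) ℝ) * (B * a)) ρ () : ℂ) • 1 := by
  -- The symplectic condition BᵀJ = -JB rewrites the constant as W applied to a vector, ready to be
  -- compared with the translation part of a matrix bracket.
  have h1 : (-θ⁻¹ • Matrix.J (Fin n) ℝ) * (B * a) = -(Bᵀ * ((-θ⁻¹ • Matrix.J (Fin n) ℝ) * a)) := by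
    rw [← Matrix.mul_assoc, ← Matrix.mul_assoc, Matrix.smul_mul, Matrix.mul_smul,
      mem_sp_iff.1 hB, Matrix.mul_neg, smul_neg, Matrix.neg_mul, neg_neg]
  rw [comm_ispPoly_xi hB, comm_add_right, comm_smul_right, comm_one_right, smul_zero, add_zero,
    comm_sum_right]
  simp only [comm_smul_right, comm_ispPoly_xi hA, smul_add, Finset.sum_add_distrib,
    Finset.smul_sum, smul_smul]
  rw [sub_eq_add_neg]
  congr 1
  · rw [Finset.sum_comm]
    refine Finset.sum_congr rfl fun i _ => ?_
    rw [← Finset.sum_smul, Matrix.mul_apply]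
    push_cast
    simp only [mul_comm]
  · rw [← Finset.sum_smul, ← neg_smul, h1, Matrix.neg_apply, Matrix.mul_apply]
    push_cast
    rw [neg_neg]
    rfl

/-- If the polynomial is zero, so are its commutators with the ξ's. Their values at the origin give
Wv = 0 and their gradients give AᵀW = 0, and W is invertible. -/
theorem ispRep_injective : Function.Injective (ispRep n θ) := by
  rw [← LinearMap.ker_eq_bot, LinearMap.ker_eq_bot']
  rintro ⟨_, A, hA, v, rfl⟩ h
  change poly θ (ispPoly θ (Matrix.fromBlocks A v 0 0)) = 0 at h
  set W : Matrix (Fin n ⊕ Fin n) (Fin n ⊕ Fin n) ℝ := -θ⁻¹ • Matrix.J (Fin n) ℝ with hW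
  have hWW : (θ • Matrix.J (Fin n) ℝ) * W = 1 := by
    rw [hW, Matrix.smul_mul, Matrix.mul_smul, Matrix.J_squared, smul_smul, mul_neg,
      mul_inv_cancel₀ hθ.out]
    simp
  have h1 : ∀ ρ, ∑ i, (A i ρ : ℂ) • xi n θ (sumEquivIdx n i) +
      ((W * v) ρ () : ℂ) • (1 : MvPolynomial (Idx n) ℂ) = 0 := fun ρ => by
    have h2 := comm_ispPoly_xi (θ := θ) hA v ρ
    rw [h] at h2
    apply poly_injective (θ := θ)
    rw [← polyL_apply, ← polyL_apply, map_add, map_sum, map_zero]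
    simp only [map_smul]
    refine h2.symm.trans ?_
    simp [comm]
  have hv : W * v = 0 := by
    ext ρ u
    rw [Subsingleton.elim u (), Matrix.zero_apply]
    have h2 := congrArg (MvPolynomial.eval 0) (h1 ρ)
    simpa only [map_add, map_sum, MvPolynomial.smul_eval, eval_zero_xi, mul_zero,
      Finset.sum_const_zero, zero_add, map_one, mul_one, map_zero, Complex.ofReal_eq_zero] using h2
  have hAW : Aᵀ * W = 0 := by
    ext ρ κ
    have h2 := congrArg (MvPolynomial.pderiv (sumEquivIdx n κ)) (h1 ρ)
    simp only [map_add, map_sum, Derivation.map_smul, pderiv_xi, Theta_inv_sumEquivIdx, ← hW,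
      map_zero, Derivation.map_one_eq_zero, smul_zero, add_zero] at h2
    have h3 := congrArg (MvPolynomial.eval 0) h2
    simp only [map_sum, MvPolynomial.smul_eval, MvPolynomial.eval_C, map_zero, mul_neg,
      Finset.sum_neg_distrib, neg_eq_zero] at h3
    rw [Matrix.mul_apply, Matrix.zero_apply]
    exact_mod_cast h3
  have hv0 : v = 0 := by
    rw [← Matrix.one_mul v, ← hWW, Matrix.mul_assoc, hv, Matrix.mul_zero]
  have hA0 : A = 0 := by
    rw [← Matrix.transpose_eq_zero, ← Matrix.mul_one Aᵀ,
      ← mul_eq_one_comm.1 hWW, ← Matrix.mul_assoc, hAW, Matrix.zero_mul]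
  subst hv0 hA0
  exact Subtype.ext Matrix.fromBlocks_zero

theorem eta_Ad_ispRep (u : isp n) : eta (Ad (ispRep n θ u)) = ispRep n θ u := by
  change eta (Ad (poly θ (ispPoly θ _))) = poly θ (ispPoly θ _)
  rw [eta_Ad_poly (totalDegree_ispPoly_le _), eval_zero_ispPoly, map_zero, sub_zero]

theorem Ad_ispRep_mem_G2 (u : isp n) : Ad (ispRep n θ u) ∈ G2 n θ :=
  mem_G2_iff.2 ⟨_, totalDegree_ispPoly_le _, rfl⟩

/-- Both sides are polynomials without constant term, so it suffices to compare their commutators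
with each ξ. There the Jacobi identity leaves a difference of two double commutators, with matrix
part AB - BA and translation part Ab - Ba. -/
theorem ispRep_lie (u v : isp n) : ispRep n θ ⁅u, v⁆ =
    eta (bracket (Ad (ispRep n θ u)) (Ad (ispRep n θ v))) := by
  obtain ⟨r, hr, h⟩ := exists_comm_poly_eq (θ := θ) (totalDegree_ispPoly_le (θ := θ) u.1)
    (totalDegree_ispPoly_le (θ := θ) v.1)
  change poly θ (ispPoly θ (⁅u, v⁆ : isp n).1) = eta (bracket (Ad (poly θ _)) (Ad (poly θ _)))
  rw [bracket_Ad, h, eta_Ad_poly hr]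
  have key : ∀ μ, comm (poly θ (ispPoly θ (⁅u, v⁆ : isp n).1)) (poly θ (xi n θ μ)) =
      comm (poly θ r) (poly θ (xi n θ μ)) := by
    intro μ
    obtain ⟨ρ, rfl⟩ := (sumEquivIdx n).surjective μ
    rw [← h, comm_jacobi]
    obtain ⟨_, A, hA, a, rfl⟩ := u
    obtain ⟨_, B, hB, b, rfl⟩ := v
    have hl : (⁅(⟨_, A, hA, a, rfl⟩ : isp n), (⟨_, B, hB, b, rfl⟩ : isp n)⁆ : isp n).1 =
        Matrix.fromBlocks (A * B - B * A) (A * b - B * a) 0 0 := by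
      change Matrix.fromBlocks A a 0 0 * Matrix.fromBlocks B b 0 0 -
        Matrix.fromBlocks B b 0 0 * Matrix.fromBlocks A a 0 0 = _
      simp [Matrix.fromBlocks_multiply, sub_eq_add_neg, Matrix.fromBlocks_neg,
        Matrix.fromBlocks_add]
    have hAB : A * B - B * A ∈ LieAlgebra.Symplectic.sp (Fin n) ℝ :=
      sub_mul_mem_sp hA hB
    rw [comm_ispPoly_comm_ispPoly_xi hA hB, comm_ispPoly_comm_ispPoly_xi hB hA, hl,
      comm_ispPoly_xi hAB]
    simp only [Matrix.sub_apply, Matrix.mul_sub, Complex.ofReal_sub, sub_smul,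
      Finset.sum_sub_distrib]
    abel
  have h1 := sub_C_eq_of_comm_eq key
  rw [eval_zero_ispPoly, map_zero, sub_zero] at h1
  rw [h1]

theorem range_ispRep : LinearMap.range (ispRep n θ) =
    Submodule.span ℝ (Set.range (eta1 n θ) ∪
      Set.range (fun q : Idx n × Idx n => eta2 n θ q.1 q.2)) := by
  refine le_antisymm ?_ (Submodule.span_le.2 ?_)
  · rintro _ ⟨u, rfl⟩
    change poly θ (ispPoly θ _) ∈ _
    rw [poly_ispPoly]
    refine sub_mem (sum_mem fun i _ => sum_mem fun j _ => ?_) (sum_mem fun i _ => ?_)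
    · rw [← Complex.ofReal_ofNat, ← Complex.ofReal_div]
      exact Submodule.smul_mem _ (_ : ℝ) (Submodule.subset_span (Or.inr ⟨(_, _), rfl⟩))
    · exact Submodule.smul_mem _ (_ : ℝ) (Submodule.subset_span (Or.inl ⟨_, rfl⟩))
  · rintro _ (⟨μ, rfl⟩ | ⟨⟨μ, ν⟩, rfl⟩)
    · obtain ⟨k, rfl⟩ := (sumEquivIdx n).surjective μ
      -- The entry is -1 because the linear part enters `ispPoly` with a minus sign.
      refine ⟨⟨_, 0, zero_mem _, Matrix.of fun i _ => if i = k then -1 else 0, rfl⟩, ?_⟩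
      change poly θ (ispPoly θ _) = _
      rw [poly_ispPoly, Matrix.toBlocks_fromBlocks₁₁, Matrix.toBlocks_fromBlocks₁₂]
      rw [Finset.sum_eq_single k (fun i _ h => by simp) (by simp)]
      simp
    · obtain ⟨k, rfl⟩ := (sumEquivIdx n).surjective μ
      obtain ⟨l, rfl⟩ := (sumEquivIdx n).surjective ν
      have h : ∀ k l, ∑ i, ∑ j, ((Matrix.single k l 1 i j : ℝ) / 2 : ℂ) •
          eta2 n θ (sumEquivIdx n i) (sumEquivIdx n j) =
          (1 / 2 : ℂ) • eta2 n θ (sumEquivIdx n k) (sumEquivIdx n l) := fun k l => by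
        rw [Finset.sum_eq_single k (fun i _ h => Finset.sum_eq_zero fun j _ => by
            simp [h.symm]) (by simp),
          Finset.sum_eq_single l (fun j _ h => by simp [h.symm]) (by simp)]
        simp
      -- Symmetrising puts the preimage in sp: A = -θ⁻¹BJ solves A(θJ) = B, and its two halves add
      -- up by symmetry of `eta2`. For k = l the entry 2 offsets the factor 1/2.
      let B : Matrix (Fin n ⊕ Fin n) (Fin n ⊕ Fin n) ℝ := Matrix.single k l 1 + Matrix.single l k 1
      have hBt : Bᵀ = B := by
        simp only [B, Matrix.transpose_add, Matrix.transpose_single]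
        exact add_comm _ _
      have hA : -θ⁻¹ • (B * Matrix.J (Fin n) ℝ) ∈ LieAlgebra.Symplectic.sp (Fin n) ℝ := by
        rw [mem_sp_iff, Matrix.transpose_smul, Matrix.transpose_mul, hBt, Matrix.J_transpose]
        simp [Matrix.mul_assoc]
      have hB : -θ⁻¹ • (B * Matrix.J (Fin n) ℝ) * (θ • Matrix.J (Fin n) ℝ) = B := by
        rw [Matrix.smul_mul, Matrix.mul_smul, Matrix.mul_assoc, Matrix.J_squared, smul_smul,
          neg_mul, inv_mul_cancel₀ hθ.out]
        simp
      refine ⟨⟨_, _, hA, 0, rfl⟩, ?_⟩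
      change poly θ (ispPoly θ _) = _
      rw [poly_ispPoly, Matrix.toBlocks_fromBlocks₁₁, Matrix.toBlocks_fromBlocks₁₂, hB]
      simp only [B, Matrix.add_apply, Complex.ofReal_add, add_div, add_smul,
        Finset.sum_add_distrib, h]
      rw [eta2_symm (sumEquivIdx n l), ← add_smul, add_halves]
      simp

end AffineSymplectic

end Moyal

theorem mainTheorem8 (n : ℕ) (θ : ℝ) (hθ : θ ≠ 0) :
    -- `(𝓢, ⋆)` and the unital associative algebra `(𝓜, ⋆)` are well defined, and `𝓜` contains
    -- the polynomial functions of degree at most two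
    ((∀ (a b : 𝓢(Moyal.Space n, ℂ)) (x : Moyal.Space n),
        Moyal.star n θ a b x = Moyal.starIntegral n θ a b x) ∧
      (∀ T S : Moyal.Alg n θ, Moyal.IsProduct T S (T * S)) ∧
      (∀ T S U : Moyal.Alg n θ, (T * S) * U = T * (S * U)) ∧
      (∀ T : Moyal.Alg n θ, 1 * T = T ∧ T * 1 = T) ∧
      (∀ p : MvPolynomial (Moyal.Idx n) ℂ, p.totalDegree ≤ 2 →
        ((Moyal.poly θ p : Moyal.Alg n θ) : 𝓢'(Moyal.Space n, ℂ)) = Moyal.polyDist p)) ∧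
    -- `𝓖₂` is the complex vector space spanned by the `∂_μ` and `X_{(μν)}`, and it is closed
    -- under the bracket; `η(Ad_P) = P - P(0)` is well defined, and `X = Ad_{η(X)}` on `𝓖₂`
    (Moyal.G2 n θ = (Submodule.span ℂ (Set.range (Moyal.D1 n θ) ∪
          Set.range (fun q : Moyal.Idx n × Moyal.Idx n => Moyal.D2 n θ q.1 q.2)) :
          Set (Moyal.Alg n θ → Moyal.Alg n θ)) ∧
      (∀ X ∈ Moyal.G2 n θ, ∀ Y ∈ Moyal.G2 n θ, Moyal.bracket X Y ∈ Moyal.G2 n θ) ∧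
      (∀ p : MvPolynomial (Moyal.Idx n) ℂ, p.totalDegree ≤ 2 →
        Moyal.eta (Moyal.Ad (Moyal.poly θ p)) =
          Moyal.poly θ (p - MvPolynomial.C (MvPolynomial.eval 0 p))) ∧
      (∀ X ∈ Moyal.G2 n θ, X = Moyal.Ad (Moyal.eta X))) ∧
    -- the image of `𝓖₂` under `η` is the complex span of the `η_μ`, `η_{(μν)}`; their real span,
    -- with the bracket of `𝓖₂` transported by `η`, is the Lie algebra `isp(2n, ℝ)`
    (Moyal.eta '' Moyal.G2 n θ = (Submodule.span ℂ (Set.range (Moyal.eta1 n θ) ∪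
          Set.range (fun q : Moyal.Idx n × Moyal.Idx n => Moyal.eta2 n θ q.1 q.2)) :
          Set (Moyal.Alg n θ)) ∧
      ∃ φ : Moyal.isp n →ₗ[ℝ] Moyal.Alg n θ,
        Function.Injective φ ∧
        LinearMap.range φ = Submodule.span ℝ (Set.range (Moyal.eta1 n θ) ∪
          Set.range (fun q : Moyal.Idx n × Moyal.Idx n => Moyal.eta2 n θ q.1 q.2)) ∧
        (∀ u, Moyal.Ad (φ u) ∈ Moyal.G2 n θ ∧ Moyal.eta (Moyal.Ad (φ u)) = φ u) ∧
        (∀ u v, φ ⁅u, v⁆ =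
          Moyal.eta (Moyal.bracket (Moyal.Ad (φ u)) (Moyal.Ad (φ v))))) ∧
    -- the curvature of an arbitrary connection
    (∀ nabla : (Moyal.Alg n θ → Moyal.Alg n θ) → Moyal.Alg n θ → Moyal.Alg n θ,
      Moyal.IsConnection nabla →
      ∀ (A₁ : Moyal.Idx n → Moyal.Alg n θ) (A₂ : Moyal.Idx n → Moyal.Idx n → Moyal.Alg n θ),
      (∀ μ, A₁ μ = Moyal.covCoord nabla (Moyal.D1 n θ μ)) →
      (∀ μ ν, A₂ μ ν = Moyal.covCoord nabla (Moyal.D2 n θ μ ν)) →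
      (∀ X ∈ Moyal.G2 n θ, ∀ a,
        nabla X a = Moyal.canonical X a + Moyal.covCoord nabla X * a) ∧
      (∀ μ ν m, Moyal.curvature nabla (Moyal.D1 n θ μ) (Moyal.D1 n θ ν) m =
        (Moyal.comm (A₁ μ) (A₁ ν)
          - (Complex.I * (((Moyal.Theta n θ)⁻¹ μ ν : ℝ) : ℂ)) • 1) * m) ∧
      (∀ μ ρ σ m, Moyal.curvature nabla (Moyal.D1 n θ μ) (Moyal.D2 n θ ρ σ) m =
        (Moyal.comm (A₁ μ) (A₂ ρ σ)
          - (((Moyal.Theta n θ)⁻¹ μ ρ : ℝ) : ℂ) • A₁ σ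
          - (((Moyal.Theta n θ)⁻¹ μ σ : ℝ) : ℂ) • A₁ ρ) * m) ∧
      (∀ μ ν ρ σ m, Moyal.curvature nabla (Moyal.D2 n θ μ ν) (Moyal.D2 n θ ρ σ) m =
        (Moyal.comm (A₂ μ ν) (A₂ ρ σ)
          + (((Moyal.Theta n θ)⁻¹ ρ ν : ℝ) : ℂ) • A₂ μ σ
          + (((Moyal.Theta n θ)⁻¹ σ ν : ℝ) : ℂ) • A₂ μ ρ
          + (((Moyal.Theta n θ)⁻¹ ρ μ : ℝ) : ℂ) • A₂ ν σ
          + (((Moyal.Theta n θ)⁻¹ σ μ : ℝ) : ℂ) • A₂ ν ρ) * m)) ∧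
    -- the curvature of the canonical connection
    (Moyal.IsConnection (Moyal.canonical (n := n) (θ := θ)) ∧
      (∀ μ ν m, Moyal.curvature Moyal.canonical (Moyal.D1 n θ μ) (Moyal.D1 n θ ν) m =
        (-(Complex.I * (((Moyal.Theta n θ)⁻¹ μ ν : ℝ) : ℂ))) • m) ∧
      (∀ μ ρ σ m,
        Moyal.curvature Moyal.canonical (Moyal.D1 n θ μ) (Moyal.D2 n θ ρ σ) m = 0) ∧
      (∀ μ ν ρ σ m,
        Moyal.curvature Moyal.canonical (Moyal.D2 n θ μ ν) (Moyal.D2 n θ ρ σ) m = 0)) := by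
  have : NeZero θ := ⟨hθ⟩
  have hinv := Moyal.isConnection_canonical n θ
  refine ⟨⟨Moyal.star_apply n hθ, Moyal.isProduct_mul, mul_assoc,
      fun T => ⟨one_mul T, mul_one T⟩, fun p _ => Moyal.coe_poly p⟩,
    ⟨Moyal.G2_eq_span n θ, fun X hX Y hY => Moyal.bracket_mem_G2 hX hY,
      fun p hp => Moyal.eta_Ad_poly hp, fun X hX => (Moyal.Ad_eta hX).symm⟩,
    ⟨Moyal.eta_image_G2_eq_span n θ, Moyal.ispRep n θ, Moyal.ispRep_injective, Moyal.range_ispRep,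
      fun u => ⟨Moyal.Ad_ispRep_mem_G2 u, Moyal.eta_Ad_ispRep u⟩, Moyal.ispRep_lie⟩,
    fun nabla h A₁ A₂ h₁ h₂ => ⟨fun X hX a => h.apply_eq hX a, fun μ ν m => ?_,
      fun μ ρ σ m => ?_, fun μ ν ρ σ m => ?_⟩,
    ⟨hinv, fun μ ν m => ?_, fun μ ρ σ m => ?_, fun μ ν ρ σ m => ?_⟩⟩
  · rw [h₁, h₁, h.curvature_D1_D1]
  · rw [h₁, h₁, h₁, h₂, h.curvature_D1_D2]
  · simp only [h₂, h.curvature_D2_D2]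
  · rw [hinv.curvature_D1_D1]
    simp [Moyal.covCoord_canonical, Moyal.D1_mem_G2, Moyal.comm]
  · rw [hinv.curvature_D1_D2]
    simp [Moyal.covCoord_canonical, Moyal.D1_mem_G2, Moyal.D2_mem_G2, Moyal.comm]
  · rw [hinv.curvature_D2_D2]
    simp [Moyal.covCoord_canonical, Moyal.D2_mem_G2, Moyal.comm]
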